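/- **Setting.** Let $d\in\{2,3\}$, let $D\subset\mathbb R^d$ be a bounded domain, $Y=(0,1)^d$, let $Y_1,\dots,Y_n$ be copies of $Y$, $\mathbf Y=Y_1\times\dots\times Y_n$, $\mathbf Y_i=Y_1\times\dots\times Y_i$, $\boldsymbol y=(y_1,\dots,y_n)$, $\boldsymbol y_i=(y_1,\dots,y_i)$, and let $T>0$. Curls are vector valued in $\mathbb R^3$ if $d=3$; if $d=2$, $\operatorname{curl}v=\partial_1v_2-\partial_2v_1$ is a scalar. Let $b$ be a measurable symmetric $d\times d$ matrix function and $a$ a measurable symmetric $3\times3$ matrix function if $d=3$ (a scalar function if $d=2$) on $D\times\mathbf Y$ such that, for constants $\alpha,\beta>0$, almost all $(x,\boldsymbol y)$ and all vectors $\xi,\zeta$, $$\alpha|\xi|^2\le a\xi\cdot\xi,\quad a\xi\cdot\zeta\le\beta|\xi||\zeta|,\qquad \alpha|\xi|^2\le b\xi\cdot\xi,\quad b\xi\cdot\zeta\le\beta|\xi||\zeta|.$$ Let $H=L^2(D)^d$, $H_i=L^2(D\times\mathbf Y_i)^d$, and let $W=H_0(\operatorname{curl},D)$ be the closure of $C_c^\infty(D)^d$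 in $H(\operatorname{curl},D)$. For $i=1,\dots,n$ let $$V_i=L^2(D\times\mathbf Y_{i-1};H^1_\#(Y_i)/\mathbb R),\qquad W_i=L^2(D\times\mathbf Y_{i-1};\tilde H_\#(\operatorname{curl},Y_i)),$$ where $\#$ denotes $Y$-periodicity and $\tilde H_\#(\operatorname{curl},Y_i)$ is the space of equivalence classes of elements of $H_\#(\operatorname{curl},Y_i)$ with equal curl. Put $\mathbf V=W\times W_1\times\dots\times W_n\times V_1\times\dots\times V_n$. Let $f\in L^2(0,T;H)$, $g_0\in W$ and $g_1\in H$. For $\boldsymbol u=(u_0,\{u_i\},\{\mathfrak u_i\})\in L^2(0,T;\mathbf V)$ write $U=u_0+\sum_{i=1}^n\nabla_{y_i}\mathfrak u_i$. Regard $\int_{\mathbf Y}bU\,d\boldsymbol y$ as the element $v_0\mapsto\int_D\int_{\mathbf Y}bU\cdot v_0\,d\boldsymbol y\,dx$ of $W'$, and $bU$ as the element $\mathfrak v_j\mapsto\int_D\int_{\mathbf Y}bU\cdot\nabla_{y_j}\mathfrak v_j\,d\boldsymbol y\,dx$ of $V_j'$; in the same way, with $g_1$ in place of $U$, regard $\int_{\mathbf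 Y}bg_1\,d\boldsymbol y$ and $bg_1$ as elements of $W'$ and $V_j'$. **Proposition.** There is exactly one $\boldsymbol u=(u_0,\{u_i\},\{\mathfrak u_i\})\in L^2(0,T;\mathbf V)$ with the following properties. 1. $u_0\in H^1(0,T;H)$ and $\nabla_{y_i}\mathfrak u_i\in H^1(0,T;H_i)$ for $i=1,\dots,n$. The first and second distributional time derivatives of $\int_{\mathbf Y}bU\,d\boldsymbol y$ lie in $L^2(0,T;W')$ and those of $bU$ lie in $L^2(0,T;V_j')$ for each $j=1,\dots,n$. 2. For almost every $t\in(0,T)$ and all $(v_0,\{v_i\},\{\mathfrak v_i\})\in\mathbf V$, $$\Big\langle\tfrac{\partial^2}{\partial t^2}\int_{\mathbf Y}bU\,d\boldsymbol y,v_0\Big\rangle_{W',W}+\sum_{j=1}^n\Big\langle\tfrac{\partial^2}{\partial t^2}(bU),\mathfrak v_j\Big\rangle_{V_j',V_j}+\int_D\int_{\mathbf Y}a\Big(\operatorname{curl}u_0+\sum_{i=1}^n\operatorname{curl}_{y_i}u_i\Big)\cdot\Big(\operatorname{curl}v_0+\sum_{i=1}^n\operatorname{curl}_{y_i}v_i\Big)d\boldsymbol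 y\,dx=\int_Df\cdot v_0\,dx .$$ 3. In the sense of the continuous representatives on $[0,T]$: $u_0(0)=g_0$ in $H$ and $\nabla_{y_i}\mathfrak u_i(0)=0$ in $H_i$ for $i=1,\dots,n$; further $$\tfrac{\partial}{\partial t}\int_{\mathbf Y}bU\,d\boldsymbol y\Big|_{t=0}=\int_{\mathbf Y}bg_1\,d\boldsymbol y\ \text{ in }W',\qquad \tfrac{\partial}{\partial t}(bU)\Big|_{t=0}=bg_1\ \text{ in }V_j',\quad j=1,\dots,n.$$ -/

import Mathlib

open MeasureTheory Set
open scoped ContDiff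

noncomputable section

namespace MultiscaleMaxwell

/-! ## Space dimension, coordinates and the algebraic form of the curl -/

/-- The two admissible space dimensions `d = 2` and `d = 3`. -/
inductive SpaceDim
  | two
  | three

/-- The space dimension `d`. -/
def SpaceDim.dim : SpaceDim → ℕ
  | .two => 2
  | .three => 3

/-- Number of components of a curl: a scalar for `d = 2`, a vector in `ℝ³` for `d = 3`. -/
def SpaceDim.curlDim : SpaceDim → ℕ
  | .two => 1
  | .three => 3

/-- The space `ℝ^d`. -/
abbrev Vec (s : SpaceDim) : Type := EuclideanSpace ℝ (Fin s.dim)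

/-- The space in which curls take their values (`ℝ` for `d = 2`, `ℝ³` for `d = 3`). -/
abbrev CurlVec (s : SpaceDim) : Type := EuclideanSpace ℝ (Fin s.curlDim)

/-- The Levi-Civita symbol: `(curl v)_k = ∑ i, ∑ j, eps s k i j * ∂_i v_j`.
For `d = 2` it is `ε_{ij}`, for `d = 3` it is `ε_{kij}` (indices start at `0`). -/
def eps : (s : SpaceDim) → Fin s.curlDim → Fin s.dim → Fin s.dim → ℝ
  | .two, _, i, j => (j.val : ℝ) - (i.val : ℝ)
  | .three, k, i, j =>
      ((i.val : ℝ) - (k.val : ℝ)) * ((j.val : ℝ) - (i.val : ℝ)) * ((j.val : ℝ) - (k.val : ℝ)) / 2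

/-- The partial derivative `∂_j φ` at the point `x`. -/
def pderiv {s : SpaceDim} {F : Type*} [NormedAddCommGroup F] [NormedSpace ℝ F]
    (j : Fin s.dim) (φ : Vec s → F) (x : Vec s) : F :=
  fderiv ℝ φ x (EuclideanSpace.single j 1)

/-- The classical curl of a vector field. -/
def curl {s : SpaceDim} (φ : Vec s → Vec s) (x : Vec s) : CurlVec s :=
  WithLp.toLp 2 fun k => ∑ i, ∑ j, eps s k i j * (pderiv i φ x) j

/-- In dimension two, `curl φ = ∂₁ φ₂ - ∂₂ φ₁`. -/
theorem curl_two (φ : Vec .two → Vec .two) (x : Vec .two) :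
    let D : Fin 2 → Fin 2 → ℝ := fun i j => (pderiv (s := .two) i φ x).ofLp j
    ((curl φ x).ofLp : Fin 1 → ℝ) = ![D 0 1 - D 1 0] := by
  intro D
  have h : ∀ k : Fin 1, ((curl φ x).ofLp : Fin 1 → ℝ) k =
      ∑ i : Fin 2, ∑ j : Fin 2, ((j.val : ℝ) - (i.val : ℝ)) * D i j := fun k => rfl
  refine funext fun (k : Fin 1) => (h k).trans ?_
  fin_cases k
  simp [Fin.sum_univ_two]
  ring

/-- In dimension three, the usual formula for the curl. -/
theorem curl_three (φ : Vec .three → Vec .three) (x : Vec .three) :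
    let D : Fin 3 → Fin 3 → ℝ := fun i j => (pderiv (s := .three) i φ x).ofLp j
    ((curl φ x).ofLp : Fin 3 → ℝ) = ![D 1 2 - D 2 1, D 2 0 - D 0 2, D 0 1 - D 1 0] := by
  intro D
  have h : ∀ k : Fin 3, ((curl φ x).ofLp : Fin 3 → ℝ) k = ∑ i : Fin 3, ∑ j : Fin 3,
      (((i.val : ℝ) - (k.val : ℝ)) * ((j.val : ℝ) - (i.val : ℝ))
        * ((j.val : ℝ) - (k.val : ℝ)) / 2) * D i j := fun k => rfl
  refine funext fun (k : Fin 3) => (h k).trans ?_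
  fin_cases k <;> simp [Fin.sum_univ_three] <;> ring

/-! ## The periodicity cell and the underlying measures -/

/-- The (open) unit cube `Y = (0,1)^d`. -/
def unitCell (s : SpaceDim) : Set (Vec s) := {y | ∀ i, y i ∈ Ioo (0 : ℝ) 1}

/-- Lebesgue measure on the unit cube `Y`. -/
def cellMeasure (s : SpaceDim) : Measure (Vec s) := volume.restrict (unitCell s)

/-- Points of `D × Y_1 × ⋯ × Y_k` are of this form, `(x, (y_1, …, y_k))`. -/
abbrev Pts (s : SpaceDim) (k : ℕ) : Type := Vec s × (Fin k → Vec s)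

/-- Lebesgue measure on `D`. -/
def domMeasure (s : SpaceDim) (D : Set (Vec s)) : Measure (Vec s) := volume.restrict D

/-- Lebesgue measure on `D × Y_1 × ⋯ × Y_k`. -/
def ptsMeasure (s : SpaceDim) (D : Set (Vec s)) (k : ℕ) : Measure (Pts s k) :=
  (domMeasure s D).prod (Measure.pi fun _ : Fin k => cellMeasure s)

/-- Lebesgue measure on `(D × Y_1 × ⋯ × Y_k) × Y_{k+1}`. -/
def levelMeasure (s : SpaceDim) (D : Set (Vec s)) (k : ℕ) : Measure (Pts s k × Vec s) :=
  (ptsMeasure s D k).prod (cellMeasure s)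

theorem unitCell_eq (s : SpaceDim) :
    unitCell s = (MeasurableEquiv.toLp 2 (Fin s.dim → ℝ)).symm ⁻¹'
      (Set.univ.pi fun _ => Ioo (0 : ℝ) 1) := by
  ext y
  simp [unitCell, Set.mem_pi]

theorem measurableSet_unitCell (s : SpaceDim) : MeasurableSet (unitCell s) := by
  rw [unitCell_eq]
  exact (MeasurableEquiv.measurable _)
    (MeasurableSet.univ_pi fun _ => measurableSet_Ioo)

instance (s : SpaceDim) : IsProbabilityMeasure (cellMeasure s) := by
  refine ⟨?_⟩
  rw [cellMeasure, Measure.restrict_apply MeasurableSet.univ, univ_inter, unitCell_eq,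
    (EuclideanSpace.volume_preserving_symm_measurableEquiv_toLp (Fin s.dim)).measure_preimage
      (MeasurableSet.univ_pi fun _ => measurableSet_Ioo).nullMeasurableSet,
    volume_pi_pi]
  simp

instance (s : SpaceDim) (D : Set (Vec s)) : SFinite (domMeasure s D) := by
  unfold domMeasure; infer_instance

instance (s : SpaceDim) (D : Set (Vec s)) (k : ℕ) : SFinite (ptsMeasure s D k) := by
  unfold ptsMeasure; infer_instance

instance (s : SpaceDim) (D : Set (Vec s)) (k : ℕ) : SFinite (levelMeasure s D k) := by
  unfold levelMeasure; infer_instance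

/-! ## The space `W = H₀(curl, D)` -/

/-- The space `H = L²(D)^d`. -/
abbrev HField (s : SpaceDim) (D : Set (Vec s)) : Type := Lp (Vec s) 2 (domMeasure s D)

/-- `H₀(curl, D)`: the closure of `C_c^∞(D)^d` in `H(curl, D)`. A function `u` is represented by
its graph pair `(u, curl u)`, so that the norm is `(‖u‖² + ‖curl u‖²)^{1/2}`. -/
def hZeroCurl (s : SpaceDim) (D : Set (Vec s)) :
    Submodule ℝ (WithLp 2 (Lp (Vec s) 2 (domMeasure s D) × Lp (CurlVec s) 2 (domMeasure s D))) :=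
  (Submodule.span ℝ {p | ∃ φ : Vec s → Vec s, ContDiff ℝ ∞ φ ∧ HasCompactSupport φ ∧
      tsupport φ ⊆ D ∧ p.fst =ᵐ[domMeasure s D] φ ∧
      p.snd =ᵐ[domMeasure s D] curl φ}).topologicalClosure

/-- The Hilbert space `W = H₀(curl, D)`. -/
def WSpace (s : SpaceDim) (D : Set (Vec s)) : Type := hZeroCurl s D

instance (s : SpaceDim) (D : Set (Vec s)) : NormedAddCommGroup (WSpace s D) :=
  inferInstanceAs (NormedAddCommGroup (hZeroCurl s D))

instance (s : SpaceDim) (D : Set (Vec s)) : InnerProductSpace ℝ (WSpace s D) :=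
  inferInstanceAs (InnerProductSpace ℝ (hZeroCurl s D))

/-- The inclusion `W → H`. -/
def WSpace.val (s : SpaceDim) (D : Set (Vec s)) : WSpace s D →L[ℝ] HField s D :=
  (WithLp.fstL 2 ℝ _ _).comp (hZeroCurl s D).subtypeL

/-- The operator `curl : W → L²(D)`. -/
def WSpace.curl (s : SpaceDim) (D : Set (Vec s)) :
    WSpace s D →L[ℝ] Lp (CurlVec s) 2 (domMeasure s D) :=
  (WithLp.sndL 2 ℝ _ _).comp (hZeroCurl s D).subtypeL

/-! ## Periodic Sobolev spaces on the cell -/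

/-- Smooth `Y`-periodic scalar functions. -/
structure IsPeriodicTest {s : SpaceDim} (ψ : Vec s → ℝ) : Prop where
  smooth : ContDiff ℝ ∞ ψ
  periodic : ∀ (j : Fin s.dim) (y : Vec s), ψ (y + EuclideanSpace.single j 1) = ψ y

theorem IsPeriodicTest.continuous_pderiv {s : SpaceDim} {ψ : Vec s → ℝ} (h : IsPeriodicTest ψ)
    (j : Fin s.dim) : Continuous (pderiv j ψ) :=
  (h.smooth.continuous_fderiv (by simp)).clm_apply continuous_const

theorem integrable_mul_test {s : SpaceDim} {u ψ : Vec s → ℝ} (hu : MemLp u 2 (cellMeasure s))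
    (hψ : Continuous ψ) : Integrable (fun y => u y * ψ y) (cellMeasure s) := by
  have hK : IsCompact ((fun y : Vec s => (WithLp.ofLp y : Fin s.dim → ℝ)) ⁻¹' Icc 0 1) :=
    (PiLp.homeomorph 2 (fun _ : Fin s.dim => ℝ)).isCompact_preimage.2 isCompact_Icc
  obtain ⟨C, hC⟩ := hK.exists_bound_of_continuousOn hψ.continuousOn
  refine (hu.integrable (by norm_num)).mul_bdd (c := C) hψ.aestronglyMeasurable ?_
  filter_upwards [ae_restrict_mem (measurableSet_unitCell s)] with y hy
  exact hC y ⟨fun i => (hy i).1.le, fun i => (hy i).2.le⟩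

theorem memLp_coord {α : Type*} [MeasurableSpace α] {μ : Measure α} {k : ℕ}
    {u : α → EuclideanSpace ℝ (Fin k)} (hu : MemLp u 2 μ) (i : Fin k) :
    MemLp (fun x => u x i) 2 μ :=
  (EuclideanSpace.proj i : EuclideanSpace ℝ (Fin k) →L[ℝ] ℝ).comp_memLp' hu

/-- `H¹_#(Y)`: the functions `u ∈ L²(Y)` whose gradient in the sense of periodic distributions is
in `L²(Y)^d`, represented by the pair `(u, ∇u)`. -/
def hOnePer (s : SpaceDim) :
    Submodule ℝ (WithLp 2 (Lp ℝ 2 (cellMeasure s) × Lp (Vec s) 2 (cellMeasure s))) where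
  carrier := {p | ∀ ψ : Vec s → ℝ, IsPeriodicTest ψ → ∀ k : Fin s.dim,
    ∫ y, p.snd y k * ψ y ∂(cellMeasure s) = -∫ y, p.fst y * pderiv k ψ y ∂(cellMeasure s)}
  zero_mem' := by
    intro ψ hψ k
    have h1 : (fun y => ((0 : Lp (Vec s) 2 (cellMeasure s)) : Vec s → Vec s) y k * ψ y)
        =ᵐ[cellMeasure s] fun _ => 0 := by
      filter_upwards [Lp.coeFn_zero (Vec s) 2 (cellMeasure s)] with y hy
      simp
    have h2 : (fun y => ((0 : Lp ℝ 2 (cellMeasure s)) : Vec s → ℝ) y * pderiv k ψ y)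
        =ᵐ[cellMeasure s] fun _ => 0 := by
      filter_upwards [Lp.coeFn_zero ℝ 2 (cellMeasure s)] with y hy
      simp
    simp only [WithLp.zero_fst, WithLp.zero_snd]
    rw [integral_congr_ae h1, integral_congr_ae h2]
    simp
  add_mem' := by
    intro p q hp hq ψ hψ k
    have h1 : (fun y => (p + q).snd y k * ψ y)
        =ᵐ[cellMeasure s] fun y => p.snd y k * ψ y + q.snd y k * ψ y := by
      filter_upwards [Lp.coeFn_add p.snd q.snd] with y hy
      simp only [WithLp.add_snd]
      rw [hy]
      simp [add_mul]
    have h2 : (fun y => (p + q).fst y * pderiv k ψ y)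
        =ᵐ[cellMeasure s] fun y => p.fst y * pderiv k ψ y + q.fst y * pderiv k ψ y := by
      filter_upwards [Lp.coeFn_add p.fst q.fst] with y hy
      simp only [WithLp.add_fst]
      rw [hy]
      simp [add_mul]
    rw [integral_congr_ae h1, integral_congr_ae h2,
      integral_add (integrable_mul_test (memLp_coord (Lp.memLp _) k) hψ.smooth.continuous)
        (integrable_mul_test (memLp_coord (Lp.memLp _) k) hψ.smooth.continuous),
      integral_add (integrable_mul_test (Lp.memLp _) (hψ.continuous_pderiv k))
        (integrable_mul_test (Lp.memLp _) (hψ.continuous_pderiv k)), hp ψ hψ k, hq ψ hψ k]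
    ring
  smul_mem' := by
    intro c p hp ψ hψ k
    have h1 : (fun y => (c • p).snd y k * ψ y)
        =ᵐ[cellMeasure s] fun y => c * (p.snd y k * ψ y) := by
      filter_upwards [Lp.coeFn_smul c p.snd] with y hy
      simp [hy, mul_assoc]
    have h2 : (fun y => (c • p).fst y * pderiv k ψ y)
        =ᵐ[cellMeasure s] fun y => c * (p.fst y * pderiv k ψ y) := by
      filter_upwards [Lp.coeFn_smul c p.fst] with y hy
      simp [hy, mul_assoc]
    rw [integral_congr_ae h1, integral_congr_ae h2, integral_const_mul, integral_const_mul,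
      hp ψ hψ k]
    ring

/-- `H_#(curl, Y)`: the fields `u ∈ L²(Y)^d` whose curl in the sense of periodic distributions is
square integrable on `Y`, represented by the pair `(u, curl u)`. -/
def hCurlPer (s : SpaceDim) :
    Submodule ℝ (WithLp 2 (Lp (Vec s) 2 (cellMeasure s) × Lp (CurlVec s) 2 (cellMeasure s))) where
  carrier := {p | ∀ ψ : Vec s → ℝ, IsPeriodicTest ψ → ∀ k : Fin s.curlDim,
    ∫ y, p.snd y k * ψ y ∂(cellMeasure s) =
      -∑ i, ∑ j, eps s k i j * ∫ y, p.fst y j * pderiv i ψ y ∂(cellMeasure s)}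
  zero_mem' := by
    intro ψ hψ k
    have h1 : (fun y => ((0 : Lp (CurlVec s) 2 (cellMeasure s)) : Vec s → CurlVec s) y k * ψ y)
        =ᵐ[cellMeasure s] fun _ => 0 := by
      filter_upwards [Lp.coeFn_zero (CurlVec s) 2 (cellMeasure s)] with y hy
      simp
    have h2 : ∀ i j, (fun y => ((0 : Lp (Vec s) 2 (cellMeasure s)) : Vec s → Vec s) y j
        * pderiv i ψ y) =ᵐ[cellMeasure s] fun _ => 0 := by
      intro i j
      filter_upwards [Lp.coeFn_zero (Vec s) 2 (cellMeasure s)] with y hy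
      simp
    simp only [WithLp.zero_fst, WithLp.zero_snd]
    rw [integral_congr_ae h1]
    simp only [fun i j => integral_congr_ae (h2 i j)]
    simp
  add_mem' := by
    intro p q hp hq ψ hψ k
    have h1 : (fun y => (p + q).snd y k * ψ y)
        =ᵐ[cellMeasure s] fun y => p.snd y k * ψ y + q.snd y k * ψ y := by
      filter_upwards [Lp.coeFn_add p.snd q.snd] with y hy
      simp only [WithLp.add_snd]
      rw [hy]
      simp [add_mul]
    have h2 : ∀ i j, ∫ y, (p + q).fst y j * pderiv i ψ y ∂(cellMeasure s) =
        ∫ y, p.fst y j * pderiv i ψ y ∂(cellMeasure s)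
          + ∫ y, q.fst y j * pderiv i ψ y ∂(cellMeasure s) := by
      intro i j
      rw [← integral_add
        (integrable_mul_test (memLp_coord (Lp.memLp _) j) (hψ.continuous_pderiv i))
        (integrable_mul_test (memLp_coord (Lp.memLp _) j) (hψ.continuous_pderiv i))]
      refine integral_congr_ae ?_
      filter_upwards [Lp.coeFn_add p.fst q.fst] with y hy
      simp only [WithLp.add_fst]
      rw [hy]
      simp [add_mul]
    rw [integral_congr_ae h1,
      integral_add (integrable_mul_test (memLp_coord (Lp.memLp _) k) hψ.smooth.continuous)
        (integrable_mul_test (memLp_coord (Lp.memLp _) k) hψ.smooth.continuous),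
      hp ψ hψ k, hq ψ hψ k]
    simp only [h2, mul_add, Finset.sum_add_distrib]
    ring
  smul_mem' := by
    intro c p hp ψ hψ k
    have h1 : (fun y => (c • p).snd y k * ψ y)
        =ᵐ[cellMeasure s] fun y => c * (p.snd y k * ψ y) := by
      filter_upwards [Lp.coeFn_smul c p.snd] with y hy
      simp [hy, mul_assoc]
    have h2 : ∀ i j, ∫ y, (c • p).fst y j * pderiv i ψ y ∂(cellMeasure s) =
        c * ∫ y, p.fst y j * pderiv i ψ y ∂(cellMeasure s) := by
      intro i j
      rw [← integral_const_mul]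
      refine integral_congr_ae ?_
      filter_upwards [Lp.coeFn_smul c p.fst] with y hy
      simp [hy, mul_assoc]
    rw [integral_congr_ae h1, integral_const_mul, hp ψ hψ k]
    simp only [h2, Finset.mul_sum, mul_neg]
    congr 1
    refine Finset.sum_congr rfl fun i _ => Finset.sum_congr rfl fun j _ => ?_
    ring

/-! ## The spaces `L²(D × Y_1 × ⋯ × Y_k ; S)` for `S = H¹_#(Y)` and `S = H_#(curl, Y)` -/

/-- For a space `S ⊆ L²(Y; A) × L²(Y; B)` of pairs of functions on the cell, the space
`L²(D × Y_1 × ⋯ × Y_k ; S)`: square integrable functions on `(D × Y_1 × ⋯ × Y_k) × Y`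
almost all of whose slices in the last variable are in `S`. -/
def sliceSpace (s : SpaceDim) (D : Set (Vec s)) (k : ℕ)
    {A B : Type} [NormedAddCommGroup A] [NormedSpace ℝ A] [NormedAddCommGroup B] [NormedSpace ℝ B]
    (S : Submodule ℝ (WithLp 2 (Lp A 2 (cellMeasure s) × Lp B 2 (cellMeasure s)))) :
    Submodule ℝ (WithLp 2 (Lp A 2 (levelMeasure s D k) × Lp B 2 (levelMeasure s D k))) where
  carrier := {p | ∀ᵐ z ∂(ptsMeasure s D k), ∃ v ∈ S,
    (fun y => p.fst (z, y)) =ᵐ[cellMeasure s] v.fst ∧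
    (fun y => p.snd (z, y)) =ᵐ[cellMeasure s] v.snd}
  zero_mem' := by
    have h1 := Measure.ae_ae_of_ae_prod (Lp.coeFn_zero A 2 (levelMeasure s D k))
    have h2 := Measure.ae_ae_of_ae_prod (Lp.coeFn_zero B 2 (levelMeasure s D k))
    filter_upwards [h1, h2] with z hz1 hz2
    refine ⟨0, S.zero_mem, ?_, ?_⟩
    · filter_upwards [hz1, Lp.coeFn_zero A 2 (cellMeasure s)] with y hy1 hy2
      simp only [WithLp.zero_fst]
      rw [hy1, hy2]; rfl
    · filter_upwards [hz2, Lp.coeFn_zero B 2 (cellMeasure s)] with y hy1 hy2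
      simp only [WithLp.zero_snd]
      rw [hy1, hy2]; rfl
  add_mem' := by
    intro p q hp hq
    simp only [mem_ofPred_eq] at hp hq ⊢
    have h1 := Measure.ae_ae_of_ae_prod (Lp.coeFn_add p.fst q.fst)
    have h2 := Measure.ae_ae_of_ae_prod (Lp.coeFn_add p.snd q.snd)
    filter_upwards [h1, h2, hp, hq] with z hz1 hz2 hpz hqz
    obtain ⟨v, hv, hv1, hv2⟩ := hpz
    obtain ⟨w, hw, hw1, hw2⟩ := hqz
    refine ⟨v + w, S.add_mem hv hw, ?_, ?_⟩
    · filter_upwards [hz1, hv1, hw1, Lp.coeFn_add v.fst w.fst] with y e1 e2 e3 e4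
      simp only [WithLp.add_fst]
      rw [e1, e4, Pi.add_apply, Pi.add_apply, e2, e3]
    · filter_upwards [hz2, hv2, hw2, Lp.coeFn_add v.snd w.snd] with y e1 e2 e3 e4
      simp only [WithLp.add_snd]
      rw [e1, e4, Pi.add_apply, Pi.add_apply, e2, e3]
  smul_mem' := by
    intro c p hp
    simp only [mem_ofPred_eq] at hp ⊢
    have h1 := Measure.ae_ae_of_ae_prod (Lp.coeFn_smul c p.fst)
    have h2 := Measure.ae_ae_of_ae_prod (Lp.coeFn_smul c p.snd)
    filter_upwards [h1, h2, hp] with z hz1 hz2 hpz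
    obtain ⟨v, hv, hv1, hv2⟩ := hpz
    refine ⟨c • v, S.smul_mem c hv, ?_, ?_⟩
    · filter_upwards [hz1, hv1, Lp.coeFn_smul c v.fst] with y e1 e2 e3
      simp only [WithLp.smul_fst]
      rw [e1, e3, Pi.smul_apply, Pi.smul_apply, e2]
    · filter_upwards [hz2, hv2, Lp.coeFn_smul c v.snd] with y e1 e2 e3
      simp only [WithLp.smul_snd]
      rw [e1, e3, Pi.smul_apply, Pi.smul_apply, e2]

/-- The second component (the gradient or the curl in the last variable) on `L²(⋯ ; S)`. -/
def sliceDiff (s : SpaceDim) (D : Set (Vec s)) (k : ℕ)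
    {A B : Type} [NormedAddCommGroup A] [NormedSpace ℝ A] [NormedAddCommGroup B] [NormedSpace ℝ B]
    (S : Submodule ℝ (WithLp 2 (Lp A 2 (cellMeasure s) × Lp B 2 (cellMeasure s)))) :
    sliceSpace s D k S →L[ℝ] Lp B 2 (levelMeasure s D k) :=
  (WithLp.sndL 2 ℝ _ _).comp (sliceSpace s D k S).subtypeL

instance (s : SpaceDim) (D : Set (Vec s)) (k : ℕ)
    {A B : Type} [NormedAddCommGroup A] [NormedSpace ℝ A] [NormedAddCommGroup B] [NormedSpace ℝ B]
    (S : Submodule ℝ (WithLp 2 (Lp A 2 (cellMeasure s) × Lp B 2 (cellMeasure s)))) :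
    IsClosed ((sliceDiff s D k S).ker : Set (sliceSpace s D k S)) :=
  (sliceDiff s D k S).isClosed_ker

/-- `V_{k+1} = L²(D × Y_1 × ⋯ × Y_k ; H¹_#(Y_{k+1}) / ℝ)`, as the quotient of
`L²(D × Y_1 × ⋯ × Y_k ; H¹_#(Y_{k+1}))` by the functions of vanishing `y_{k+1}`-gradient, that is
by the functions that are constant in `y_{k+1}`. -/
def VSpace (s : SpaceDim) (D : Set (Vec s)) (k : ℕ) : Type :=
  sliceSpace s D k (hOnePer s) ⧸ (sliceDiff s D k (hOnePer s)).ker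

instance (s : SpaceDim) (D : Set (Vec s)) (k : ℕ) : NormedAddCommGroup (VSpace s D k) :=
  inferInstanceAs (NormedAddCommGroup
    (sliceSpace s D k (hOnePer s) ⧸ (sliceDiff s D k (hOnePer s)).ker))

instance (s : SpaceDim) (D : Set (Vec s)) (k : ℕ) : NormedSpace ℝ (VSpace s D k) :=
  inferInstanceAs (NormedSpace ℝ
    (sliceSpace s D k (hOnePer s) ⧸ (sliceDiff s D k (hOnePer s)).ker))

/-- `W_{k+1} = L²(D × Y_1 × ⋯ × Y_k ; H̃_#(curl, Y_{k+1}))`, as the quotient of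
`L²(D × Y_1 × ⋯ × Y_k ; H_#(curl, Y_{k+1}))` by the fields of vanishing `y_{k+1}`-curl: its
elements are classes of fields with equal `y_{k+1}`-curl. -/
def WLevel (s : SpaceDim) (D : Set (Vec s)) (k : ℕ) : Type :=
  sliceSpace s D k (hCurlPer s) ⧸ (sliceDiff s D k (hCurlPer s)).ker

instance (s : SpaceDim) (D : Set (Vec s)) (k : ℕ) : NormedAddCommGroup (WLevel s D k) :=
  inferInstanceAs (NormedAddCommGroup
    (sliceSpace s D k (hCurlPer s) ⧸ (sliceDiff s D k (hCurlPer s)).ker))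

instance (s : SpaceDim) (D : Set (Vec s)) (k : ℕ) : NormedSpace ℝ (WLevel s D k) :=
  inferInstanceAs (NormedSpace ℝ
    (sliceSpace s D k (hCurlPer s) ⧸ (sliceDiff s D k (hCurlPer s)).ker))

/-- The gradient `∇_{y_{k+1}} : V_{k+1} → L²(D × Y_1 × ⋯ × Y_{k+1})^d`. -/
def VSpace.grad (s : SpaceDim) (D : Set (Vec s)) (k : ℕ) :
    VSpace s D k →L[ℝ] Lp (Vec s) 2 (levelMeasure s D k) :=
  Submodule.liftQL (sliceDiff s D k (hOnePer s)).ker (sliceDiff s D k (hOnePer s)) le_rfl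

/-- The operator `curl_{y_{k+1}} : W_{k+1} → L²(D × Y_1 × ⋯ × Y_{k+1})`. -/
def WLevel.curl (s : SpaceDim) (D : Set (Vec s)) (k : ℕ) :
    WLevel s D k →L[ℝ] Lp (CurlVec s) 2 (levelMeasure s D k) :=
  Submodule.liftQL (sliceDiff s D k (hCurlPer s)).ker (sliceDiff s D k (hCurlPer s)) le_rfl

/-! ## Viewing functions of fewer variables as functions on `D × Y_1 × ⋯ × Y_n` -/

theorem measurePreserving_base (s : SpaceDim) (D : Set (Vec s)) (n : ℕ) :
    MeasurePreserving (Prod.fst : Pts s n → Vec s) (ptsMeasure s D n) (domMeasure s D) :=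
  measurePreserving_fst

/-- The projection `(x, (y_1, …, y_n)) ↦ ((x, (y_1, …, y_i)), y_{i+1})`. -/
def levelProj (s : SpaceDim) {n : ℕ} (i : Fin n) (p : Pts s n) : Pts s i × Vec s :=
  ((p.1, fun j => p.2 (Fin.castLE i.isLt.le j)), p.2 i)

theorem measurePreserving_levelProj (s : SpaceDim) (D : Set (Vec s)) {n : ℕ} (i : Fin n) :
    MeasurePreserving (levelProj s i) (ptsMeasure s D n) (levelMeasure s D i) := by
  have h1 : MeasurePreserving
      (fun (y : Fin n → Vec s) (j : Fin (i.val + 1)) => y (Fin.castLE i.isLt j))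
      (Measure.pi fun _ => cellMeasure s) (Measure.pi fun _ => cellMeasure s) := by
    refine ⟨by fun_prop, ?_⟩
    have hind := (ProbabilityTheory.iIndepFun_pi (μ := fun _ : Fin n => cellMeasure s)
      (X := fun _ (y : Vec s) => y) (fun _ => aemeasurable_id)).precomp
        (Fin.castLE_injective (Nat.succ_le_of_lt i.isLt))
    have := (ProbabilityTheory.iIndepFun_iff_map_fun_eq_pi_map
      (fun j => (measurable_pi_apply _).aemeasurable)).1 hind
    refine this.trans ?_
    congr 1
    funext j
    exact (measurePreserving_eval (fun _ : Fin n => cellMeasure s) _).map_eq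
  have h2 := (measurePreserving_piFinSuccAbove
    (fun _ : Fin (i.val + 1) => cellMeasure s) (Fin.last i.val))
  have h3 := (Measure.measurePreserving_swap (μ := cellMeasure s)
    (ν := Measure.pi fun _ : Fin i.val => cellMeasure s)).comp (h2.comp h1)
  have h4 := (MeasurePreserving.id (domMeasure s D)).prod h3
  have h5 := (measurePreserving_prodAssoc (domMeasure s D)
    (Measure.pi fun _ : Fin i.val => cellMeasure s) (cellMeasure s)).symm.comp h4
  have he : levelProj s i = ⇑(MeasurableEquiv.prodAssoc.symm :
      Vec s × ((Fin i.val → Vec s) × Vec s) ≃ᵐ (Vec s × (Fin i.val → Vec s)) × Vec s) ∘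
      Prod.map id (Prod.swap ∘ (MeasurableEquiv.piFinSuccAbove (fun _ => Vec s)
        (Fin.last i.val)) ∘ fun (y : Fin n → Vec s) (j : Fin (i.val + 1)) =>
          y (Fin.castLE i.isLt j)) := by
    funext p
    refine Prod.ext (Prod.ext rfl (funext fun j => ?_)) rfl
    change p.2 _ = p.2 (Fin.castLE _ ((Fin.last i.val).succAbove j))
    rw [Fin.succAbove_last]
    rfl
  rw [he]
  exact h5

/-- `L²(D; A) → L²(D × Y_1 × ⋯ × Y_n; A)`. -/
def liftBase (s : SpaceDim) (D : Set (Vec s)) (n : ℕ)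
    (A : Type) [NormedAddCommGroup A] [NormedSpace ℝ A] :
    Lp A 2 (domMeasure s D) →L[ℝ] Lp A 2 (ptsMeasure s D n) :=
  (Lp.compMeasurePreservingₗᵢ ℝ Prod.fst (measurePreserving_base s D n)).toContinuousLinearMap

/-- `L²(D × Y_1 × ⋯ × Y_{i+1}; A) → L²(D × Y_1 × ⋯ × Y_n; A)`. -/
def liftLevel (s : SpaceDim) (D : Set (Vec s)) {n : ℕ} (i : Fin n)
    (A : Type) [NormedAddCommGroup A] [NormedSpace ℝ A] :
    Lp A 2 (levelMeasure s D i) →L[ℝ] Lp A 2 (ptsMeasure s D n) :=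
  (Lp.compMeasurePreservingₗᵢ ℝ (levelProj s i)
    (measurePreserving_levelProj s D i)).toContinuousLinearMap

/-! ## Coefficients -/

/-- A measurable symmetric `k × k` matrix function on `D × Y_1 × ⋯ × Y_n` that satisfies the
boundedness and coerciveness conditions with constants `α` and `β`. -/
structure Coefficient (s : SpaceDim) (D : Set (Vec s)) (n k : ℕ) (α β : ℝ) where
  toFun : Pts s n → Matrix (Fin k) (Fin k) ℝ
  aemeasurable : ∀ i j, AEMeasurable (fun p => toFun p i j) (ptsMeasure s D n)
  symm : ∀ᵐ p ∂(ptsMeasure s D n), (toFun p).IsSymm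
  coercive : ∀ᵐ p ∂(ptsMeasure s D n), ∀ ξ : EuclideanSpace ℝ (Fin k),
    α * ‖ξ‖ ^ 2 ≤ ∑ i, ∑ j, toFun p i j * ξ i * ξ j
  bounded : ∀ᵐ p ∂(ptsMeasure s D n), ∀ ξ ζ : EuclideanSpace ℝ (Fin k),
    ∑ i, ∑ j, toFun p i j * ξ i * ζ j ≤ β * ‖ξ‖ * ‖ζ‖

/-- The matrix-vector product in Euclidean coordinates. -/
def mulVecE {k : ℕ} (A : Matrix (Fin k) (Fin k) ℝ) (ξ : EuclideanSpace ℝ (Fin k)) :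
    EuclideanSpace ℝ (Fin k) :=
  WithLp.toLp 2 (A.mulVec ξ.ofLp)

namespace Coefficient

variable {s : SpaceDim} {D : Set (Vec s)} {n k : ℕ} {α β : ℝ}

theorem norm_mulVecE_le (A : Coefficient s D n k α β) :
    ∀ᵐ p ∂(ptsMeasure s D n), ∀ ξ, ‖mulVecE (A.toFun p) ξ‖ ≤ β * ‖ξ‖ := by
  filter_upwards [A.bounded] with p hp ξ
  have h := hp (mulVecE (A.toFun p) ξ) ξ
  have e : ∑ i, ∑ j, A.toFun p i j * (mulVecE (A.toFun p) ξ) i * ξ j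
      = ‖mulVecE (A.toFun p) ξ‖ ^ 2 := by
    rw [EuclideanSpace.real_norm_sq_eq]
    refine Finset.sum_congr rfl fun i _ => ?_
    have : (mulVecE (A.toFun p) ξ) i = ∑ j, A.toFun p i j * ξ j := rfl
    rw [pow_two]
    nth_rewrite 3 [this]
    rw [Finset.mul_sum]
    refine Finset.sum_congr rfl fun j _ => ?_
    ring
  rw [e] at h
  rcases (norm_nonneg (mulVecE (A.toFun p) ξ)).eq_or_lt with h0 | h0
  · rw [← h0]
    by_contra hneg
    push Not at hneg
    have h1 := hp ξ ξ
    have h2 := hp (-ξ) ξ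
    simp only [norm_neg, PiLp.neg_apply, mul_neg, neg_mul, Finset.sum_neg_distrib] at h2
    have hpos : 0 < ‖ξ‖ := by
      rcases (norm_nonneg ξ).eq_or_lt with h3 | h3
      · rw [← h3] at hneg
        simp at hneg
      · exact h3
    have h4 := mul_neg_of_neg_of_pos hneg hpos
    linarith
  · nlinarith

theorem memLp_mul (A : Coefficient s D n k α β)
    (u : Lp (EuclideanSpace ℝ (Fin k)) 2 (ptsMeasure s D n)) :
    MemLp (fun p => mulVecE (A.toFun p) (u p)) 2 (ptsMeasure s D n) := by
  refine (Lp.memLp u).of_le_mul (c := β) ?_ ?_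
  · refine AEMeasurable.aestronglyMeasurable ?_
    refine (WithLp.measurable_toLp 2 _).comp_aemeasurable ?_
    refine aemeasurable_pi_lambda _ fun i => ?_
    have hu : ∀ j, AEMeasurable (fun p => (u p).ofLp j) (ptsMeasure s D n) := fun j =>
      (memLp_coord (Lp.memLp u) j).aestronglyMeasurable.aemeasurable
    change AEMeasurable (fun p => ∑ j, A.toFun p i j * (u p).ofLp j) (ptsMeasure s D n)
    exact Finset.aemeasurable_fun_sum _ fun j _ => (A.aemeasurable i j).mul (hu j)
  · filter_upwards [A.norm_mulVecE_le] with p hp using hp _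

/-- Multiplication by the matrix function, as a bounded operator on `L²(D × Y_1 × ⋯ × Y_n)`. -/
def mulOp (A : Coefficient s D n k α β) :
    Lp (EuclideanSpace ℝ (Fin k)) 2 (ptsMeasure s D n) →L[ℝ]
      Lp (EuclideanSpace ℝ (Fin k)) 2 (ptsMeasure s D n) :=
  LinearMap.mkContinuous
    { toFun := fun u => (A.memLp_mul u).toLp _
      map_add' := by
        intro u v
        rw [← MemLp.toLp_add]
        refine MemLp.toLp_congr _ _ ?_
        filter_upwards [Lp.coeFn_add u v] with p hp
        rw [hp]
        simp [mulVecE, Matrix.mulVec_add]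
      map_smul' := by
        intro c u
        rw [RingHom.id_apply, ← MemLp.toLp_const_smul]
        refine MemLp.toLp_congr _ _ ?_
        filter_upwards [Lp.coeFn_smul c u] with p hp
        rw [hp]
        simp [mulVecE, Matrix.mulVec_smul] }
    β (by
      intro u
      refine Lp.norm_le_mul_norm_of_ae_le_mul ?_
      filter_upwards [A.norm_mulVecE_le, MemLp.coeFn_toLp (A.memLp_mul u)] with p hp hp2
      simp only [LinearMap.coe_mk, AddHom.coe_mk]
      rw [hp2]
      exact hp _)

end Coefficient

/-! ## Functions of time with values in a Banach space -/

/-- Lebesgue measure on the time interval `(0, T)`. -/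
def timeMeasure (T : ℝ) : Measure ℝ := volume.restrict (Ioo 0 T)

section Time

variable {X : Type*} [NormedAddCommGroup X] [NormedSpace ℝ X]

/-- `u ∈ L²(0, T; X)`. -/
def MemL2Time (T : ℝ) (u : ℝ → X) : Prop := MemLp u 2 (timeMeasure T)

/-- `u'` is the derivative of `u` on `(0, T)` in the sense of `X`-valued distributions. -/
def IsWeakTimeDeriv (T : ℝ) (u u' : ℝ → X) : Prop :=
  ∀ q : ℝ → ℝ, ContDiff ℝ ∞ q → HasCompactSupport q → tsupport q ⊆ Ioo 0 T →
    ∫ t, deriv q t • u t ∂(timeMeasure T) = -∫ t, q t • u' t ∂(timeMeasure T)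

/-- `u ∈ H¹(0, T; X)`. -/
def MemH1Time (T : ℝ) (u : ℝ → X) : Prop :=
  MemL2Time T u ∧ ∃ u' : ℝ → X, MemL2Time T u' ∧ IsWeakTimeDeriv T u u'

/-- `u` has a representative that is continuous on `[0, T]`, and its value at `0` is `x`. -/
def HasInitialValue (T : ℝ) (u : ℝ → X) (x : X) : Prop :=
  ∃ v : ℝ → X, ContinuousOn v (Icc 0 T) ∧ u =ᵐ[timeMeasure T] v ∧ v 0 = x

end Time

/-! ## The multiscale homogenized problem -/

section Problem

variable {s : SpaceDim} {D : Set (Vec s)} {n : ℕ} {α β : ℝ}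

/-- `u₀ + ∑ i, ∇_{y_i} 𝔲_i` in `L²(D × Y_1 × ⋯ × Y_n)^d`. -/
def totalField (u₀ : WSpace s D) (𝔲 : ∀ i : Fin n, VSpace s D i) :
    Lp (Vec s) 2 (ptsMeasure s D n) :=
  liftBase s D n _ (WSpace.val s D u₀)
    + ∑ i : Fin n, liftLevel s D i _ (VSpace.grad s D i (𝔲 i))

/-- `curl u₀ + ∑ i, curl_{y_i} u_i` in `L²(D × Y_1 × ⋯ × Y_n)`. -/
def totalCurl (u₀ : WSpace s D) (u : ∀ i : Fin n, WLevel s D i) :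
    Lp (CurlVec s) 2 (ptsMeasure s D n) :=
  liftBase s D n _ (WSpace.curl s D u₀)
    + ∑ i : Fin n, liftLevel s D i _ (WLevel.curl s D i (u i))

/-- The element `∫_Y b U dy` of `W'`, that is `v₀ ↦ ∫_D ∫_Y b U · v₀ dy dx`. -/
def pairW (b : Coefficient s D n s.dim α β) (U : Lp (Vec s) 2 (ptsMeasure s D n)) :
    StrongDual ℝ (WSpace s D) :=
  (innerSL ℝ (b.mulOp U)).comp ((liftBase s D n _).comp (WSpace.val s D))

/-- The element `b U` of `V_j'`, that is `𝔳_j ↦ ∫_D ∫_Y b U · ∇_{y_j} 𝔳_j dy dx`. -/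
def pairV (b : Coefficient s D n s.dim α β) (j : Fin n) (U : Lp (Vec s) 2 (ptsMeasure s D n)) :
    StrongDual ℝ (VSpace s D j) :=
  (innerSL ℝ (b.mulOp U)).comp ((liftLevel s D j _).comp (VSpace.grad s D j))

/-- `L²(0, T; 𝐕)`, where `𝐕 = W × W_1 × ⋯ × W_n × V_1 × ⋯ × V_n`. -/
abbrev SolutionSpace (s : SpaceDim) (D : Set (Vec s)) (n : ℕ) (T : ℝ) : Type :=
  Lp (WSpace s D) 2 (timeMeasure T) ×
    (∀ i : Fin n, Lp (WLevel s D i) 2 (timeMeasure T)) ×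
      (∀ i : Fin n, Lp (VSpace s D i) 2 (timeMeasure T))

/-- The functions of time `(u₀, {uc i}, {𝔲 i})` with values in `W`, `W_i`, `V_i` solve the
multiscale homogenized Maxwell wave problem with its initial conditions. Here `P₀`, `Q₀` are the
first and second time derivatives of `∫_Y b U dy` in `W'`, and `P j`, `Q j` those of `b U` in
`V_j'`, where `U = u₀ + ∑ i, ∇_{y_i} 𝔲_i`. -/
def IsMultiscaleSolution (T : ℝ) (a : Coefficient s D n s.curlDim α β)
    (b : Coefficient s D n s.dim α β) (f : ℝ → HField s D) (g₀ : WSpace s D) (g₁ : HField s D)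
    (u₀ : ℝ → WSpace s D) (uc : ∀ i : Fin n, ℝ → WLevel s D i)
    (𝔲 : ∀ i : Fin n, ℝ → VSpace s D i) : Prop :=
  let U : ℝ → Lp (Vec s) 2 (ptsMeasure s D n) := fun t => totalField (u₀ t) (fun i => 𝔲 i t)
  -- time regularity
  MemH1Time T (fun t => WSpace.val s D (u₀ t)) ∧
  (∀ i : Fin n, MemH1Time T (fun t => VSpace.grad s D i (𝔲 i t))) ∧
  -- initial values of `u₀` and of the gradients
  HasInitialValue T (fun t => WSpace.val s D (u₀ t)) (WSpace.val s D g₀) ∧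
  (∀ i : Fin n, HasInitialValue T (fun t => VSpace.grad s D i (𝔲 i t)) 0) ∧
  ∃ (P₀ Q₀ : ℝ → StrongDual ℝ (WSpace s D))
    (P Q : ∀ j : Fin n, ℝ → StrongDual ℝ (VSpace s D j)),
    MemL2Time T P₀ ∧ MemL2Time T Q₀ ∧ (∀ j, MemL2Time T (P j) ∧ MemL2Time T (Q j)) ∧
    IsWeakTimeDeriv T (fun t => pairW b (U t)) P₀ ∧ IsWeakTimeDeriv T P₀ Q₀ ∧
    (∀ j, IsWeakTimeDeriv T (fun t => pairV b j (U t)) (P j) ∧ IsWeakTimeDeriv T (P j) (Q j)) ∧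
    -- initial values of the first time derivatives, in `W'` and in `V_j'`
    HasInitialValue T P₀ (pairW b (liftBase s D n _ g₁)) ∧
    (∀ j, HasInitialValue T (P j) (pairV b j (liftBase s D n _ g₁))) ∧
    -- the variational equation
    ∀ᵐ t ∂(timeMeasure T), ∀ (v₀ : WSpace s D) (v : ∀ i : Fin n, WLevel s D i)
      (𝔳 : ∀ i : Fin n, VSpace s D i),
      Q₀ t v₀ + ∑ j, Q j t (𝔳 j)
          + inner ℝ (a.mulOp (totalCurl (u₀ t) (fun i => uc i t))) (totalCurl v₀ v)
        = inner ℝ (f t) (WSpace.val s D v₀)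

end Problem

end MultiscaleMaxwell

end

open MultiscaleMaxwell

open MeasureTheory Set
open scoped ContDiff

set_option linter.unusedSectionVars false

noncomputable section

namespace MultiscaleMaxwell

/-! ## Functional analysis -/

section FunctionalAnalysis

/-! The fast unknowns can be solved for explicitly, and what remains is a wave equation for `u₀`
alone.

Elimination. A periodic gradient or curl has mean zero over its cell, so by Fubini the contributions
of different levels are orthogonal in L² to each other and to functions of `x`. A Poincaré
inequality on the cell, proved with Fourier series and transferred to the parameter-dependent spaces
slice by slice, bounds a class in `V_i` or `W_i` by its gradient or curl. Hence `gradSum` and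
`curlSum` are bounded below (`norm_gradSum_ge`, `norm_curlSum_ge`), and Lax-Milgram on their closed
ranges yields bounded linear correctors `N` for `b` and `M` for `a` (`exists_corrector`): `b (e + ∇
N e)` is orthogonal to all gradients, `a (e + curl M e)` to all curls. Tested with the `v_i` alone,
the equation says that the family `u` is `M (curl u₀)`. Tested with the `𝔳_j` alone, it says `(b
U)'' = 0` in `V_j'`; with the initial conditions `b U = b (g₀ + t g₁)` there, and therefore the
family `𝔲` is `N (u₀ - g₀ - t g₁)`.

The reduced equation. Inserting this in the equation in `W'` leaves, with `z = u₀'`, the problem `(C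
z)' + A u₀ = f`, `u₀(0) = g₀`, `C z(0) = C g₁`, where `C` and `A` are the effective forms of
`exists_effective_form`. Both are symmetric, `C` is coercive on `H`, and `A(u,u) ≥ α (‖u‖² -
‖u‖_H²)`. The two problems are equivalent: `isMultiscaleSolution_of_homogenized` and
`IsMultiscaleSolution.homogenized`.

Uniqueness (`wave_unique`). As `u₀'` lies only in `H`, it is no admissible test function. The
equation is integrated once in time and tested with `u₀` itself; for zero data this shows that the
sum of `C(u₀,u₀)` and `A(∫u₀,∫u₀)` vanishes, two nonnegative terms.

Existence (`wave_exists`). Lions' projection theorem is applied on the space of pairs `(u, z)` with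
`u = ∫ z`, with the tests `(T - t) ψ'`, where `ψ` is a `C²` curve in `W` with `ψ(0) = 0`. On the
diagonal the weight turns the energy identity into an integral of the energy plus a term in `ψ'(0)`,
which gives coercivity; the equation divided by the weight is then recovered from the choice `(T -
t) ψ' = q v`. -/

/-- Lions' projection theorem: a bilinear form that is coercive on the test space admits a solution
of `E φ u = ℓ φ` for all test elements `φ`. -/
theorem exists_of_coercive_on_tests {F Φ : Type*} [NormedAddCommGroup F] [InnerProductSpace ℝ F]
    [CompleteSpace F] [AddCommGroup Φ] [Module ℝ Φ] (ι : Φ → F) (M : Φ →ₗ[ℝ] StrongDual ℝ F)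
    (N : Φ → ℝ) (ℓ : Φ →ₗ[ℝ] ℝ) {K c : ℝ} (hK : 0 ≤ K) (hc : 0 < c) (hN : ∀ φ, ‖ι φ‖ ≤ N φ)
    (hℓ : ∀ φ, |ℓ φ| ≤ K * N φ) (hM : ∀ φ, c * N φ ^ 2 ≤ M φ (ι φ)) :
    ∃ u : F, ∀ φ, M φ u = ℓ φ := by
  -- Coercivity bounds `N φ` by the dual norm of `M φ`, so `ℓ φ` is a bounded function of `M φ`
  -- alone. The gauge `N` may exceed the norm of `ι φ`, which admits functionals `ℓ` that are not
  -- continuous in that norm.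
  have hNM : ∀ φ, c * N φ ≤ ‖M φ‖ := by
    intro φ
    have h0 : 0 ≤ N φ := (norm_nonneg _).trans (hN φ)
    have h1 : M φ (ι φ) ≤ ‖M φ‖ * N φ :=
      (le_abs_self _).trans (((M φ).le_opNorm _).trans
        (mul_le_mul_of_nonneg_left (hN φ) (norm_nonneg _)))
    rcases h0.eq_or_lt with h | h
    · rw [← h]; simp
    · have := (hM φ).trans h1
      rw [pow_two, ← mul_assoc] at this
      exact le_of_mul_le_mul_right this h
  have hbd : ∀ φ, |ℓ φ| ≤ K / c * ‖M φ‖ := by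
    intro φ
    refine (hℓ φ).trans ?_
    rw [div_mul_eq_mul_div, mul_div_assoc]
    refine mul_le_mul_of_nonneg_left ?_ hK
    rw [le_div_iff₀ hc, mul_comm]
    exact hNM φ
  let R := InnerProductSpace.toDual ℝ F
  let m : Φ →ₗ[ℝ] F := 
    { toFun := fun φ => R.symm (M φ)
      map_add' := fun φ ψ => by rw [map_add, map_add]
      map_smul' := fun r φ => by rw [map_smul, map_smulₛₗ]; rfl }
  have hm : ∀ φ v, inner ℝ (m φ) v = M φ v := fun φ v => InnerProductSpace.toDual_symm_apply
  have hbd' : ∀ φ, |ℓ φ| ≤ K / c * ‖m φ‖ := fun φ => by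
    have : ‖m φ‖ = ‖M φ‖ := R.symm.norm_map _
    rw [this]
    exact hbd φ
  have hker : LinearMap.ker m ≤ LinearMap.ker ℓ := by
    intro φ hφ
    rw [LinearMap.mem_ker] at hφ ⊢
    have := hbd' φ
    rw [hφ, norm_zero, mul_zero] at this
    exact abs_nonpos_iff.1 this
  -- `ℓ` descends to the range of the Riesz representatives `m φ`; a Hahn-Banach extension of it,
  -- read as a vector of `F`, is the solution.
  let g₀ : LinearMap.range m →ₗ[ℝ] ℝ :=
    ((LinearMap.ker m).liftQ ℓ hker).comp m.quotKerEquivRange.symm.toLinearMap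
  have hg₀ : ∀ φ, g₀ ⟨m φ, LinearMap.mem_range_self m φ⟩ = ℓ φ := by
    intro φ
    have : m.quotKerEquivRange.symm ⟨m φ, LinearMap.mem_range_self m φ⟩
        = (LinearMap.ker m).mkQ φ := m.quotKerEquivRange_symm_apply_image φ _
    simp only [g₀, LinearMap.comp_apply, LinearEquiv.coe_coe, this]
    rfl
  have hg₀' : ∀ y, ‖g₀ y‖ ≤ K / c * ‖y‖ := by
    rintro ⟨_, φ, rfl⟩
    rw [hg₀]
    exact hbd' φ
  obtain ⟨G, hG, -⟩ := exists_extension_norm_eq (LinearMap.range m) (g₀.mkContinuous (K / c) hg₀')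
  refine ⟨R.symm G, fun φ => ?_⟩
  have h1 : G (m φ) = ℓ φ := (hG ⟨m φ, LinearMap.mem_range_self m φ⟩).trans (hg₀ φ)
  rw [← h1, ← hm, real_inner_comm]
  exact InnerProductSpace.toDual_symm_apply

variable {E X K : Type*} [NormedAddCommGroup E] [InnerProductSpace ℝ E]
  [NormedAddCommGroup X] [NormedSpace ℝ X]
  [NormedAddCommGroup K] [NormedSpace ℝ K]

/-- By linearity the difference `d` of two correctors satisfies `⟨B Γ d, Γ d⟩ = 0`; coercivity gives
`Γ d = 0` and the lower bound on `Γ` gives `d = 0`. -/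
theorem corrector_unique {B : E →L[ℝ] E} {Γ : X →L[ℝ] E} {α c : ℝ} (hα : 0 < α) (hc : 0 < c)
    (hB : ∀ e, α * ‖e‖ ^ 2 ≤ inner ℝ (B e) e) (hΓ : ∀ x, c * ‖x‖ ≤ ‖Γ x‖) {e : E} {x y : X}
    (hx : ∀ z, inner ℝ (B (e + Γ x)) (Γ z) = 0) (hy : ∀ z, inner ℝ (B (e + Γ y)) (Γ z) = 0) :
    x = y := by
  have h : inner ℝ (B (Γ (x - y))) (Γ (x - y)) = 0 := by
    have h1 := hx (x - y)
    have h2 := hy (x - y)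
    have h3 : Γ (x - y) = (e + Γ x) - (e + Γ y) := by rw [map_sub]; abel
    nth_rewrite 1 [h3]
    rw [map_sub, inner_sub_left, h1, h2, sub_zero]
  have h1 := hB (Γ (x - y))
  rw [h] at h1
  have h2 : ‖Γ (x - y)‖ = 0 := by
    by_contra hne
    have := mul_pos hα (pow_pos ((norm_nonneg _).lt_of_ne' hne) 2)
    linarith
  have h3 := hΓ (x - y)
  rw [h2] at h3
  have h4 : ‖x - y‖ = 0 := le_antisymm (by
    by_contra hne
    have := mul_pos hc (not_le.1 hne)
    linarith) (norm_nonneg _)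
  exact sub_eq_zero.1 (norm_eq_zero.1 h4)

/-- The lower bound makes `Γ` an isomorphism onto a closed subspace `G`. With `P` the projection on
`G`, the compression `L = P B` on `G` is coercive, Lax-Milgram inverts it, and `N = -Γ⁻¹ L⁻¹ P B`.
As a bounded linear map of `e`, `N` commutes with time integrals, so correctors inherit the time
regularity of the data. -/
theorem exists_corrector [CompleteSpace E] [CompleteSpace X] {B : E →L[ℝ] E} {Γ : X →L[ℝ] E}
    {α c : ℝ} (hα : 0 < α) (hc : 0 < c)
    (hB : ∀ e, α * ‖e‖ ^ 2 ≤ inner ℝ (B e) e) (hΓ : ∀ x, c * ‖x‖ ≤ ‖Γ x‖) :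
    ∃ N : E →L[ℝ] X, ∀ e x, inner ℝ (B (e + Γ (N e))) (Γ x) = 0 := by
  have hanti : AntilipschitzWith (Real.toNNReal c⁻¹) Γ := by
    refine AddMonoidHomClass.antilipschitz_of_bound Γ fun x => ?_
    rw [Real.coe_toNNReal _ (inv_nonneg.2 hc.le), inv_mul_eq_div, le_div_iff₀ hc, mul_comm]
    exact hΓ x
  have hcl : IsClosed (Set.range Γ) := hanti.isClosed_range Γ.uniformContinuous
  let Γ' := Γ.equivRange hanti.injective hcl
  let G : Submodule ℝ E := Γ.range
  have : CompleteSpace G := by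
    have : IsClosed (G : Set E) := hcl
    exact this.completeSpace_coe
  let L₀ : G →L[ℝ] G := G.orthogonalProjectionOnto.comp (B.comp G.subtypeL)
  let bil : G →L[ℝ] G →L[ℝ] ℝ := (innerSL ℝ).comp L₀
  have hproj : ∀ (e : E) (w : G), inner ℝ (G.orthogonalProjectionOnto e) w = inner ℝ e (w : E) := by
    intro e w
    exact Submodule.inner_orthogonalProjectionOnto_eq_of_mem_right w e
  have hcoer : IsCoercive bil := by
    refine ⟨α, hα, fun u => ?_⟩
    change α * ‖u‖ * ‖u‖ ≤ inner ℝ (G.orthogonalProjectionOnto (B u)) u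
    rw [hproj, mul_assoc, ← pow_two]
    exact hB u
  let L := hcoer.continuousLinearEquivOfBilin
  have hL : ∀ v w : G, inner ℝ (L v) w = inner ℝ (B (v : E)) (w : E) := by
    intro v w
    rw [hcoer.continuousLinearEquivOfBilin_apply]
    exact hproj _ _
  refine ⟨-((Γ'.symm : G →L[ℝ] X).comp ((L.symm : G →L[ℝ] G).comp
    (G.orthogonalProjectionOnto.comp B))), fun e x => ?_⟩
  let v : G := L.symm (G.orthogonalProjectionOnto (B e))
  have hv : Γ (Γ'.symm v) = v := by
    have : Γ' (Γ'.symm v) = v := Γ'.apply_symm_apply v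
    exact congrArg Subtype.val this
  have e1 : e + Γ ((-((Γ'.symm : G →L[ℝ] X).comp ((L.symm : G →L[ℝ] G).comp
    (G.orthogonalProjectionOnto.comp B)))) e) = e - v := by
    rw [← hv]
    simp [v, sub_eq_add_neg]
  let w : G := ⟨Γ x, by simp [G]⟩
  rw [e1, map_sub, inner_sub_left, show Γ x = (w : E) from rfl, ← hL, ← hproj]
  simp [v]

/-- The effective bilinear form that results from the elimination of the correctors. -/
theorem exists_effective_form {B : E →L[ℝ] E}
    {Γ : X →L[ℝ] E} {α : ℝ} (hα : 0 < α)
    (hB : ∀ e, α * ‖e‖ ^ 2 ≤ inner ℝ (B e) e)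
    (hsymm : ∀ u v, inner ℝ (B u) v = inner ℝ (B v) u) (N : E →L[ℝ] X)
    (hN : ∀ e x, inner ℝ (B (e + Γ (N e))) (Γ x) = 0) (l : K →L[ℝ] E) (hl : ∀ k, ‖l k‖ = ‖k‖)
    (horth : ∀ k x, inner ℝ (l k) (Γ x) = 0) :
    ∃ C : K →L[ℝ] StrongDual ℝ K,
      (∀ h v, C h v = inner ℝ (B (l h + Γ (N (l h)))) (l v)) ∧
      (∀ h v, C h v = C v h) ∧ (∀ h, α * ‖h‖ ^ 2 ≤ C h h) := by
  refine ⟨((ContinuousLinearMap.compL ℝ K E ℝ).flip l).comp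
    ((innerSL ℝ).comp (B.comp (l + Γ.comp (N.comp l)))), fun h v => rfl, ?_, ?_⟩
  · intro h v
    -- The corrector equation allows the second argument to be corrected as well, so `C` is the form
    -- of `B` on corrected fields and inherits its symmetry.
    change inner ℝ (B (l h + Γ (N (l h)))) (l v) = inner ℝ (B (l v + Γ (N (l v)))) (l h)
    have h1 := hN (l h) (N (l v))
    have h2 := hN (l v) (N (l h))
    rw [← add_zero (inner ℝ _ (l v)), ← h1, ← inner_add_right, hsymm, inner_add_right, h2, add_zero]
  · intro h
    change α * ‖h‖ ^ 2 ≤ inner ℝ (B (l h + Γ (N (l h)))) (l h)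
    rw [← add_zero (inner ℝ _ (l h)), ← hN (l h) (N (l h)), ← inner_add_right]
    -- By Pythagoras the correction can only increase the norm of `l h`.
    refine le_trans (mul_le_mul_of_nonneg_left ?_ hα.le) (hB _)
    rw [← hl h, pow_two, pow_two,
      norm_add_sq_eq_norm_sq_add_norm_sq_of_inner_eq_zero _ _ (horth h _)]
    nlinarith [norm_nonneg (Γ (N (l h)))]

end FunctionalAnalysis

/-! ## Primitives and weak derivatives of vector valued functions of time -/

section TimeCalculus

variable {X Y Z : Type*} [NormedAddCommGroup X] [NormedSpace ℝ X]
  [NormedAddCommGroup Y] [NormedSpace ℝ Y] [NormedAddCommGroup Z] [NormedSpace ℝ Z] {T : ℝ}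

instance (T : ℝ) : IsFiniteMeasure (timeMeasure T) := by
  unfold timeMeasure; infer_instance

theorem MemL2Time.integrable {u : ℝ → X} (h : MemL2Time T u) : Integrable u (timeMeasure T) :=
  MemLp.integrable (by norm_num) h

theorem integral_timeMeasure (hT : 0 ≤ T) (g : ℝ → X) :
    ∫ t, g t ∂(timeMeasure T) = ∫ t in (0 : ℝ)..T, g t := by
  rw [intervalIntegral.integral_of_le hT, timeMeasure, integral_Ioc_eq_integral_Ioo]

theorem integrableOn_Icc_of_timeMeasure {g : ℝ → X} (hg : Integrable g (timeMeasure T)) :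
    IntegrableOn g (Icc 0 T) := by
  rwa [integrableOn_Icc_iff_integrableOn_Ioo]

theorem intervalIntegrable_of_timeMeasure {g : ℝ → X} (hg : Integrable g (timeMeasure T)) {a b : ℝ}
    (ha : a ∈ Icc 0 T) (hb : b ∈ Icc 0 T) : IntervalIntegrable g volume a b :=
  ((integrableOn_Icc_of_timeMeasure hg).mono_set (uIcc_subset_Icc ha hb)).intervalIntegrable

theorem continuousOn_prim {g : ℝ → X} (hT : 0 ≤ T) (hg : Integrable g (timeMeasure T)) :
    ContinuousOn (fun t => ∫ s in (0 : ℝ)..t, g s) (Icc 0 T) := by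
  have := intervalIntegral.continuousOn_primitive_interval (a := 0) (b := T) (μ := volume) (f := g)
    (by rw [uIcc_of_le hT]; exact integrableOn_Icc_of_timeMeasure hg)
  rwa [uIcc_of_le hT] at this

theorem aestronglyMeasurable_of_continuousOn {u : ℝ → X} (hu : ContinuousOn u (Icc 0 T)) :
    AEStronglyMeasurable u (timeMeasure T) :=
  (hu.mono Ioo_subset_Icc_self).aestronglyMeasurable measurableSet_Ioo

theorem memL2Time_of_continuousOn {u : ℝ → X} (hu : ContinuousOn u (Icc 0 T)) : MemL2Time T u := by
  obtain ⟨C, hC⟩ := isCompact_Icc.exists_bound_of_continuousOn hu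
  refine MemLp.of_bound (aestronglyMeasurable_of_continuousOn hu) C ?_
  filter_upwards [ae_restrict_mem measurableSet_Ioo] with t ht
  exact hC t (Ioo_subset_Icc_self ht)

/-- Fubini's theorem on the triangle `s < t`. -/
theorem integral_bilin_prim [CompleteSpace X] [CompleteSpace Y] [CompleteSpace Z] (hT : 0 ≤ T)
    (L : Y →L[ℝ] X →L[ℝ] Z) {θ : ℝ → Y} {g : ℝ → X} (hθ : Integrable θ (timeMeasure T))
    (hg : Integrable g (timeMeasure T)) :
    ∫ t, L (θ t) (∫ s in (0 : ℝ)..t, g s) ∂(timeMeasure T)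
      = ∫ s, L (∫ t in s..T, θ t) (g s) ∂(timeMeasure T) := by
  let F : ℝ → ℝ → Z := fun t s => {p : ℝ × ℝ | p.2 < p.1}.indicator
    (fun p => L (θ p.1) (g p.2)) (t, s)
  have hF : Integrable (Function.uncurry F) ((timeMeasure T).prod (timeMeasure T)) := by
    have h := (hθ.op_fst_snd (op := fun y x => L y x) (by fun_prop) ⟨‖L‖, L.le_opNorm₂⟩ hg)
    exact h.indicator (measurableSet_lt measurable_snd measurable_fst)
  have h1 : ∀ t ∈ Ioo 0 T, L (θ t) (∫ s in (0 : ℝ)..t, g s) = ∫ s, F t s ∂(timeMeasure T) := by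
    intro t ht
    have e : ∀ s, F t s = (Iio t).indicator (fun s => L (θ t) (g s)) s := by
      intro s
      simp only [F, indicator_apply, mem_ofPred_eq, mem_Iio]
    simp_rw [e]
    rw [integral_indicator measurableSet_Iio, timeMeasure, Measure.restrict_restrict
      measurableSet_Iio, Iio_inter_Ioo, min_eq_left ht.2.le, ← integral_Ioc_eq_integral_Ioo,
      ← intervalIntegral.integral_of_le ht.1.le, ContinuousLinearMap.intervalIntegral_comp_comm]
    exact intervalIntegrable_of_timeMeasure hg ⟨le_rfl, hT⟩ (Ioo_subset_Icc_self ht)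
  have h2 : ∀ s ∈ Ioo 0 T, L (∫ t in s..T, θ t) (g s) = ∫ t, F t s ∂(timeMeasure T) := by
    intro s hs
    have e : ∀ t, F t s = (Ioi s).indicator (fun t => L.flip (g s) (θ t)) t := by
      intro t
      simp only [F, indicator_apply, mem_ofPred_eq, mem_Ioi, ContinuousLinearMap.flip_apply]
    simp_rw [e]
    rw [integral_indicator measurableSet_Ioi, timeMeasure, Measure.restrict_restrict
      measurableSet_Ioi, Ioi_inter_Ioo, max_eq_left hs.1.le, ← integral_Ioc_eq_integral_Ioo,
      ← intervalIntegral.integral_of_le hs.2.le, ContinuousLinearMap.intervalIntegral_comp_comm]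
    · rfl
    exact intervalIntegrable_of_timeMeasure hθ (Ioo_subset_Icc_self hs) ⟨hT, le_rfl⟩
  calc _ = ∫ t, ∫ s, F t s ∂(timeMeasure T) ∂(timeMeasure T) :=
        setIntegral_congr_fun measurableSet_Ioo h1
    _ = ∫ s, ∫ t, F t s ∂(timeMeasure T) ∂(timeMeasure T) := integral_integral_swap hF
    _ = _ := (setIntegral_congr_fun measurableSet_Ioo h2).symm

theorem integrable_timeMeasure_of_continuous {u : ℝ → X} (hu : Continuous u) :
    Integrable u (timeMeasure T) := (memL2Time_of_continuousOn hu.continuousOn).integrable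

theorem integrable_smul_of_continuous {q : ℝ → ℝ} (hq : Continuous q) {u : ℝ → X}
    (hu : Integrable u (timeMeasure T)) : Integrable (fun t => q t • u t) (timeMeasure T) := by
  obtain ⟨C, hC⟩ := (isCompact_Icc (a := 0) (b := T)).exists_bound_of_continuousOn hq.continuousOn
  refine hu.bdd_smul C hq.aestronglyMeasurable ?_
  filter_upwards [ae_restrict_mem measurableSet_Ioo] with t ht
  exact hC t (Ioo_subset_Icc_self ht)

/-- Integration by parts against a test function that vanishes at the final time. -/
theorem integral_deriv_smul_prim [CompleteSpace X] (hT : 0 ≤ T) {q : ℝ → ℝ} (hq : ContDiff ℝ 1 q)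
    (hqT : q T = 0) {g : ℝ → X} (hg : Integrable g (timeMeasure T)) (x : X) :
    ∫ t, deriv q t • (x + ∫ s in (0 : ℝ)..t, g s) ∂(timeMeasure T)
      = -(q 0 • x) - ∫ t, q t • g t ∂(timeMeasure T) := by
  have hd : Continuous (deriv q) := hq.continuous_deriv le_rfl
  have hint : ∀ s, ∫ t in s..T, deriv q t = - q s := by
    intro s
    rw [intervalIntegral.integral_deriv_eq_sub (fun t _ => hq.differentiable (by simp) t)
      (hd.intervalIntegrable _ _), hqT, zero_sub]
  simp_rw [smul_add]
  have h0 := continuousOn_prim hT hg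
  rw [integral_add (integrable_smul_of_continuous hd (integrable_const _))
    (integrable_smul_of_continuous hd (memL2Time_of_continuousOn h0).integrable)]
  have h1 := integral_bilin_prim hT (ContinuousLinearMap.lsmul ℝ ℝ (E := X))
    (integrable_timeMeasure_of_continuous hd) hg
  simp only [ContinuousLinearMap.lsmul_apply, hint, neg_smul] at h1
  rw [h1, integral_smul_const, integral_timeMeasure hT, hint, integral_neg, neg_smul, sub_eq_add_neg]

theorem eq_zero_of_tsupport_subset_Ioo {q : ℝ → ℝ} (hq : tsupport q ⊆ Ioo 0 T) {t : ℝ}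
    (ht : t ∉ Ioo 0 T) : q t = 0 :=
  image_eq_zero_of_notMem_tsupport fun h => ht (hq h)

theorem isWeakTimeDeriv_prim [CompleteSpace X] (hT : 0 ≤ T) {g : ℝ → X}
    (hg : Integrable g (timeMeasure T)) (x : X) :
    IsWeakTimeDeriv T (fun t => x + ∫ s in (0 : ℝ)..t, g s) g := by
  intro q hq _ hsupp
  rw [integral_deriv_smul_prim hT (hq.of_le (by simp))
    (eq_zero_of_tsupport_subset_Ioo hsupp (by simp)) hg,
    eq_zero_of_tsupport_subset_Ioo hsupp (by simp)]
  simp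

theorem IsWeakTimeDeriv.congr {u u' v v' : ℝ → X} (h : IsWeakTimeDeriv T u u')
    (hu : u =ᵐ[timeMeasure T] v) (hu' : u' =ᵐ[timeMeasure T] v') : IsWeakTimeDeriv T v v' := by
  intro q hq hc hs
  rw [← integral_congr_ae (f := fun t => deriv q t • u t), h q hq hc hs]
  · congr 1
    exact integral_congr_ae (by filter_upwards [hu'] with t ht; rw [ht])
  · filter_upwards [hu] with t ht; rw [ht]

theorem HasInitialValue.congr {u v : ℝ → X} {x : X} (h : HasInitialValue T u x)
    (hu : u =ᵐ[timeMeasure T] v) : HasInitialValue T v x := by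
  obtain ⟨w, hw, h1, h2⟩ := h
  exact ⟨w, hw, hu.symm.trans h1, h2⟩

theorem MemL2Time.congr {u v : ℝ → X} (h : MemL2Time T u)
    (hu : u =ᵐ[timeMeasure T] v) : MemL2Time T v := (memLp_congr_ae hu).1 h

theorem hasInitialValue_prim (hT : 0 ≤ T) {g : ℝ → X}
    (hg : Integrable g (timeMeasure T)) (x : X) :
    HasInitialValue T (fun t => x + ∫ s in (0 : ℝ)..t, g s) x :=
  ⟨_, continuousOn_const.add (continuousOn_prim hT hg), ae_eq_refl _, by simp⟩

theorem MemL2Time.clm (L : X →L[ℝ] Y) {u : ℝ → X} (h : MemL2Time T u) :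
    MemL2Time T (fun t => L (u t)) := L.comp_memLp' h

theorem integral_smul_eq_setIntegral {q : ℝ → ℝ} (hs : tsupport q ⊆ Ioo 0 T) (u : ℝ → X) :
    ∫ t, q t • u t = ∫ t, q t • u t ∂(timeMeasure T) := by
  rw [timeMeasure, setIntegral_eq_integral_of_forall_compl_eq_zero]
  intro t ht
  rw [eq_zero_of_tsupport_subset_Ioo hs ht, zero_smul]

/-- The fundamental lemma of the calculus of variations on `(0, T)`. -/
theorem ae_eq_zero_of_forall_test [CompleteSpace X] {d : ℝ → X} (hd : Integrable d (timeMeasure T))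
    (h : ∀ q : ℝ → ℝ, ContDiff ℝ ∞ q → HasCompactSupport q → tsupport q ⊆ Ioo 0 T →
      ∫ t, q t • d t ∂(timeMeasure T) = 0) : d =ᵐ[timeMeasure T] 0 := by
  have h1 := isOpen_Ioo.ae_eq_zero_of_integral_contDiff_smul_eq_zero (μ := volume)
    (IntegrableOn.locallyIntegrableOn (s := Ioo 0 T) hd) fun q hq hc hs => by
      rw [integral_smul_eq_setIntegral hs]
      exact h q hq hc hs
  exact (ae_restrict_iff' measurableSet_Ioo).2 h1

theorem IsWeakTimeDeriv.unique [CompleteSpace X] {u v w : ℝ → X}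
    (hv : Integrable v (timeMeasure T)) (hw : Integrable w (timeMeasure T))
    (h1 : IsWeakTimeDeriv T u v) (h2 : IsWeakTimeDeriv T u w) : v =ᵐ[timeMeasure T] w := by
  have := ae_eq_zero_of_forall_test (hv.sub hw) fun q hq hc hs => by
    have h3 := (h1 q hq hc hs).symm.trans (h2 q hq hc hs)
    simp_rw [Pi.sub_apply, smul_sub]
    rw [integral_sub (integrable_smul_of_continuous hq.continuous hv)
      (integrable_smul_of_continuous hq.continuous hw)]
    rw [neg_inj] at h3
    rw [h3, sub_self]
  filter_upwards [this] with t ht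
  exact sub_eq_zero.1 ht

theorem exists_Icc_of_tsupport_subset {q : ℝ → ℝ} (hT : 0 < T) (hc : HasCompactSupport q)
    (hs : tsupport q ⊆ Ioo 0 T) :
    ∃ a b, 0 < a ∧ b < T ∧ ∀ t, q t ≠ 0 → t ∈ Icc a b := by
  rcases (tsupport q).eq_empty_or_nonempty with h | h
  -- For empty support, `a = T` and `b = 0` satisfy the strict bounds and the membership claim is
  -- vacuous.
  · refine ⟨T, 0, hT, hT, fun t ht => ?_⟩
    have : t ∈ tsupport q := subset_tsupport _ ht
    rw [h] at this
    exact this.elim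
  · obtain ⟨a, ha, ha'⟩ := hc.isCompact.exists_isLeast h
    obtain ⟨b, hb, hb'⟩ := hc.isCompact.exists_isGreatest h
    exact ⟨a, b, (hs ha).1, (hs hb).2, fun t ht =>
      ⟨ha' (subset_tsupport _ ht), hb' (subset_tsupport _ ht)⟩⟩

theorem contDiff_prim {η : ℝ → X} [CompleteSpace X] (hη : ContDiff ℝ ∞ η) (a : ℝ) :
    ContDiff ℝ ∞ (fun t => ∫ s in a..t, η s) ∧ ∀ t, deriv (fun t => ∫ s in a..t, η s) t = η t := by
  have h : ∀ t, HasDerivAt (fun t => ∫ s in a..t, η s) (η t) t := fun t =>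
    (hη.continuous.integral_hasStrictDerivAt a t).hasDerivAt
  refine ⟨contDiff_infty_iff_deriv.2 ⟨fun t => (h t).differentiableAt, ?_⟩, fun t => (h t).deriv⟩
  rwa [show deriv (fun t => ∫ s in a..t, η s) = η from funext fun t => (h t).deriv]

/-- Every test function on `(0, T)` is the derivative of its primitive from `T`, which vanishes near
`T` but possibly not near `0`. Since the admitted `q` are free at `0`, no constant of integration is
left: the identity determines the initial value too. -/
theorem ae_eq_zero_of_forall_deriv_test [CompleteSpace X] (hT : 0 < T) {d : ℝ → X}
    (hd : Integrable d (timeMeasure T))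
    (h : ∀ q : ℝ → ℝ, ContDiff ℝ ∞ q → (∃ b < T, ∀ t, b ≤ t → q t = 0) →
      ∫ t, deriv q t • d t ∂(timeMeasure T) = 0) : d =ᵐ[timeMeasure T] 0 := by
  refine ae_eq_zero_of_forall_test hd fun θ hθ hc hs => ?_
  obtain ⟨a, b, -, hb, hab⟩ := exists_Icc_of_tsupport_subset hT hc hs
  obtain ⟨h1, h2⟩ := contDiff_prim hθ T
  have := h _ h1 ⟨b, hb, fun t ht => ?_⟩
  · simpa only [h2] using this
  · have h3 : ∀ s ∈ uIoc T t, θ s = 0 := by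
      intro s hs'
      by_contra hne
      have h4 := (hab s hne).2
      rcases le_total T t with h5 | h5
      · rw [uIoc_of_le h5] at hs'
        linarith [hs'.1]
      · rw [uIoc_of_ge h5] at hs'
        linarith [hs'.1]
    rw [intervalIntegral.integral_congr_ae (g := fun _ => 0) (by filter_upwards with s using h3 s)]
    simp

theorem exists_test_integral_eq_one (hT : 0 < T) : ∃ q : ℝ → ℝ, ContDiff ℝ ∞ q ∧
    HasCompactSupport q ∧ tsupport q ⊆ Ioo 0 T ∧ ∫ t, q t ∂(timeMeasure T) = 1 := by
  let φ : ContDiffBump (T / 2) := ⟨T / 8, T / 4, by positivity, by linarith⟩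
  have hs : tsupport (φ.normed volume) ⊆ Ioo 0 T := by
    rw [φ.tsupport_normed_eq, Real.closedBall_eq_Icc]
    intro t ht
    change t ∈ Icc (T / 2 - T / 4) (T / 2 + T / 4) at ht
    exact ⟨by linarith [ht.1], by linarith [ht.2]⟩
  refine ⟨φ.normed volume, φ.contDiff_normed, φ.hasCompactSupport_normed, hs, ?_⟩
  have := integral_smul_eq_setIntegral hs (fun _ => (1 : ℝ))
  simp only [smul_eq_mul, mul_one] at this
  rw [← this, φ.integral_normed]

/-- Du Bois-Reymond's argument: if `q₀` has integral one, then `θ - (∫ θ) q₀` is the derivative of a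
test function, so `∫ θ d = (∫ θ) c` with `c = ∫ q₀ d`. -/
theorem ae_eq_const_of_isWeakTimeDeriv_zero [CompleteSpace X] (hT : 0 < T) {d : ℝ → X}
    (hd : Integrable d (timeMeasure T))
    (h : IsWeakTimeDeriv T d (fun _ => 0)) : ∃ c, d =ᵐ[timeMeasure T] fun _ => c := by
  obtain ⟨q₀, hq₀, hc₀, hs₀, hi₀⟩ := exists_test_integral_eq_one hT
  let c := ∫ t, q₀ t • d t ∂(timeMeasure T)
  refine ⟨c, ?_⟩
  have := ae_eq_zero_of_forall_test (d := fun t => d t - c) (hd.sub (integrable_const c))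
    fun θ hθ hc hs => by
    let I := ∫ t, θ t ∂(timeMeasure T)
    let η : ℝ → ℝ := fun t => θ t - I * q₀ t
    have hη : ContDiff ℝ ∞ η := hθ.sub (contDiff_const.mul hq₀)
    obtain ⟨h1, h2⟩ := contDiff_prim hη 0
    obtain ⟨a, b, ha, hb, hab⟩ := exists_Icc_of_tsupport_subset hT hc hs
    obtain ⟨a', b', ha', hb', hab'⟩ := exists_Icc_of_tsupport_subset hT hc₀ hs₀
    have hη0 : ∀ t, t ∉ Icc (min a a') (max b b') → η t = 0 := by
      intro t ht
      have e1 : θ t = 0 := by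
        by_contra hne
        exact ht (Icc_subset_Icc (min_le_left _ _) (le_max_left _ _) (hab t hne))
      have e2 : q₀ t = 0 := by
        by_contra hne
        exact ht (Icc_subset_Icc (min_le_right _ _) (le_max_right _ _) (hab' t hne))
      simp [η, e1, e2]
    have hηI : ∫ t in (0 : ℝ)..T, η t = 0 := by
      rw [← integral_timeMeasure hT.le]
      simp only [η]
      rw [integral_sub (integrable_timeMeasure_of_continuous hθ.continuous)
        ((integrable_timeMeasure_of_continuous hq₀.continuous).const_mul I),
        integral_const_mul, hi₀]
      simp [I]
    have hz : ∀ x y, (∀ s ∈ uIoc x y, s ∉ Icc (min a a') (max b b')) →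
        ∫ s in x..y, η s = 0 := by
      intro x y hxy
      rw [intervalIntegral.integral_congr_ae (g := fun _ => 0)
        (by filter_upwards with s hs using hη0 s (hxy s hs))]
      simp
    have hcont := hη.continuous
    -- To the left of the supports nothing has been integrated yet; to the right, the total integral
    -- zero makes the primitive vanish again.
    have hout : ∀ t, t ∉ Icc (min a a') (max b b') → ∫ s in (0 : ℝ)..t, η s = 0 := by
      intro t ht
      rw [mem_Icc, not_and_or, not_le, not_le] at ht
      rcases ht with ht | ht
      · refine hz _ _ fun s hs h3 => ?_
        have : 0 < min a a' := lt_min ha ha'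
        have h4 := hs.2
        have h5 := h3.1
        rcases max_cases 0 t with h6 | h6 <;> rw [h6.1] at h4 <;> linarith
      · rw [← intervalIntegral.integral_add_adjacent_intervals (b := T)
          (hcont.intervalIntegrable _ _) (hcont.intervalIntegrable _ _), hηI, zero_add]
        refine hz _ _ fun s hs h3 => ?_
        have : max b b' < T := max_lt hb hb'
        have h4 := hs.1
        have h5 := h3.2
        rcases min_cases T t with h6 | h6 <;> rw [h6.1] at h4 <;> linarith
    have hts : tsupport (fun t => ∫ s in (0 : ℝ)..t, η s) ⊆ Icc (min a a') (max b b') :=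
      closure_minimal (fun t ht => by
        by_contra hne
        exact ht (hout t hne)) isClosed_Icc
    have h3 := h _ h1 (HasCompactSupport.intro isCompact_Icc hout)
      (hts.trans (Icc_subset_Ioo (lt_min ha ha') (max_lt hb hb')))
    simp only [h2, smul_zero, integral_zero, neg_zero, η, sub_smul, mul_smul] at h3
    rw [integral_sub (integrable_smul_of_continuous hθ.continuous hd)
      (g := fun t => I • q₀ t • d t)
      ((integrable_smul_of_continuous hq₀.continuous hd).smul I), integral_smul, sub_eq_zero] at h3
    simp_rw [smul_sub]
    rw [integral_sub (integrable_smul_of_continuous hθ.continuous hd)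
      (integrable_smul_of_continuous hθ.continuous (integrable_const _)), h3, integral_smul_const,
      sub_self]
  filter_upwards [this] with t ht
  exact sub_eq_zero.1 ht

theorem eqOn_of_ae_eq_timeMeasure (hT : 0 < T) {u v : ℝ → X} (h : u =ᵐ[timeMeasure T] v)
    (hu : ContinuousOn u (Icc 0 T)) (hv : ContinuousOn v (Icc 0 T)) : EqOn u v (Icc 0 T) := by
  refine Measure.eqOn_Icc_of_ae_eq volume hT.ne ?_ hu hv
  rwa [← restrict_Ioo_eq_restrict_Icc]

/-- A function is determined by its weak derivative and its initial value. -/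
theorem IsWeakTimeDeriv.eq_prim [CompleteSpace X] (hT : 0 < T) {u u' : ℝ → X} {x : X}
    (hu : Integrable u (timeMeasure T)) (hu' : Integrable u' (timeMeasure T))
    (h : IsWeakTimeDeriv T u u') (hx : HasInitialValue T u x) :
    u =ᵐ[timeMeasure T] fun t => x + ∫ s in (0 : ℝ)..t, u' s := by
  have hprim := isWeakTimeDeriv_prim hT.le hu' x
  obtain ⟨v, hv, huv, hv0⟩ := hx
  have hpc : ContinuousOn (fun t => x + ∫ s in (0 : ℝ)..t, u' s) (Icc 0 T) :=
    continuousOn_const.add (continuousOn_prim hT.le hu')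
  have hpi := (memL2Time_of_continuousOn hpc).integrable
  obtain ⟨c, hc⟩ := ae_eq_const_of_isWeakTimeDeriv_zero (d := fun t => u t - (x + ∫ s in (0 : ℝ)..t, u' s))
    hT (hu.sub hpi) fun q hq hcs hs => by
    have h1 := h q hq hcs hs
    have h2 := hprim q hq hcs hs
    have hd := hq.continuous_deriv (by simp)
    simp_rw [smul_sub]
    rw [integral_sub (integrable_smul_of_continuous hd hu) (integrable_smul_of_continuous hd hpi),
      h1, h2]
    simp
  -- By continuity the constant `c` may be read off at `t = 0`, where the difference is `x - x`.
  have h3 : EqOn (fun t => v t - (x + ∫ s in (0 : ℝ)..t, u' s)) (fun _ => c) (Icc 0 T) := by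
    refine eqOn_of_ae_eq_timeMeasure hT ?_ (hv.sub hpc) continuousOn_const
    filter_upwards [huv, hc] with t h1 h2
    rw [← h1, h2]
  have h4 := h3 (left_mem_Icc.2 hT.le)
  simp [hv0] at h4
  filter_upwards [hc] with t h1
  rw [← h4, sub_eq_zero] at h1
  exact h1

/-- The energy identity for a symmetric bilinear form along a primitive. -/
theorem bilin_prim_self [CompleteSpace X] {L : X →L[ℝ] X →L[ℝ] ℝ} (hL : ∀ x y, L x y = L y x)
    {η : ℝ → X} (hη : Integrable η (timeMeasure T)) (hT : 0 ≤ T) :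
    L (∫ s in (0 : ℝ)..T, η s) (∫ s in (0 : ℝ)..T, η s)
      = 2 * ∫ t, L (η t) (∫ s in (0 : ℝ)..t, η s) ∂(timeMeasure T) := by
  have h1 := integral_bilin_prim hT L hη hη
  have hi : Integrable (fun t => L (η t) (∫ s in (0 : ℝ)..t, η s)) (timeMeasure T) := by
    have hc := continuousOn_prim hT hη
    obtain ⟨C, hC⟩ := isCompact_Icc.exists_bound_of_continuousOn hc
    refine Integrable.mono' (hη.norm.const_mul (‖L‖ * C)) ?_ ?_
    · exact L.aestronglyMeasurable_comp₂ hη.aestronglyMeasurable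
        (aestronglyMeasurable_of_continuousOn hc)
    · filter_upwards [ae_restrict_mem measurableSet_Ioo] with t ht
      refine (L.le_opNorm₂ _ _).trans ?_
      have := hC t (Ioo_subset_Icc_self ht)
      nlinarith [mul_nonneg (norm_nonneg L) (norm_nonneg (η t))]
  -- Writing `∫_s^T` as `∫_0^T - ∫_0^s` and using symmetry, the Fubini identity says that the wanted
  -- integral is the value at the full primitives minus that integral itself.
  have h2 : ∀ s ∈ Ioo 0 T, L (∫ t in s..T, η t) (η s)
      = L (η s) (∫ t in (0 : ℝ)..T, η t) - L (η s) (∫ t in (0 : ℝ)..s, η t) := by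
    intro s hs
    have h0 : (0 : ℝ) ∈ Icc 0 T := ⟨le_rfl, hT⟩
    have hT' : T ∈ Icc 0 T := ⟨hT, le_rfl⟩
    have hs' := Ioo_subset_Icc_self hs
    rw [← intervalIntegral.integral_interval_sub_left
      (intervalIntegrable_of_timeMeasure hη h0 hT') (intervalIntegrable_of_timeMeasure hη h0 hs'),
      hL, map_sub]
  rw [show (∫ s, L (∫ t in s..T, η t) (η s) ∂(timeMeasure T)) = _ from
    setIntegral_congr_fun measurableSet_Ioo h2] at h1
  have hi2 : Integrable (fun s => L (η s) (∫ t in (0 : ℝ)..T, η t)) (timeMeasure T) :=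
    ((L.flip _).integrable_comp hη)
  rw [show (∫ s in Ioo 0 T, (L (η s) (∫ t in (0 : ℝ)..T, η t) - L (η s) (∫ t in (0 : ℝ)..s, η t)))
    = _ from integral_sub hi2 hi] at h1
  have h3 : ∫ s, L (η s) (∫ t in (0 : ℝ)..T, η t) ∂(timeMeasure T)
      = L (∫ s in (0 : ℝ)..T, η s) (∫ s in (0 : ℝ)..T, η s) := by
    have := (L.flip (∫ t in (0 : ℝ)..T, η t)).integral_comp_comm hη
    rw [integral_timeMeasure hT η] at this
    exact this
  have h4 : ∫ s in Ioo 0 T, L (η s) (∫ t in (0 : ℝ)..T, η t)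
      = L (∫ s in (0 : ℝ)..T, η s) (∫ s in (0 : ℝ)..T, η s) := h3
  have h5 : ∫ t in Ioo 0 T, L (η t) (∫ s in (0 : ℝ)..t, η s)
    = ∫ t, L (η t) (∫ s in (0 : ℝ)..t, η s) ∂(timeMeasure T) := rfl
  rw [h4, h5] at h1
  linarith

end TimeCalculus

/-! ## The abstract wave equation `(C u')' + A u = f` -/

section Wave

variable {X : Type*} [NormedAddCommGroup X] [InnerProductSpace ℝ X] {T : ℝ}

/-- The class of a continuous function in `L²(0, T; X)`. -/
def toL2 (T : ℝ) : C(ℝ, X) →ₗ[ℝ] Lp X 2 (timeMeasure T) where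
  toFun φ := MemLp.toLp φ (memL2Time_of_continuousOn φ.continuous.continuousOn)
  map_add' _ _ := rfl
  map_smul' _ _ := rfl

theorem coeFn_toL2 (φ : C(ℝ, X)) : toL2 T φ =ᵐ[timeMeasure T] φ :=
  MemLp.coeFn_toLp (memL2Time_of_continuousOn φ.continuous.continuousOn)

theorem inner_toL2 (φ : C(ℝ, X)) (F : Lp X 2 (timeMeasure T)) :
    inner ℝ (toL2 T φ) F = ∫ t, inner ℝ (φ t) (F t) ∂(timeMeasure T) := by
  rw [L2.inner_def]
  refine integral_congr_ae ?_
  filter_upwards [coeFn_toL2 (T := T) φ] with t ht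
  rw [ht]

theorem inner_toL2_toL2 (φ ψ : C(ℝ, X)) :
    inner ℝ (toL2 T φ) (toL2 T ψ) = ∫ t, inner ℝ (φ t) (ψ t) ∂(timeMeasure T) := by
  rw [inner_toL2]
  refine integral_congr_ae ?_
  filter_upwards [coeFn_toL2 (T := T) ψ] with t ht
  rw [ht]

theorem norm_sq_toL2 (φ : C(ℝ, X)) :
    ‖toL2 T φ‖ ^ 2 = ∫ t, ‖φ t‖ ^ 2 ∂(timeMeasure T) := by
  rw [← real_inner_self_eq_norm_sq, inner_toL2_toL2]
  simp_rw [real_inner_self_eq_norm_sq]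

variable {W H : Type*} [NormedAddCommGroup W] [InnerProductSpace ℝ W] [CompleteSpace W]
  [NormedAddCommGroup H] [InnerProductSpace ℝ H] [CompleteSpace H]

/-- Uniqueness for the abstract wave equation. -/
theorem wave_unique (hT : 0 < T) {J : W →L[ℝ] H} {C : H →L[ℝ] StrongDual ℝ H}
    {A : W →L[ℝ] StrongDual ℝ W} {γ κ : ℝ} (hγ : 0 < γ) (hκ : 0 < κ)
    (hCs : ∀ x y, C x y = C y x) (hC : ∀ x, γ * ‖x‖ ^ 2 ≤ C x x)
    (hAs : ∀ x y, A x y = A y x) (hA : ∀ x, κ * (‖x‖ ^ 2 - ‖J x‖ ^ 2) ≤ A x x)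
    (hJ : ∀ x, ‖J x‖ ≤ ‖x‖) {u : ℝ → W} {z : ℝ → H} (hu : Integrable u (timeMeasure T))
    (hz : Integrable z (timeMeasure T))
    (h1 : (fun t => J (u t)) =ᵐ[timeMeasure T] fun t => ∫ s in (0 : ℝ)..t, z s)
    (h2 : (fun t => (C (z t)).comp J) =ᵐ[timeMeasure T] fun t => -∫ s in (0 : ℝ)..t, A (u s)) :
    u =ᵐ[timeMeasure T] 0 := by
  have hA0 : ∀ x, 0 ≤ A x x := fun x => le_trans (mul_nonneg hκ.le (sub_nonneg.2
    (pow_le_pow_left₀ (norm_nonneg _) (hJ x) 2))) (hA x)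
  have h0 : (0 : ℝ) ∈ Icc 0 T := ⟨le_rfl, hT.le⟩
  have hprim : ∀ t ∈ Ioo 0 T, ∫ s in (0 : ℝ)..t, A (u s) = A (∫ s in (0 : ℝ)..t, u s) :=
    fun t ht => A.intervalIntegral_comp_comm
      (intervalIntegrable_of_timeMeasure hu h0 (Ioo_subset_Icc_self ht))
  -- The integrated equation tested with `u t` reads `C (z) (∫ z) + A (u) (∫ u) = 0`. Its integral
  -- over `(0, τ)` is half the sum of the two quadratic forms at the primitives, both of which are
  -- nonnegative.
  have henergy : ∀ τ ∈ Ioo 0 T, ∫ s in (0 : ℝ)..τ, z s = 0 ∧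
      A (∫ s in (0 : ℝ)..τ, u s) (∫ s in (0 : ℝ)..τ, u s) = 0 := by
    intro τ hτ
    have hle : timeMeasure τ ≤ timeMeasure T :=
      Measure.restrict_mono_set _ (Ioo_subset_Ioo_right hτ.2.le)
    have e1 := bilin_prim_self hCs (hz.mono_measure hle) hτ.1.le
    have e2 := bilin_prim_self hAs (hu.mono_measure hle) hτ.1.le
    have e3 : ∫ t, C (z t) (∫ s in (0 : ℝ)..t, z s) ∂(timeMeasure τ)
        = -∫ t, A (u t) (∫ s in (0 : ℝ)..t, u s) ∂(timeMeasure τ) := by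
      rw [← integral_neg]
      refine integral_congr_ae ?_
      filter_upwards [ae_mono hle h1, ae_mono hle h2, ae_restrict_mem measurableSet_Ioo] with
        t ht1 ht2 ht
      rw [← ht1]
      have := congrArg (fun l => l (u t)) ht2
      simp only [ContinuousLinearMap.comp_apply, neg_apply] at this
      rw [this, hprim t ⟨ht.1, ht.2.trans hτ.2⟩, hAs]
    have hsum : C (∫ s in (0 : ℝ)..τ, z s) (∫ s in (0 : ℝ)..τ, z s)
        + A (∫ s in (0 : ℝ)..τ, u s) (∫ s in (0 : ℝ)..τ, u s) = 0 := by
      rw [e1, e2, e3]; ring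
    have h3 := hC (∫ s in (0 : ℝ)..τ, z s)
    have h4 := hA0 (∫ s in (0 : ℝ)..τ, u s)
    have h5 : 0 ≤ γ * ‖∫ s in (0 : ℝ)..τ, z s‖ ^ 2 := by positivity
    refine ⟨?_, by linarith⟩
    have h6 : γ * ‖∫ s in (0 : ℝ)..τ, z s‖ ^ 2 = 0 := by linarith
    simpa [hγ.ne'] using h6
  -- The form `A` controls `∫ u` only up to its image under `J`; that image vanishes because `J u =
  -- ∫ z = 0` almost everywhere.
  have hkey : ∀ τ ∈ Ioo 0 T, ∫ s in (0 : ℝ)..τ, u s = 0 := by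
    intro τ hτ
    have hle : timeMeasure τ ≤ timeMeasure T :=
      Measure.restrict_mono_set _ (Ioo_subset_Ioo_right hτ.2.le)
    have hJu : J (∫ s in (0 : ℝ)..τ, u s) = 0 := by
      rw [← ContinuousLinearMap.intervalIntegral_comp_comm _
        (intervalIntegrable_of_timeMeasure hu h0 (Ioo_subset_Icc_self hτ)),
        ← integral_timeMeasure hτ.1.le]
      refine integral_eq_zero_of_ae ?_
      filter_upwards [ae_mono hle h1, ae_restrict_mem measurableSet_Ioo] with t ht1 ht
      rw [ht1]
      exact (henergy t ⟨ht.1, ht.2.trans hτ.2⟩).1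
    have h3 := hA (∫ s in (0 : ℝ)..τ, u s)
    rw [(henergy τ hτ).2, hJu, norm_zero] at h3
    have h4 : 0 ≤ κ * ‖∫ s in (0 : ℝ)..τ, u s‖ ^ 2 := by positivity
    have h5 : κ * ‖∫ s in (0 : ℝ)..τ, u s‖ ^ 2 = 0 := by nlinarith
    simpa [hκ.ne'] using h5
  have hw := isWeakTimeDeriv_prim hT.le hu 0
  have hw0 : IsWeakTimeDeriv T (fun t => (0 : W) + ∫ s in (0 : ℝ)..t, u s) (fun _ => 0) := by
    have : IsWeakTimeDeriv T (fun _ => (0 : W)) (fun _ => 0) := by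
      intro q _ _ _
      simp
    refine this.congr ?_ (ae_eq_refl _)
    filter_upwards [ae_restrict_mem measurableSet_Ioo] with t ht
    rw [hkey t ht, add_zero]
  exact hw.unique hu (integrable_zero _ _ _) hw0


/-- Curves `ψ` of class `C²` with `ψ(0) = 0`, given by `(ψ, ψ', ψ'')`. -/
def testCurves (W : Type*) [NormedAddCommGroup W] [InnerProductSpace ℝ W] :
    Submodule ℝ (C(ℝ, W) × C(ℝ, W) × C(ℝ, W)) where
  carrier := {ψ | (∀ t, HasDerivAt ψ.1 (ψ.2.1 t) t) ∧ (∀ t, HasDerivAt ψ.2.1 (ψ.2.2 t) t) ∧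
    ψ.1 0 = 0}
  zero_mem' := ⟨fun t => hasDerivAt_const t 0, fun t => hasDerivAt_const t 0, rfl⟩
  add_mem' := fun {φ ψ} hφ hψ => ⟨fun t => (hφ.1 t).add (hψ.1 t),
    fun t => (hφ.2.1 t).add (hψ.2.1 t), by
      change φ.1 0 + ψ.1 0 = 0
      rw [hφ.2.2, hψ.2.2, add_zero]⟩
  smul_mem' := fun c ψ hψ => ⟨fun t => (hψ.1 t).const_smul c,
    fun t => (hψ.2.1 t).const_smul c, by
      change c • ψ.1 0 = 0
      rw [hψ.2.2, smul_zero]⟩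

/-- The pairs `(u, z)` with `J u = ∫ z`, in a weak form. -/
def waveSpace (T : ℝ) (J : W →L[ℝ] H) :
    Submodule ℝ (WithLp 2 (Lp W 2 (timeMeasure T) × Lp H 2 (timeMeasure T))) :=
  (Submodule.span ℝ {p | ∃ (q q' : C(ℝ, ℝ)) (h : H), (∀ t, HasDerivAt q (q' t) t) ∧ q T = 0 ∧
    p = WithLp.toLp 2 (toL2 T ⟨fun t => q' t • J.adjoint h, by fun_prop⟩,
      toL2 T ⟨fun t => q t • h, by fun_prop⟩)})ᗮ

/-- The defining orthogonality unfolds to the integration by parts `∫ q' J u + ∫ q z = 0`. Because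
`q` is free at `0`, it encodes the initial value `J u (0) = 0` along with `(J u)' = z`, while an
orthogonal complement is automatically closed. -/
theorem mem_waveSpace_iff {J : W →L[ℝ] H}
    {p : WithLp 2 (Lp W 2 (timeMeasure T) × Lp H 2 (timeMeasure T))} :
    p ∈ waveSpace T J ↔ ∀ (q q' : C(ℝ, ℝ)) (h : H), (∀ t, HasDerivAt q (q' t) t) → q T = 0 →
      ∫ t, q' t * inner ℝ h (J (p.fst t)) ∂(timeMeasure T)
        + ∫ t, q t * inner ℝ h (p.snd t) ∂(timeMeasure T) = 0 := by
  have key : ∀ (q q' : C(ℝ, ℝ)) (h : H), inner ℝ (WithLp.toLp 2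
      (toL2 T ⟨fun t => q' t • J.adjoint h, by fun_prop⟩,
        toL2 T ⟨fun t => q t • h, by fun_prop⟩)) p
      = ∫ t, q' t * inner ℝ h (J (p.fst t)) ∂(timeMeasure T)
        + ∫ t, q t * inner ℝ h (p.snd t) ∂(timeMeasure T) := by
    intro q q' h
    rw [WithLp.prod_inner_apply]
    congr 1
    · refine (inner_toL2 _ _).trans ?_
      simp [inner_smul_left, ContinuousLinearMap.adjoint_inner_left]
    · refine (inner_toL2 _ _).trans ?_
      simp [inner_smul_left]
  constructor
  · intro hp q q' h hq hqT
    rw [← key]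
    exact (Submodule.mem_orthogonal _ _).1 hp _ (Submodule.subset_span ⟨q, q', h, hq, hqT, rfl⟩)
  · intro hp
    refine (Submodule.mem_orthogonal _ _).2 fun v hv => ?_
    induction hv using Submodule.span_induction with
    | mem x hx =>
      obtain ⟨q, q', h, hq, hqT, rfl⟩ := hx
      rw [key]
      exact hp q q' h hq hqT
    | zero => exact inner_zero_left _
    | add x y _ _ hx hy => rw [inner_add_left, hx, hy, add_zero]
    | smul c x _ hx => rw [inner_smul_left, hx, mul_zero]

theorem waveSpace_eq_prim (hT : 0 < T) {J : W →L[ℝ] H}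
    {p : WithLp 2 (Lp W 2 (timeMeasure T) × Lp H 2 (timeMeasure T))} (hp : p ∈ waveSpace T J) :
    (fun t => J (p.fst t)) =ᵐ[timeMeasure T] fun t => ∫ s in (0 : ℝ)..t, p.snd s := by
  have hu : MemL2Time T (fun t => J (p.fst t)) := MemL2Time.clm J (Lp.memLp p.fst)
  have hz : MemL2Time T p.snd := Lp.memLp p.snd
  have hpr := (memL2Time_of_continuousOn (continuousOn_prim hT.le hz.integrable)).integrable
  have h := ae_eq_zero_of_forall_deriv_test hT
    (d := fun t => J (p.fst t) - ∫ s in (0 : ℝ)..t, p.snd s) (hu.integrable.sub hpr)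
    fun q hq hb => by
    obtain ⟨b, hb, hqb⟩ := hb
    have hd : Continuous (deriv q) := hq.continuous_deriv (by simp)
    have hi1 := integrable_smul_of_continuous hd hu.integrable
    have hi2 := integrable_smul_of_continuous hq.continuous hz.integrable
    have h1 := integral_deriv_smul_prim hT.le (hq.of_le (by simp)) (hqb T hb.le) hz.integrable 0
    simp only [zero_add, smul_zero, neg_zero, zero_sub] at h1
    simp_rw [smul_sub]
    rw [integral_sub hi1 (integrable_smul_of_continuous hd hpr), h1, sub_neg_eq_add]
    refine ext_inner_left ℝ fun h => ?_
    rw [inner_add_right, ← integral_inner hi1, ← integral_inner hi2, inner_zero_right]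
    simp_rw [inner_smul_right]
    exact mem_waveSpace_iff.1 hp ⟨q, hq.continuous⟩ ⟨deriv q, hd⟩ h
      (fun t => (hq.differentiable (by simp) t).hasDerivAt) (hqb T hb.le)
  filter_upwards [h] with t ht
  exact sub_eq_zero.1 ht

theorem integral_eq_sub_of_hasDerivAt (hT : 0 ≤ T) {e e' : ℝ → ℝ} (h : ∀ t, HasDerivAt e (e' t) t)
    (he : Continuous e') : ∫ t, e' t ∂(timeMeasure T) = e T - e 0 := by
  rw [integral_timeMeasure hT]
  exact intervalIntegral.integral_eq_sub_of_hasDerivAt (fun t _ => h t)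
    (he.intervalIntegrable _ _)

theorem testCurve_mem_waveSpace (hT : 0 < T) (J : W →L[ℝ] H) (ψ : testCurves W) :
    WithLp.toLp 2 (toL2 T ψ.1.1, toL2 T ⟨fun t => J (ψ.1.2.1 t), by fun_prop⟩)
      ∈ waveSpace T J := by
  obtain ⟨⟨ψ, ψ₁, ψ₂⟩, hψ, -, hψ0⟩ := ψ
  dsimp only at hψ hψ0 ⊢
  rw [mem_waveSpace_iff]
  intro q q' h hq hqT
  have e1 : ∫ t, q' t * inner ℝ h (J (toL2 T ψ t)) ∂(timeMeasure T)
      = ∫ t, q' t * inner ℝ h (J (ψ t)) ∂(timeMeasure T) := by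
    refine integral_congr_ae ?_
    filter_upwards [coeFn_toL2 (T := T) ψ] with t ht
    rw [ht]
  have e2 : ∫ t, q t * inner ℝ h (toL2 T ⟨fun t => J (ψ₁ t), by fun_prop⟩ t) ∂(timeMeasure T)
      = ∫ t, q t * inner ℝ h (J (ψ₁ t)) ∂(timeMeasure T) := by
    refine integral_congr_ae ?_
    filter_upwards [coeFn_toL2 (T := T) (⟨fun t => J (ψ₁ t), by fun_prop⟩ : C(ℝ, H))] with t ht
    rw [ht]; rfl
  change ∫ t, q' t * inner ℝ h (J (toL2 T ψ t)) ∂(timeMeasure T) +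
    ∫ t, q t * inner ℝ h (toL2 T ⟨fun t => J (ψ₁ t), by fun_prop⟩ t) ∂(timeMeasure T) = 0
  rw [e1, e2, ← integral_add (integrable_timeMeasure_of_continuous (by fun_prop))
    (integrable_timeMeasure_of_continuous (by fun_prop))]
  rw [integral_eq_sub_of_hasDerivAt (e := fun t => q t * inner ℝ h (J (ψ t))) hT.le]
  · simp [hqT, hψ0]
  · intro t
    have := (hq t).mul (((innerSL ℝ h).comp J).hasFDerivAt.comp_hasDerivAt t (hψ t))
    exact this
  · fun_prop

end Wave

/-! ### Existence for the abstract wave equation by a weighted energy estimate -/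

section WaveExistence

variable {X Y : Type*} [NormedAddCommGroup X] [InnerProductSpace ℝ X]
  [NormedAddCommGroup Y] [InnerProductSpace ℝ Y] {T : ℝ}

/-- `φ ↦ w L φ` for a scalar weight `w` and an operator `L`. -/
def weightedMap (w : C(ℝ, ℝ)) (L : X →L[ℝ] Y) : C(ℝ, X) →ₗ[ℝ] C(ℝ, Y) where
  toFun φ := ⟨fun t => w t • L (φ t), by fun_prop⟩
  map_add' φ ψ := by ext t; simp
  map_smul' c φ := by
    ext t
    change w t • L (c • φ t) = c • w t • L (φ t)
    rw [map_smul, smul_comm]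

/-- The weight `T - t`. -/
def timeWeight (T : ℝ) : C(ℝ, ℝ) := ⟨fun t => T - t, by fun_prop⟩

theorem hasDerivAt_bilin_self (L : X →L[ℝ] StrongDual ℝ X) {x : ℝ → X} {x' : X} {t : ℝ}
    (hx : HasDerivAt x x' t) :
    HasDerivAt (fun t => L (x t) (x t)) (L x' (x t) + L (x t) x') t :=
  HasDerivAt.clm_apply (c := fun t => L (x t)) (L.hasFDerivAt.comp_hasDerivAt t hx) hx

variable {W H : Type*} [NormedAddCommGroup W] [InnerProductSpace ℝ W] [CompleteSpace W]
  [NormedAddCommGroup H] [InnerProductSpace ℝ H] [CompleteSpace H]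

/-- The pointwise inequality behind the coerciveness of the weak wave operator. -/
theorem wave_pointwise_bound {J : W →L[ℝ] H} {C : H →L[ℝ] StrongDual ℝ H}
    {A : W →L[ℝ] StrongDual ℝ W} {γ κ : ℝ} (hγ : 0 < γ) (hT : 0 < T)
    (hC : ∀ x, γ * ‖x‖ ^ 2 ≤ C x x) (hA : ∀ x, κ * (‖x‖ ^ 2 - ‖J x‖ ^ 2) ≤ A x x)
    (hJ : ∀ x, ‖J x‖ ≤ ‖x‖) {w : ℝ} (hw0 : 0 ≤ w) (hw : w ≤ T) (x : W) (y : H) :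
    min κ (γ / (8 * T ^ 2)) / 2 * ‖x‖ ^ 2 + γ / 4 * ‖y‖ ^ 2 ≤
      A x x / 2 + C y y / 2 + γ / (8 * T ^ 2) * (‖J x‖ ^ 2 - 2 * w * inner ℝ (J x) y) := by
  -- With this `μ`, Young's inequality costs `2 μ T² ‖y‖² = γ/4 ‖y‖²`, half of the lower bound `γ/2
  -- ‖y‖²` that `C y y / 2` provides.
  set μ := γ / (8 * T ^ 2) with hμ
  have hμ0 : 0 < μ := by positivity
  have h1 : 8 * (μ * T ^ 2) = γ := by rw [hμ]; field_simp
  have h2 : 2 * w * inner ℝ (J x) y ≤ ‖J x‖ ^ 2 / 2 + 2 * T ^ 2 * ‖y‖ ^ 2 := by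
    have h3 := real_inner_le_norm (J x) y
    have h4 : 2 * w * inner ℝ (J x) y ≤ 2 * w * (‖J x‖ * ‖y‖) :=
      mul_le_mul_of_nonneg_left h3 (by linarith)
    have h5 : 2 * w * (‖J x‖ * ‖y‖) ≤ 2 * T * (‖J x‖ * ‖y‖) :=
      mul_le_mul_of_nonneg_right (by linarith) (by positivity)
    nlinarith [sq_nonneg (‖J x‖ - 2 * T * ‖y‖)]
  have hd : 0 ≤ ‖x‖ ^ 2 - ‖J x‖ ^ 2 :=
    sub_nonneg.2 (pow_le_pow_left₀ (norm_nonneg _) (hJ x) 2)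
  have h6 : min κ μ * (‖x‖ ^ 2 - ‖J x‖ ^ 2) ≤ A x x :=
    (mul_le_mul_of_nonneg_right (min_le_left _ _) hd).trans (hA x)
  have h7 : min κ μ * ‖J x‖ ^ 2 ≤ μ * ‖J x‖ ^ 2 :=
    mul_le_mul_of_nonneg_right (min_le_right _ _) (sq_nonneg _)
  have h8 := hC y
  have h9 := mul_le_mul_of_nonneg_left h2 hμ0.le
  have h10 : μ * (2 * T ^ 2 * ‖y‖ ^ 2) = γ / 4 * ‖y‖ ^ 2 := by rw [← h1]; ring
  nlinarith

/-- Coerciveness of the weak wave operator on test curves. -/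
theorem wave_energy_bound {J : W →L[ℝ] H} {C : H →L[ℝ] StrongDual ℝ H}
    {A : W →L[ℝ] StrongDual ℝ W} {γ κ : ℝ} (hγ : 0 < γ) (hT : 0 < T)
    (hCs : ∀ x y, C x y = C y x) (hAs : ∀ x y, A x y = A y x)
    (hC : ∀ x, γ * ‖x‖ ^ 2 ≤ C x x) (hA : ∀ x, κ * (‖x‖ ^ 2 - ‖J x‖ ^ 2) ≤ A x x)
    (hJ : ∀ x, ‖J x‖ ≤ ‖x‖) (ψ : testCurves W) :
    min κ (γ / (8 * T ^ 2)) / 2 * ∫ t, ‖ψ.1.1 t‖ ^ 2 ∂(timeMeasure T)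
      + γ / 4 * ∫ t, ‖J (ψ.1.2.1 t)‖ ^ 2 ∂(timeMeasure T) + T * γ / 2 * ‖J (ψ.1.2.1 0)‖ ^ 2 ≤
    ∫ t, ((T - t) * A (ψ.1.2.1 t) (ψ.1.1 t) + (C (J (ψ.1.2.1 t)) (J (ψ.1.2.1 t))
      - (T - t) * C (J (ψ.1.2.2 t)) (J (ψ.1.2.1 t)))) ∂(timeMeasure T) := by
  obtain ⟨⟨ψ, ψ₁, ψ₂⟩, hψ, hψ₁, hψ0⟩ := ψ
  dsimp only at hψ hψ₁ hψ0 ⊢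
  set μ := γ / (8 * T ^ 2) with hμ
  -- The integrand on the right minus `e'` is exactly the expression bounded below in
  -- `wave_pointwise_bound`. Since `e T = 0` and `ψ 0 = 0`, the integral of `e'` is `T/2` times the
  -- value of `C` at `J ψ'(0)`. The summand with `μ` supplies the part of `‖ψ‖` that `A` does not
  -- control.
  let e : ℝ → ℝ := fun t => (T - t) * ((A (ψ t) (ψ t) - C (J (ψ₁ t)) (J (ψ₁ t))) / 2
    + μ * inner ℝ (J (ψ t)) (J (ψ t)))
  let e' : ℝ → ℝ := fun t => -((A (ψ t) (ψ t) - C (J (ψ₁ t)) (J (ψ₁ t))) / 2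
    + μ * inner ℝ (J (ψ t)) (J (ψ t)))
    + (T - t) * ((A (ψ₁ t) (ψ t) - C (J (ψ₂ t)) (J (ψ₁ t))) + 2 * μ * inner ℝ (J (ψ t)) (J (ψ₁ t)))
  have he : ∀ t, HasDerivAt e (e' t) t := by
    intro t
    have hJ0 : HasDerivAt (fun t => J (ψ t)) (J (ψ₁ t)) t :=
      J.hasFDerivAt.comp_hasDerivAt t (hψ t)
    have hJ1 : HasDerivAt (fun t => J (ψ₁ t)) (J (ψ₂ t)) t :=
      J.hasFDerivAt.comp_hasDerivAt t (hψ₁ t)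
    have d1 := hasDerivAt_bilin_self A (hψ t)
    have d2 := hasDerivAt_bilin_self C hJ1
    have d3 : HasDerivAt (fun t => inner ℝ (J (ψ t)) (J (ψ t))) _ t :=
      hasDerivAt_bilin_self (innerSL ℝ) hJ0
    have d4 : HasDerivAt (fun t => T - t) (-1) t := (hasDerivAt_id t).const_sub T
    have d5 : HasDerivAt (fun t => (A (ψ t) (ψ t) - C (J (ψ₁ t)) (J (ψ₁ t))) / 2) _ t :=
      (d1.sub d2).div_const 2
    have d6 : HasDerivAt (fun t => (A (ψ t) (ψ t) - C (J (ψ₁ t)) (J (ψ₁ t))) / 2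
      + μ * inner ℝ (J (ψ t)) (J (ψ t))) _ t := d5.add (d3.const_mul μ)
    refine (d4.mul d6).congr_deriv ?_
    have d7 : innerSL ℝ (J (ψ₁ t)) (J (ψ t)) = inner ℝ (J (ψ t)) (J (ψ₁ t)) :=
      real_inner_comm _ _
    have d8 : innerSL ℝ (J (ψ t)) (J (ψ₁ t)) = inner ℝ (J (ψ t)) (J (ψ₁ t)) := rfl
    simp only [e']
    rw [hAs (ψ t) (ψ₁ t), hCs (J (ψ₁ t)) (J (ψ₂ t)), d7, d8]
    ring
  have hec : Continuous e' := by fun_prop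
  have hI := integral_eq_sub_of_hasDerivAt hT.le he hec
  have heT : e T = 0 := by simp [e]
  have he0 : e 0 = -(T * (C (J (ψ₁ 0)) (J (ψ₁ 0)) / 2)) := by simp [e, hψ0]; ring
  have h0 : T * γ / 2 * ‖J (ψ₁ 0)‖ ^ 2 ≤ ∫ t, e' t ∂(timeMeasure T) := by
    rw [hI, heT, he0]
    have := mul_le_mul_of_nonneg_left (hC (J (ψ₁ 0))) hT.le
    nlinarith
  have h1 : ∫ t, (min κ μ / 2 * ‖ψ t‖ ^ 2 + γ / 4 * ‖J (ψ₁ t)‖ ^ 2 + e' t) ∂(timeMeasure T)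
      ≤ ∫ t, ((T - t) * A (ψ₁ t) (ψ t) + (C (J (ψ₁ t)) (J (ψ₁ t))
      - (T - t) * C (J (ψ₂ t)) (J (ψ₁ t)))) ∂(timeMeasure T) := by
    refine integral_mono_ae (integrable_timeMeasure_of_continuous (by fun_prop))
      (integrable_timeMeasure_of_continuous (by fun_prop)) ?_
    filter_upwards [ae_restrict_mem measurableSet_Ioo] with t ht
    have := wave_pointwise_bound hγ hT hC hA hJ (w := T - t) (by linarith [ht.2])
      (by linarith [ht.1]) (ψ t) (J (ψ₁ t))
    rw [← hμ] at this
    simp only [e', real_inner_self_eq_norm_sq]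
    nlinarith
  rw [integral_add (integrable_timeMeasure_of_continuous (by fun_prop))
    (integrable_timeMeasure_of_continuous hec),
    integral_add (integrable_timeMeasure_of_continuous (by fun_prop))
    (integrable_timeMeasure_of_continuous (by fun_prop)), integral_const_mul,
    integral_const_mul] at h1
  linarith

/-- The representative of the weak wave operator. -/
def waveOp (T : ℝ) (J : W →L[ℝ] H) (C : H →L[ℝ] StrongDual ℝ H) (A : W →L[ℝ] StrongDual ℝ W) :
    (C(ℝ, W) × C(ℝ, W) × C(ℝ, W)) →ₗ[ℝ]
      WithLp 2 (Lp W 2 (timeMeasure T) × Lp H 2 (timeMeasure T)) :=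
  (WithLp.linearEquiv 2 ℝ _).symm.toLinearMap ∘ₗ LinearMap.prod
    (toL2 T ∘ₗ weightedMap (timeWeight T) (InnerProductSpace.continuousLinearMapOfBilin A) ∘ₗ
      LinearMap.fst ℝ _ _ ∘ₗ LinearMap.snd ℝ _ _)
    (toL2 T ∘ₗ
      (weightedMap 1 ((InnerProductSpace.continuousLinearMapOfBilin C).comp J) ∘ₗ
        LinearMap.fst ℝ _ _ - weightedMap (timeWeight T)
          ((InnerProductSpace.continuousLinearMapOfBilin C).comp J) ∘ₗ LinearMap.snd ℝ _ _) ∘ₗ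
      LinearMap.snd ℝ _ _)

/-- This is `(C z)' + A u` tested with `(T - t) ψ'` after one integration by parts: the second
integral comes from `-((T - t) ψ')' = ψ' - (T - t) ψ''`. The weight removes the boundary term at
`T`; the one at `0` belongs to the data. -/
theorem inner_waveOp (J : W →L[ℝ] H) (C : H →L[ℝ] StrongDual ℝ H) (A : W →L[ℝ] StrongDual ℝ W)
    (ψ : C(ℝ, W) × C(ℝ, W) × C(ℝ, W))
    (p : WithLp 2 (Lp W 2 (timeMeasure T) × Lp H 2 (timeMeasure T))) :
    inner ℝ (waveOp T J C A ψ) p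
      = ∫ t, (T - t) * A (ψ.2.1 t) (p.fst t) ∂(timeMeasure T)
        + ∫ t, (C (J (ψ.2.1 t)) (p.snd t)
          - (T - t) * C (J (ψ.2.2 t)) (p.snd t)) ∂(timeMeasure T) := by
  rw [WithLp.prod_inner_apply]
  congr 1
  · refine (inner_toL2 _ _).trans ?_
    simp [weightedMap, timeWeight, inner_smul_left]
  · refine (inner_toL2 _ _).trans ?_
    simp [weightedMap, timeWeight, inner_smul_left, inner_sub_left]

end WaveExistence

section WaveExistence

variable {T : ℝ} {W H : Type*} [NormedAddCommGroup W] [InnerProductSpace ℝ W] [CompleteSpace W]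
  [NormedAddCommGroup H] [InnerProductSpace ℝ H] [CompleteSpace H]

/-- A solution of the weak wave equation with test curves. -/
theorem exists_weak_wave (hT : 0 < T) {J : W →L[ℝ] H} {C : H →L[ℝ] StrongDual ℝ H}
    {A : W →L[ℝ] StrongDual ℝ W} {γ κ : ℝ} (hγ : 0 < γ) (hκ : 0 < κ)
    (hCs : ∀ x y, C x y = C y x) (hC : ∀ x, γ * ‖x‖ ^ 2 ≤ C x x)
    (hAs : ∀ x y, A x y = A y x) (hA : ∀ x, κ * (‖x‖ ^ 2 - ‖J x‖ ^ 2) ≤ A x x)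
    (hJ : ∀ x, ‖J x‖ ≤ ‖x‖) (f : Lp H 2 (timeMeasure T)) (g₀ : W) (g₁ : H) :
    ∃ p ∈ waveSpace T J, ∀ ψ : testCurves W,
      inner ℝ (waveOp T J C A ψ.1) p
        = ∫ t, (T - t) * inner ℝ (J (ψ.1.2.1 t)) (f t) ∂(timeMeasure T)
          + T * C g₁ (J (ψ.1.2.1 0)) - ∫ t, A g₀ (ψ.1.1 t) ∂(timeMeasure T) := by
  let F := waveSpace T J
  have : CompleteSpace F := (Submodule.isClosed_orthogonal _).completeSpace_coe
  let ι : testCurves W → F := fun ψ => ⟨_, testCurve_mem_waveSpace hT J ψ⟩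
  let M : testCurves W →ₗ[ℝ] StrongDual ℝ F :=
    { toFun := fun ψ => (innerSL ℝ (waveOp T J C A ψ.1)).comp F.subtypeL
      map_add' := fun φ ψ => by
        ext p
        simp
      map_smul' := fun c ψ => by
        ext p
        simp }
  let a₀ : W := InnerProductSpace.continuousLinearMapOfBilin A g₀
  -- The unknown is the solution minus `g₀`, which starts at zero. Moving `g₀` to the right produces
  -- `-∫ (T - t) A(g₀, ψ')`, which equals `-∫ A(g₀, ψ)` by parts because `ψ(0) = 0`.
  let ℓ : testCurves W →ₗ[ℝ] ℝ :=
    { toFun := fun ψ => inner ℝ (toL2 T (weightedMap (timeWeight T) J ψ.1.2.1)) f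
        + T * C g₁ (J (ψ.1.2.1 0)) - inner ℝ (toL2 T (.const ℝ a₀)) (toL2 T ψ.1.1)
      map_add' := fun φ ψ => by
        simp [inner_add_left, inner_add_right]
        ring
      map_smul' := fun c ψ => by
        simp [inner_smul_left, inner_smul_right]
        ring }
  -- The point value `J ψ'(0)`, through which the initial velocity enters `ℓ`, is not bounded by the
  -- L² norms in `ι ψ`; the energy bound controls it, so it is put into the gauge.
  let N : testCurves W → ℝ := fun ψ => √(‖ι ψ‖ ^ 2 + ‖J (ψ.1.2.1 0)‖ ^ 2)
  have hN1 : ∀ ψ, ‖ι ψ‖ ≤ N ψ := fun ψ => Real.le_sqrt_of_sq_le (by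
    nlinarith [sq_nonneg ‖J (ψ.1.2.1 0)‖])
  have hN2 : ∀ ψ, ‖J (ψ.1.2.1 0)‖ ≤ N ψ := fun ψ => Real.le_sqrt_of_sq_le (by
    nlinarith [sq_nonneg ‖ι ψ‖])
  have hι : ∀ ψ, ‖ι ψ‖ ^ 2 = ‖toL2 T ψ.1.1‖ ^ 2
      + ‖toL2 T ⟨fun t => J (ψ.1.2.1 t), by fun_prop⟩‖ ^ 2 := fun ψ =>
    WithLp.prod_norm_sq_eq_of_L2 _
  have hι1 : ∀ ψ, ‖toL2 T ψ.1.1‖ ≤ ‖ι ψ‖ := fun ψ =>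
    le_of_sq_le_sq (by rw [hι]; nlinarith [sq_nonneg ‖toL2 T ⟨fun t => J (ψ.1.2.1 t), by fun_prop⟩‖]) (norm_nonneg _)
  have hι2 : ∀ ψ, ‖toL2 T ⟨fun t => J (ψ.1.2.1 t), by fun_prop⟩‖ ≤ ‖ι ψ‖ := fun ψ =>
    le_of_sq_le_sq (by rw [hι]; nlinarith [sq_nonneg ‖toL2 T ψ.1.1‖]) (norm_nonneg _)
  have hw : ∀ ψ : testCurves W, ‖toL2 T (weightedMap (timeWeight T) J ψ.1.2.1)‖
      ≤ T * ‖toL2 T ⟨fun t => J (ψ.1.2.1 t), by fun_prop⟩‖ := by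
    intro ψ
    refine Lp.norm_le_mul_norm_of_ae_le_mul ?_
    filter_upwards [coeFn_toL2 (T := T) (weightedMap (timeWeight T) J ψ.1.2.1),
      coeFn_toL2 (T := T) (⟨fun t => J (ψ.1.2.1 t), by fun_prop⟩ : C(ℝ, H)),
      ae_restrict_mem measurableSet_Ioo] with t h1 h2 ht
    rw [h1, h2]
    change ‖(T - t) • J (ψ.1.2.1 t)‖ ≤ T * ‖J (ψ.1.2.1 t)‖
    rw [norm_smul, Real.norm_eq_abs, abs_of_nonneg (by linarith [ht.2])]
    exact mul_le_mul_of_nonneg_right (by linarith [ht.1]) (norm_nonneg _)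
  obtain ⟨p, hp⟩ := exists_of_coercive_on_tests ι M N ℓ
    (K := T * ‖f‖ + T * ‖C g₁‖ + ‖toL2 T (.const ℝ a₀)‖)
    (c := min (min (min κ (γ / (8 * T ^ 2)) / 2) (γ / 4)) (T * γ / 2))
    (by positivity) (by
      have : 0 < T * γ / 2 := by positivity
      have h2 : 0 < γ / (8 * T ^ 2) := by positivity
      have h3 : 0 < γ / 4 := by positivity
      have h4 : 0 < min κ (γ / (8 * T ^ 2)) / 2 := half_pos (lt_min hκ h2)
      exact lt_min (lt_min h4 h3) this) hN1
    (fun ψ => by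
      change |inner ℝ (toL2 T (weightedMap (timeWeight T) J ψ.1.2.1)) f
        + T * C g₁ (J (ψ.1.2.1 0)) - inner ℝ (toL2 T (.const ℝ a₀)) (toL2 T ψ.1.1)| ≤ _
      have b1 : |inner ℝ (toL2 T (weightedMap (timeWeight T) J ψ.1.2.1)) f| ≤ T * N ψ * ‖f‖ :=
        (abs_real_inner_le_norm _ _).trans (mul_le_mul_of_nonneg_right ((hw ψ).trans
          (mul_le_mul_of_nonneg_left ((hι2 ψ).trans (hN1 ψ)) hT.le)) (norm_nonneg _))
      have b2 : |T * C g₁ (J (ψ.1.2.1 0))| ≤ T * (‖C g₁‖ * N ψ) := by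
        rw [abs_mul, abs_of_pos hT]
        exact mul_le_mul_of_nonneg_left (((C g₁).le_opNorm _).trans
          (mul_le_mul_of_nonneg_left (hN2 ψ) (norm_nonneg _))) hT.le
      have b3 : |inner ℝ (toL2 T (.const ℝ a₀)) (toL2 T ψ.1.1)|
          ≤ ‖toL2 T (.const ℝ a₀)‖ * N ψ :=
        (abs_real_inner_le_norm _ _).trans (mul_le_mul_of_nonneg_left
          ((hι1 ψ).trans (hN1 ψ)) (norm_nonneg _))
      refine (abs_sub _ _).trans ((add_le_add (abs_add_le _ _) le_rfl).trans ?_)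
      nlinarith)
    (fun ψ => by
      have h1 := wave_energy_bound hγ hT hCs hAs hC hA hJ ψ
      have h2 : M ψ (ι ψ) = ∫ t, ((T - t) * A (ψ.1.2.1 t) (ψ.1.1 t)
          + (C (J (ψ.1.2.1 t)) (J (ψ.1.2.1 t))
          - (T - t) * C (J (ψ.1.2.2 t)) (J (ψ.1.2.1 t)))) ∂(timeMeasure T) := by
        refine (inner_waveOp J C A ψ.1 _).trans ?_
        rw [integral_add (integrable_timeMeasure_of_continuous (by fun_prop))
          (integrable_timeMeasure_of_continuous (by fun_prop))]
        congr 1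
        · refine integral_congr_ae ?_
          filter_upwards [coeFn_toL2 (T := T) ψ.1.1] with t ht
          exact congrArg (fun x => (T - t) * A (ψ.1.2.1 t) x) ht
        · refine integral_congr_ae ?_
          filter_upwards [coeFn_toL2 (T := T)
            (⟨fun t => J (ψ.1.2.1 t), by fun_prop⟩ : C(ℝ, H))] with t ht
          exact congrArg (fun x => C (J (ψ.1.2.1 t)) x - (T - t) * C (J (ψ.1.2.2 t)) x) ht
      rw [h2]
      refine le_trans ?_ h1
      have h3 : N ψ ^ 2 = ‖ι ψ‖ ^ 2 + ‖J (ψ.1.2.1 0)‖ ^ 2 := Real.sq_sqrt (by positivity)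
      rw [h3, hι, norm_sq_toL2, norm_sq_toL2]
      have i1 : 0 ≤ ∫ t, ‖ψ.1.1 t‖ ^ 2 ∂(timeMeasure T) := integral_nonneg fun t => sq_nonneg _
      have i2 : 0 ≤ ∫ t, ‖J (ψ.1.2.1 t)‖ ^ 2 ∂(timeMeasure T) :=
        integral_nonneg fun t => sq_nonneg _
      rw [mul_add, mul_add]
      exact add_le_add (add_le_add
        (mul_le_mul_of_nonneg_right ((min_le_left _ _).trans (min_le_left _ _)) i1)
        (mul_le_mul_of_nonneg_right ((min_le_left _ _).trans (min_le_right _ _)) i2))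
        (mul_le_mul_of_nonneg_right (min_le_right _ _) (sq_nonneg _)))
  refine ⟨p, p.2, fun ψ => (hp ψ).trans ?_⟩
  change inner ℝ (toL2 T (weightedMap (timeWeight T) J ψ.1.2.1)) f
        + T * C g₁ (J (ψ.1.2.1 0)) - inner ℝ (toL2 T (.const ℝ a₀)) (toL2 T ψ.1.1) = _
  rw [inner_toL2, inner_toL2_toL2]
  simp [weightedMap, timeWeight, inner_smul_left, a₀]

end WaveExistence

section WaveExistence

variable {T : ℝ} {W H : Type*} [NormedAddCommGroup W] [InnerProductSpace ℝ W] [CompleteSpace W]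
  [NormedAddCommGroup H] [InnerProductSpace ℝ H] [CompleteSpace H]

theorem contDiff_div_sub {q : ℝ → ℝ} (hq : ContDiff ℝ ∞ q) {b : ℝ} (hb : b < T)
    (hqb : ∀ t, b ≤ t → q t = 0) : ContDiff ℝ ∞ (fun t => q t / (T - t)) := by
  rw [contDiff_iff_contDiffAt]
  intro t
  rcases lt_or_ge t T with ht | ht
  · exact hq.contDiffAt.div (contDiffAt_const.sub contDiffAt_id) (sub_pos.2 ht).ne'
  · refine (contDiffAt_const (c := (0 : ℝ))).congr_of_eventuallyEq ?_
    filter_upwards [lt_mem_nhds (hb.trans_le ht)] with s hs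
    rw [hqb s hs.le, zero_div]

/-- Existence for the abstract wave equation. -/
theorem wave_exists (hT : 0 < T) {J : W →L[ℝ] H} {C : H →L[ℝ] StrongDual ℝ H}
    {A : W →L[ℝ] StrongDual ℝ W} {γ κ : ℝ} (hγ : 0 < γ) (hκ : 0 < κ)
    (hCs : ∀ x y, C x y = C y x) (hC : ∀ x, γ * ‖x‖ ^ 2 ≤ C x x)
    (hAs : ∀ x y, A x y = A y x) (hA : ∀ x, κ * (‖x‖ ^ 2 - ‖J x‖ ^ 2) ≤ A x x)
    (hJ : ∀ x, ‖J x‖ ≤ ‖x‖) (f : Lp H 2 (timeMeasure T)) (g₀ : W) (g₁ : H) :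
    ∃ (u : ℝ → W) (z : ℝ → H), MemL2Time T u ∧ MemL2Time T z ∧
      ((fun t => J (u t)) =ᵐ[timeMeasure T] fun t => J g₀ + ∫ s in (0 : ℝ)..t, z s) ∧
      ((fun t => (C (z t)).comp J) =ᵐ[timeMeasure T] fun t => (C g₁).comp J
        + ∫ s in (0 : ℝ)..t, ((innerSL ℝ (f s)).comp J - A (u s))) := by
  obtain ⟨p, hpF, hp⟩ := exists_weak_wave hT hγ hκ hCs hC hAs hA hJ f g₀ g₁
  have hz : MemL2Time T p.snd := Lp.memLp p.snd
  have hu : MemL2Time T (fun t => p.fst t + g₀) := MemLp.add (Lp.memLp p.fst) (memLp_const g₀)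
  have hf : MemL2Time T f := Lp.memLp f
  refine ⟨fun t => p.fst t + g₀, p.snd, hu, hz, ?_, ?_⟩
  · filter_upwards [waveSpace_eq_prim hT hpF] with t ht
    rw [map_add, ht, add_comm]
  let Jd : StrongDual ℝ H →L[ℝ] StrongDual ℝ W := (ContinuousLinearMap.compL ℝ W H ℝ).flip J
  let G : ℝ → StrongDual ℝ W := fun s => (innerSL ℝ (f s)).comp J - A (p.fst s + g₀)
  have hG : Integrable G (timeMeasure T) :=
    (MemL2Time.clm (Jd.comp (innerSL ℝ)) hf).integrable.sub (MemL2Time.clm A hu).integrable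
  have hCz : Integrable (fun t => (C (p.snd t)).comp J) (timeMeasure T) :=
    (MemL2Time.clm (Jd.comp C) hz).integrable
  have hP : Integrable (fun t => (C g₁).comp J + ∫ s in (0 : ℝ)..t, G s) (timeMeasure T) := (memL2Time_of_continuousOn ((continuousOn_const (c := (C g₁).comp J)).add
    (continuousOn_prim hT.le hG))).integrable
  have key := ae_eq_zero_of_forall_deriv_test hT (hCz.sub hP) fun q hq hb => by
    obtain ⟨b, hb, hqb⟩ := hb
    have hd : Continuous (deriv q) := hq.continuous_deriv (by simp)
    have hi1 := integrable_smul_of_continuous hd hCz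
    have hi2 := integrable_smul_of_continuous hd hP
    have hi3 := integrable_smul_of_continuous hq.continuous hG
    have hparts := integral_deriv_smul_prim hT.le (hq.of_le (by simp)) (hqb T hb.le) hG
      ((C g₁).comp J)
    simp_rw [Pi.sub_apply, smul_sub]
    rw [integral_sub hi1 hi2, hparts]
    ext v
    -- The test curve has derivative `ρ v`, so that `(T - t) ψ' = q v` and the weight disappears
    -- from the equation. Smoothness of `ρ` at `T` holds because `q` vanishes on a neighbourhood of
    -- `T`.
    let ρ : ℝ → ℝ := fun t => q t / (T - t)
    have hρ : ContDiff ℝ ∞ ρ := contDiff_div_sub hq hb hqb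
    have hρd : Continuous (deriv ρ) := hρ.continuous_deriv (by simp)
    have hρq : ∀ t, (T - t) * ρ t = q t := by
      intro t
      rcases eq_or_ne T t with h | h
      · rw [← h, hqb T hb.le, sub_self, zero_mul]
      · exact mul_div_cancel₀ _ (sub_ne_zero.2 h)
    have hρ' : ∀ t, HasDerivAt ρ (deriv ρ t) t := fun t =>
      (hρ.differentiable (by simp) t).hasDerivAt
    have hqd : ∀ t, deriv q t = (T - t) * deriv ρ t - ρ t := by
      intro t
      have h1 : HasDerivAt (fun t => (T - t) * ρ t) (-1 * ρ t + (T - t) * deriv ρ t) t :=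
        ((hasDerivAt_id t).const_sub T).mul (hρ' t)
      rw [show (fun t => (T - t) * ρ t) = q from funext hρq] at h1
      rw [h1.deriv]
      ring
    let r : ℝ → ℝ := fun t => ∫ s in (0 : ℝ)..t, ρ s
    have hr : ∀ t, HasDerivAt r (ρ t) t := fun t =>
      (hρ.continuous.integral_hasStrictDerivAt 0 t).hasDerivAt
    have hrc : Continuous r := continuous_iff_continuousAt.2 fun t => (hr t).continuousAt
    have hρc := hρ.continuous
    let ψ : testCurves W := ⟨⟨⟨fun t => r t • v, by fun_prop⟩, ⟨fun t => ρ t • v, by fun_prop⟩,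
      ⟨fun t => deriv ρ t • v, by fun_prop⟩⟩, fun t => (hr t).smul_const v,
      fun t => (hρ' t).smul_const v, by simp [r]⟩
    have h1 := hp ψ
    rw [inner_waveOp] at h1
    simp only [ψ, ContinuousMap.coe_mk, map_smul, smul_apply, smul_eq_mul, inner_smul_left] at h1
    -- Here `((T - t) r)' = q - r`, and `(T - t) r` vanishes at both ends.
    have hrint : ∫ t, r t ∂(timeMeasure T) = ∫ t, q t ∂(timeMeasure T) := by
      have h2 := integral_eq_sub_of_hasDerivAt (e := fun t => (T - t) * r t)
        (e' := fun t => q t - r t) hT.le (fun t => by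
          have h3 : HasDerivAt (fun t => (T - t) * r t) (-1 * r t + (T - t) * ρ t) t :=
            ((hasDerivAt_id t).const_sub T).mul (hr t)
          refine h3.congr_deriv ?_
          rw [hρq]; ring) (hq.continuous.sub hrc)
      rw [integral_sub (integrable_timeMeasure_of_continuous hq.continuous)
        (integrable_timeMeasure_of_continuous hrc)] at h2
      simp [r] at h2
      simp only [r]
      linarith
    have hi4 : Integrable (fun t => q t * inner ℝ (f t) (J v)) (timeMeasure T) :=
      integrable_smul_of_continuous hq.continuous
        (MemL2Time.clm ((innerSL ℝ).flip (J v)) hf).integrable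
    have hi5 : Integrable (fun t => q t * A (p.fst t) v) (timeMeasure T) :=
      integrable_smul_of_continuous hq.continuous
        (MemL2Time.clm (A.flip v) (Lp.memLp p.fst : MemL2Time T p.fst)).integrable
    have hi6 : Integrable (fun t => q t * A g₀ v) (timeMeasure T) :=
      integrable_timeMeasure_of_continuous (by fun_prop)
    have e1 : ∫ t, (T - t) * (ρ t * A v (p.fst t)) ∂(timeMeasure T)
        = ∫ t, q t * A (p.fst t) v ∂(timeMeasure T) := by
      refine integral_congr_ae (.of_forall fun t => ?_)
      simp only [hAs v, ← mul_assoc, hρq]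
    have e2 : ∫ t, (ρ t * C (J v) (p.snd t) - (T - t) * (deriv ρ t * C (J v) (p.snd t)))
        ∂(timeMeasure T) = -∫ t, deriv q t * C (p.snd t) (J v) ∂(timeMeasure T) := by
      rw [← integral_neg]
      refine integral_congr_ae (.of_forall fun t => ?_)
      simp only [hCs (J v), hqd]
      ring
    have e3 : ∫ t, (T - t) * (ρ t * inner ℝ (J v) (f t)) ∂(timeMeasure T)
        = ∫ t, q t * inner ℝ (f t) (J v) ∂(timeMeasure T) := by
      refine integral_congr_ae (.of_forall fun t => ?_)
      simp only [real_inner_comm, ← mul_assoc, hρq]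
    have e4 : ∫ t, r t * A g₀ v ∂(timeMeasure T) = ∫ t, q t * A g₀ v ∂(timeMeasure T) := by
      rw [integral_mul_const, integral_mul_const, hrint]
    have e5 : ∫ t, q t * G t v ∂(timeMeasure T) = ∫ t, q t * inner ℝ (f t) (J v) ∂(timeMeasure T)
        - (∫ t, q t * A (p.fst t) v ∂(timeMeasure T) + ∫ t, q t * A g₀ v ∂(timeMeasure T)) := by
      rw [← integral_add hi5 hi6]
      refine Eq.trans ?_ (integral_sub hi4 (hi5.add hi6))
      refine integral_congr_ae (.of_forall fun t => ?_)
      simp [G]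
      ring
    have e6 : T * (ρ 0 * C g₁ (J v)) = q 0 * C g₁ (J v) := by
      rw [← hρq 0]; ring
    simp only [sub_apply, neg_apply, smul_apply, smul_eq_mul, zero_apply,
      ContinuousLinearMap.integral_apply hi1, ContinuousLinearMap.integral_apply hi3]
    rw [e5]
    have h1' := h1
    simp only [conj_trivial] at h1'
    rw [e1, e2, e3, e4, e6] at h1'
    change ∫ t, deriv q t * C (p.snd t) (J v) ∂(timeMeasure T) - (-(q 0 * C g₁ (J v)) - _) = 0
    linarith
  filter_upwards [key] with t ht
  exact sub_eq_zero.1 ht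

end WaveExistence

/-! ## Fourier series on the periodicity cell -/

section Fourier

attribute [local instance] instMeasureSpaceUnitAddCircle

theorem restrict_cube_toLp (s : SpaceDim) : MeasurePreserving (MeasurableEquiv.toLp 2 (Fin s.dim → ℝ))
    (volume.restrict (Icc (0 : Fin s.dim → ℝ) 1)) (cellMeasure s) := by
  have h : (volume.restrict (Icc (0 : Fin s.dim → ℝ) 1))
      = volume.restrict (Set.univ.pi fun _ => Ioo (0 : ℝ) 1) :=
    (Measure.restrict_congr_set Measure.univ_pi_Ioo_ae_eq_Icc).symm
  have h1 := (EuclideanSpace.volume_preserving_symm_measurableEquiv_toLp (Fin s.dim)).restrict_preimage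
    (s := Set.univ.pi fun _ => Ioo (0 : ℝ) 1) (MeasurableSet.univ_pi fun _ => measurableSet_Ioo)
  rw [← unitCell_eq, ← h] at h1
  exact MeasurePreserving.symm _ h1

/-- The inverse of the projection of the cell onto the torus. -/
def torusToCell (s : SpaceDim) (θ : UnitAddTorus (Fin s.dim)) : Vec s :=
  WithLp.toLp 2 (UnitAddTorus.measurableEquivPiIoc 0 θ).1

theorem coe_torusToCell (s : SpaceDim) (θ : UnitAddTorus (Fin s.dim)) :
    (fun i => ((torusToCell s θ i : ℝ) : UnitAddCircle)) = θ :=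
  (UnitAddTorus.measurableEquivPiIoc 0).symm_apply_apply θ

theorem measurePreserving_torusToCell (s : SpaceDim) :
    MeasurePreserving (torusToCell s) volume (cellMeasure s) := by
  have hm : MeasurableSet {x : Fin s.dim → ℝ | ∀ i, x i ∈ Ioc ((0 : Fin s.dim → ℝ) i)
      ((0 : Fin s.dim → ℝ) i + 1)} := by
    have : {x : Fin s.dim → ℝ | ∀ i, x i ∈ Ioc ((0 : Fin s.dim → ℝ) i)
      ((0 : Fin s.dim → ℝ) i + 1)} = Set.univ.pi fun _ => Ioc (0 : ℝ) 1 := by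
      ext x; simp [Set.mem_pi]
    rw [this]
    exact MeasurableSet.univ_pi fun _ => measurableSet_Ioc
  have h1 := (measurePreserving_subtype_coe hm).comp
    (UnitAddTorus.measurePreserving_equivPiIoc (0 : Fin s.dim → ℝ))
  have h2 : volume.restrict {x : Fin s.dim → ℝ | ∀ i, x i ∈ Ioc ((0 : Fin s.dim → ℝ) i)
      ((0 : Fin s.dim → ℝ) i + 1)} = volume.restrict (Icc (0 : Fin s.dim → ℝ) 1) := by
    refine Measure.restrict_congr_set ?_
    have : {x : Fin s.dim → ℝ | ∀ i, x i ∈ Ioc ((0 : Fin s.dim → ℝ) i)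
      ((0 : Fin s.dim → ℝ) i + 1)} = Set.univ.pi fun _ => Ioc (0 : ℝ) 1 := by
      ext x; simp [Set.mem_pi]
    rw [this]
    exact Measure.univ_pi_Ioc_ae_eq_Icc
  rw [h2] at h1
  exact (restrict_cube_toLp s).comp h1

/-- The phase `2π m · y`. -/
def phase (s : SpaceDim) (m : Fin s.dim → ℤ) : Vec s →L[ℝ] ℝ :=
  (2 * Real.pi) • ∑ i, (m i : ℝ) • (EuclideanSpace.proj i : Vec s →L[ℝ] ℝ)

theorem phase_apply (s : SpaceDim) (m : Fin s.dim → ℤ) (y : Vec s) :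
    phase s m y = 2 * Real.pi * ∑ i, (m i : ℝ) * y i := by
  simp [phase]

theorem mFourier_torus (s : SpaceDim) (m : Fin s.dim → ℤ) (y : Vec s) :
    UnitAddTorus.mFourier m (fun i => ((y i : ℝ) : UnitAddCircle))
      = Complex.exp (phase s m y * Complex.I) := by
  simp only [UnitAddTorus.mFourier, ContinuousMap.coe_mk, fourier_coe_apply]
  rw [← Complex.exp_sum, phase_apply]
  congr 1
  push_cast
  rw [Finset.mul_sum, Finset.sum_mul]
  refine Finset.sum_congr rfl fun i _ => ?_
  field_simp

/-- The cosine coefficient of a function on the cell. -/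
def cosCoeff (s : SpaceDim) (u : Vec s → ℝ) (m : Fin s.dim → ℤ) : ℝ :=
  ∫ y, u y * Real.cos (phase s m y) ∂(cellMeasure s)

/-- The sine coefficient of a function on the cell. -/
def sinCoeff (s : SpaceDim) (u : Vec s → ℝ) (m : Fin s.dim → ℤ) : ℝ :=
  ∫ y, u y * Real.sin (phase s m y) ∂(cellMeasure s)

/-- Parseval's identity on the cell. -/
theorem hasSum_sq_coeff (s : SpaceDim) {u : Vec s → ℝ} (hu : MemLp u 2 (cellMeasure s)) :
    HasSum (fun m => cosCoeff s u m ^ 2 + sinCoeff s u m ^ 2) (∫ y, u y ^ 2 ∂(cellMeasure s)) := by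
  have hmp := measurePreserving_torusToCell s
  have hv : MemLp (fun y => (u y : ℂ)) 2 (cellMeasure s) := hu.ofReal
  have hF := hv.comp_measurePreserving hmp
  have h := UnitAddTorus.hasSum_sq_mFourierCoeff hF.toLp
  have e1 : ∫ t, ‖hF.toLp _ t‖ ^ 2 = ∫ y, u y ^ 2 ∂(cellMeasure s) := by
    rw [← hmp.map_eq, integral_map hmp.measurable.aemeasurable
      (by rw [hmp.map_eq]; exact hu.aestronglyMeasurable.pow 2)]
    refine integral_congr_ae ?_
    filter_upwards [hF.coeFn_toLp] with θ hθ
    rw [hθ]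
    simp
  have hcos : ∀ m, Integrable (fun y => u y * Real.cos (phase s m y)) (cellMeasure s) := fun m =>
    integrable_mul_test hu (by fun_prop)
  have hsin : ∀ m, Integrable (fun y => u y * Real.sin (phase s m y)) (cellMeasure s) := fun m =>
    integrable_mul_test hu (by fun_prop)
  -- For real `u` the complex coefficient has the cosine coefficient as real part and minus the sine
  -- coefficient as imaginary part, so its squared modulus is the stated summand.
  have e2 : ∀ m, UnitAddTorus.mFourierCoeff (hF.toLp _) m
      = (cosCoeff s u m : ℂ) - sinCoeff s u m * Complex.I := by
    intro m
    have h1 : UnitAddTorus.mFourierCoeff (hF.toLp _) m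
        = ∫ θ, (fun y : Vec s => Complex.exp (phase s (-m) y * Complex.I) * (u y : ℂ))
          (torusToCell s θ) := by
      refine integral_congr_ae ?_
      filter_upwards [hF.coeFn_toLp] with θ hθ
      rw [hθ]
      simp only [smul_eq_mul, Function.comp_apply]
      rw [← mFourier_torus, coe_torusToCell]
    have hmeas : AEStronglyMeasurable
        (fun y : Vec s => Complex.exp (phase s (-m) y * Complex.I) * (u y : ℂ)) (cellMeasure s) :=
      (Continuous.aestronglyMeasurable (by fun_prop)).mul hv.aestronglyMeasurable
    have h3 := integral_map hmp.measurable.aemeasurable (by rw [hmp.map_eq]; exact hmeas)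
    rw [hmp.map_eq] at h3
    refine (h1.trans h3.symm).trans ?_
    have h2 : ∀ y, Complex.exp (phase s (-m) y * Complex.I) * (u y : ℂ)
        = ((u y * Real.cos (phase s m y) : ℝ) : ℂ)
          - ((u y * Real.sin (phase s m y) : ℝ) : ℂ) * Complex.I := by
      intro y
      have : phase s (-m) y = -phase s m y := by
        simp [phase_apply]
      rw [this, Complex.exp_mul_I]
      push_cast
      rw [Complex.cos_neg, Complex.sin_neg]
      ring
    simp_rw [h2]
    rw [integral_sub (hcos m).ofReal ((hsin m).ofReal.mul_const _), integral_mul_const,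
      integral_complex_ofReal, integral_complex_ofReal]
    rfl
  rw [e1] at h
  refine h.congr_fun fun m => ?_
  rw [e2, ← Complex.normSq_eq_norm_sq]
  simp [Complex.normSq_apply]
  ring

end Fourier

/-! ### Poincaré inequalities on the cell from Fourier coefficients -/

section CellEstimates

theorem hasFDerivAt_cos_phase (s : SpaceDim) (m : Fin s.dim → ℤ) (y : Vec s) :
    HasFDerivAt (fun y => Real.cos (phase s m y)) (-Real.sin (phase s m y) • phase s m) y :=
  (phase s m).hasFDerivAt.cos

theorem hasFDerivAt_sin_phase (s : SpaceDim) (m : Fin s.dim → ℤ) (y : Vec s) :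
    HasFDerivAt (fun y => Real.sin (phase s m y)) (Real.cos (phase s m y) • phase s m) y :=
  (phase s m).hasFDerivAt.sin

theorem phase_single (s : SpaceDim) (m : Fin s.dim → ℤ) (i : Fin s.dim) :
    phase s m (EuclideanSpace.single i 1) = 2 * Real.pi * m i := by
  rw [phase_apply]
  simp

theorem pderiv_cos_phase (s : SpaceDim) (m : Fin s.dim → ℤ) (i : Fin s.dim) (y : Vec s) :
    pderiv i (fun y => Real.cos (phase s m y)) y
      = -(2 * Real.pi * m i) * Real.sin (phase s m y) := by
  rw [pderiv, (hasFDerivAt_cos_phase s m y).fderiv]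
  simp only [smul_apply, phase_single, smul_eq_mul]
  ring

theorem pderiv_sin_phase (s : SpaceDim) (m : Fin s.dim → ℤ) (i : Fin s.dim) (y : Vec s) :
    pderiv i (fun y => Real.sin (phase s m y)) y
      = (2 * Real.pi * m i) * Real.cos (phase s m y) := by
  rw [pderiv, (hasFDerivAt_sin_phase s m y).fderiv]
  simp only [smul_apply, phase_single, smul_eq_mul]
  ring

theorem isPeriodicTest_cos (s : SpaceDim) (m : Fin s.dim → ℤ) :
    IsPeriodicTest (fun y => Real.cos (phase s m y)) where
  smooth := Real.contDiff_cos.comp (phase s m).contDiff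
  periodic j y := by
    rw [map_add, phase_single, mul_comm (2 * Real.pi), Real.cos_add_int_mul_two_pi]

theorem isPeriodicTest_sin (s : SpaceDim) (m : Fin s.dim → ℤ) :
    IsPeriodicTest (fun y => Real.sin (phase s m y)) where
  smooth := Real.contDiff_sin.comp (phase s m).contDiff
  periodic j y := by
    rw [map_add, phase_single, mul_comm (2 * Real.pi), Real.sin_add_int_mul_two_pi]

theorem isPeriodicTest_one (s : SpaceDim) : IsPeriodicTest (fun _ : Vec s => (1 : ℝ)) where
  smooth := contDiff_const
  periodic _ _ := rfl

theorem pderiv_const {s : SpaceDim} (i : Fin s.dim) (c : ℝ) (y : Vec s) :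
    pderiv i (fun _ : Vec s => c) y = 0 := by
  simp [pderiv]

theorem norm_sq_eq_integral {k : ℕ} {α : Type*} [MeasurableSpace α] {μ : Measure α}
    (u : Lp (EuclideanSpace ℝ (Fin k)) 2 μ) : ‖u‖ ^ 2 = ∑ i, ∫ y, u y i ^ 2 ∂μ := by
  rw [← real_inner_self_eq_norm_sq, L2.inner_def, ← integral_finsetSum]
  · refine integral_congr_ae (.of_forall fun y => ?_)
    simp only [real_inner_self_eq_norm_sq, EuclideanSpace.real_norm_sq_eq]
  · exact fun i _ => (memLp_coord (Lp.memLp u) i).integrable_sq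

theorem norm_sq_eq_integral_real {α : Type*} [MeasurableSpace α] {μ : Measure α}
    (u : Lp ℝ 2 μ) : ‖u‖ ^ 2 = ∫ y, u y ^ 2 ∂μ := by
  rw [← real_inner_self_eq_norm_sq, L2.inner_def]
  refine integral_congr_ae (.of_forall fun y => ?_)
  simp only [real_inner_self_eq_norm_sq, Real.norm_eq_abs, sq_abs]

/-- Some integer `m i` is nonzero, and `4π² ≥ 1`. This crude spectral gap is what gives the Poincaré
inequalities the constant one. -/
theorem one_le_freq {s : SpaceDim} {m : Fin s.dim → ℤ} (hm : m ≠ 0) :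
    1 ≤ ∑ i, (2 * Real.pi * m i) ^ 2 := by
  obtain ⟨i, hi⟩ := Function.ne_iff.1 hm
  have h1 : (1 : ℝ) ≤ (m i : ℝ) ^ 2 := by
    have h : (0 : ℤ) < m i ^ 2 := sq_pos_of_ne_zero hi
    have : (1 : ℤ) ≤ m i ^ 2 := h
    exact_mod_cast this
  have h2 : 1 ≤ (2 * Real.pi * m i) ^ 2 := by
    rw [mul_pow]
    nlinarith [Real.pi_gt_three]
  exact h2.trans (Finset.single_le_sum (f := fun i => (2 * Real.pi * m i) ^ 2)
    (fun j _ => sq_nonneg _) (Finset.mem_univ i))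

theorem sinCoeff_zero (s : SpaceDim) (u : Vec s → ℝ) : sinCoeff s u 0 = 0 := by
  simp [sinCoeff, phase_apply]

theorem cosCoeff_zero (s : SpaceDim) (u : Vec s → ℝ) :
    cosCoeff s u 0 = ∫ y, u y ∂(cellMeasure s) := by
  simp [cosCoeff, phase_apply]

/-- The Poincaré inequality for periodic functions of mean zero. -/
theorem poincare_hOnePer {s : SpaceDim}
    {v : WithLp 2 (Lp ℝ 2 (cellMeasure s) × Lp (Vec s) 2 (cellMeasure s))} (hv : v ∈ hOnePer s)
    (h0 : ∫ y, v.fst y ∂(cellMeasure s) = 0) : ‖v.fst‖ ≤ ‖v.snd‖ := by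
  -- Testing the definition of the periodic gradient with the modes shows that differentiation
  -- multiplies by `2π m k` and exchanges sine and cosine coefficients up to sign.
  have hc : ∀ m k, cosCoeff s (fun y => v.snd y k) m
      = 2 * Real.pi * m k * sinCoeff s v.fst m := by
    intro m k
    refine (hv _ (isPeriodicTest_cos s m) k).trans ?_
    rw [sinCoeff, ← integral_const_mul, ← integral_neg]
    refine integral_congr_ae (.of_forall fun y => ?_)
    simp only [pderiv_cos_phase]
    ring
  have hs : ∀ m k, sinCoeff s (fun y => v.snd y k) m
      = -(2 * Real.pi * m k * cosCoeff s v.fst m) := by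
    intro m k
    refine (hv _ (isPeriodicTest_sin s m) k).trans ?_
    rw [cosCoeff, ← integral_const_mul]
    congr 1
    refine integral_congr_ae (.of_forall fun y => ?_)
    simp only [pderiv_sin_phase]
    ring
  have h1 := hasSum_sq_coeff s (Lp.memLp v.fst)
  have h2 := hasSum_sum (s := Finset.univ) fun k (_ : k ∈ Finset.univ) =>
    hasSum_sq_coeff s (memLp_coord (Lp.memLp v.snd) k)
  rw [← norm_sq_eq_integral_real] at h1
  rw [← norm_sq_eq_integral] at h2
  refine le_of_sq_le_sq (hasSum_le (fun m => ?_) h1 h2) (norm_nonneg _)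
  simp only [hc, hs]
  rcases eq_or_ne m 0 with rfl | hm
  · rw [cosCoeff_zero, h0, sinCoeff_zero]
    simp
  · have := mul_le_mul_of_nonneg_right (one_le_freq hm)
      (by positivity : 0 ≤ cosCoeff s v.fst m ^ 2 + sinCoeff s v.fst m ^ 2)
    rw [one_mul, Finset.sum_mul] at this
    refine this.trans (le_of_eq (Finset.sum_congr rfl fun k _ => ?_))
    ring

/-- Lagrange's identity for the algebraic curl. -/
theorem sum_sq_eps (s : SpaceDim) (a x : Fin s.dim → ℝ) :
    ∑ k, (∑ i, ∑ j, eps s k i j * (a i * x j)) ^ 2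
      = (∑ i, a i ^ 2) * (∑ i, x i ^ 2) - (∑ i, a i * x i) ^ 2 := by
  cases s with
  | two =>
    change ∑ k : Fin 1, (∑ i : Fin 2, ∑ j : Fin 2,
      ((j.val : ℝ) - (i.val : ℝ)) * (a i * x j)) ^ 2
      = (∑ i : Fin 2, a i ^ 2) * (∑ i : Fin 2, x i ^ 2) - (∑ i : Fin 2, a i * x i) ^ 2
    simp [Fin.sum_univ_two]
    ring
  | three =>
    change ∑ k : Fin 3, (∑ i : Fin 3, ∑ j : Fin 3, (((i.val : ℝ) - (k.val : ℝ)) *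
      ((j.val : ℝ) - (i.val : ℝ)) * ((j.val : ℝ) - (k.val : ℝ)) / 2) * (a i * x j)) ^ 2
      = (∑ i : Fin 3, a i ^ 2) * (∑ i : Fin 3, x i ^ 2) - (∑ i : Fin 3, a i * x i) ^ 2
    simp [Fin.sum_univ_three]
    ring

theorem eps_swap (s : SpaceDim) (k : Fin s.curlDim) (i j : Fin s.dim) :
    eps s k i j = -eps s k j i := by
  cases s <;> simp only [eps] <;> ring

/-- The Poincaré inequality for the periodic curl of divergence free fields of mean zero. -/
theorem poincare_hCurlPer {s : SpaceDim}
    {v : WithLp 2 (Lp (Vec s) 2 (cellMeasure s) × Lp (CurlVec s) 2 (cellMeasure s))}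
    (hv : v ∈ hCurlPer s) (h0 : ∀ j, ∫ y, v.fst y j ∂(cellMeasure s) = 0)
    (hcos : ∀ m : Fin s.dim → ℤ, ∑ j, (m j : ℝ) * cosCoeff s (fun y => v.fst y j) m = 0)
    (hsin : ∀ m : Fin s.dim → ℤ, ∑ j, (m j : ℝ) * sinCoeff s (fun y => v.fst y j) m = 0) :
    ‖v.fst‖ ≤ ‖v.snd‖ := by
  have hc : ∀ m k, cosCoeff s (fun y => v.snd y k) m
      = ∑ i, ∑ j, eps s k i j * (2 * Real.pi * m i * sinCoeff s (fun y => v.fst y j) m) := by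
    intro m k
    refine (hv _ (isPeriodicTest_cos s m) k).trans ?_
    rw [← Finset.sum_neg_distrib]
    refine Finset.sum_congr rfl fun i _ => ?_
    rw [← Finset.sum_neg_distrib]
    refine Finset.sum_congr rfl fun j _ => ?_
    rw [sinCoeff, ← integral_const_mul (2 * Real.pi * (m i : ℝ)), ← mul_neg, ← integral_neg]
    congr 1
    refine integral_congr_ae (.of_forall fun y => ?_)
    simp only [pderiv_cos_phase]
    ring
  have hs : ∀ m k, sinCoeff s (fun y => v.snd y k) m
      = -∑ i, ∑ j, eps s k i j * (2 * Real.pi * m i * cosCoeff s (fun y => v.fst y j) m) := by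
    intro m k
    refine (hv _ (isPeriodicTest_sin s m) k).trans ?_
    congr 1
    refine Finset.sum_congr rfl fun i _ => Finset.sum_congr rfl fun j _ => ?_
    rw [cosCoeff, ← integral_const_mul (2 * Real.pi * (m i : ℝ))]
    congr 1
    refine integral_congr_ae (.of_forall fun y => ?_)
    simp only [pderiv_sin_phase]
    ring
  have h1 := hasSum_sum (s := Finset.univ) fun k (_ : k ∈ Finset.univ) =>
    hasSum_sq_coeff s (memLp_coord (Lp.memLp v.fst) k)
  have h2 := hasSum_sum (s := Finset.univ) fun k (_ : k ∈ Finset.univ) =>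
    hasSum_sq_coeff s (memLp_coord (Lp.memLp v.snd) k)
  rw [← norm_sq_eq_integral] at h1 h2
  refine le_of_sq_le_sq (hasSum_le (fun m => ?_) h1 h2) (norm_nonneg _)
  simp only [hc, hs, neg_sq, Finset.sum_add_distrib]
  rcases eq_or_ne m 0 with rfl | hm
  · simp [cosCoeff_zero, h0, sinCoeff_zero]
  · have hmul : ∀ x : Fin s.dim → ℝ, ∑ j, (m j : ℝ) * x j = 0 →
        ∑ j, 2 * Real.pi * m j * x j = 0 := by
      intro x hx
      have : ∑ j, 2 * Real.pi * m j * x j = 2 * Real.pi * ∑ j, (m j : ℝ) * x j := by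
        rw [Finset.mul_sum]
        exact Finset.sum_congr rfl fun j _ => by ring
      rw [this, hx, mul_zero]
    -- With `ξ = 2π m`, the divergence condition removes `(ξ · x)²` from Lagrange's identity,
    -- leaving `|ξ|² |x|² ≥ |x|²` for the cosine and the sine coefficients.
    rw [sum_sq_eps s (fun i => 2 * Real.pi * m i), sum_sq_eps s (fun i => 2 * Real.pi * m i),
      hmul _ (hcos m), hmul _ (hsin m)]
    have h3 := one_le_freq hm
    have h4 : 0 ≤ ∑ j, cosCoeff s (fun y => v.fst y j) m ^ 2 :=
      Finset.sum_nonneg fun j _ => sq_nonneg _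
    have h5 : 0 ≤ ∑ j, sinCoeff s (fun y => v.fst y j) m ^ 2 :=
      Finset.sum_nonneg fun j _ => sq_nonneg _
    nlinarith

end CellEstimates

/-! ### Integration by parts for periodic functions and fields of vanishing curl -/

section PeriodicIntegration

/-- Divergence theorem on the cube for the field `F e_i`: only the two faces orthogonal to `e_i`
contribute, and periodicity makes them cancel. -/
theorem integral_fderiv_periodic {n : ℕ} {F : EuclideanSpace ℝ (Fin (n + 1)) → ℝ}
    (hF : ContDiff ℝ 1 F) (i : Fin (n + 1))
    (hper : ∀ y, F (y + EuclideanSpace.single i 1) = F y) :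
    ∫ x in Icc (0 : Fin (n + 1) → ℝ) 1,
      fderiv ℝ F (WithLp.toLp 2 x) (EuclideanSpace.single i 1) = 0 := by
  let L : (Fin (n + 1) → ℝ) →L[ℝ] EuclideanSpace ℝ (Fin (n + 1)) :=
    (PiLp.continuousLinearEquiv 2 ℝ (fun _ : Fin (n + 1) => ℝ)).symm
  let f : Fin (n + 1) → (Fin (n + 1) → ℝ) → ℝ := fun j x => if j = i then F (L x) else 0
  let f' : Fin (n + 1) → (Fin (n + 1) → ℝ) → (Fin (n + 1) → ℝ) →L[ℝ] ℝ := fun j x =>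
    if j = i then (fderiv ℝ F (L x)).comp L else 0
  have hsum : ∀ x, ∑ j, f' j x (Pi.single j 1)
      = fderiv ℝ F (WithLp.toLp 2 x) (EuclideanSpace.single i 1) := by
    intro x
    rw [Finset.sum_eq_single i]
    · simp only [f', if_true]
      rfl
    · intro j _ hj
      simp [f', hj]
    · simp
  have hcont : Continuous fun x => fderiv ℝ F (L x) :=
    (hF.continuous_fderiv (by simp)).comp L.continuous
  have hc : Continuous fun x : Fin (n + 1) → ℝ =>
      fderiv ℝ F (WithLp.toLp 2 x) (EuclideanSpace.single i 1) :=
    hcont.clm_apply continuous_const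
  have h := integral_divergence_of_hasFDerivAt_off_countable' (0 : Fin (n + 1) → ℝ) 1
    zero_le_one f f' ∅ countable_empty (fun j => by
      by_cases hj : j = i
      · simp only [f, hj, if_true]
        exact (hF.continuous.comp L.continuous).continuousOn
      · simp only [f, hj, if_false]
        exact continuousOn_const) (fun x _ j => by
      by_cases hj : j = i
      · simp only [f, f', hj, if_true]
        exact ((hF.differentiable (by simp)) (L x)).hasFDerivAt.comp x L.hasFDerivAt
      · simp only [f, f', hj, if_false]
        exact hasFDerivAt_const _ _) (by
      simp_rw [hsum]
      exact hc.continuousOn.integrableOn_compact isCompact_Icc)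
  simp_rw [hsum] at h
  rw [h]
  refine Finset.sum_eq_zero fun j _ => ?_
  rw [sub_eq_zero]
  refine integral_congr_ae (.of_forall fun x => ?_)
  by_cases hj : j = i
  · subst hj
    simp only [f, if_true]
    rw [← hper (L (j.insertNth ((0 : Fin (n + 1) → ℝ) j) x))]
    congr 1
    ext k
    change (j.insertNth (1 : ℝ) x : Fin (n + 1) → ℝ) k
      = (j.insertNth (0 : ℝ) x : Fin (n + 1) → ℝ) k + (EuclideanSpace.single j (1 : ℝ)).ofLp k
    induction k using Fin.succAboveCases j with
    | x => simp
    | p k => simp [Fin.succAbove_ne]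
  · simp [f, hj]

theorem integral_pderiv_eq_zero {s : SpaceDim} {F : Vec s → ℝ} (hF : IsPeriodicTest F)
    (i : Fin s.dim) : ∫ y, pderiv i F y ∂(cellMeasure s) = 0 := by
  rw [← (restrict_cube_toLp s).integral_comp']
  cases s with
  | two => exact integral_fderiv_periodic (n := 1) (hF.smooth.of_le (by simp)) i (hF.periodic i)
  | three => exact integral_fderiv_periodic (n := 2) (hF.smooth.of_le (by simp)) i (hF.periodic i)

theorem IsPeriodicTest.mul {s : SpaceDim} {φ ψ : Vec s → ℝ} (hφ : IsPeriodicTest φ)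
    (hψ : IsPeriodicTest ψ) : IsPeriodicTest (fun y => φ y * ψ y) where
  smooth := hφ.smooth.mul hψ.smooth
  periodic j y := by rw [hφ.periodic, hψ.periodic]

theorem integrable_cell_of_continuous {s : SpaceDim} {φ : Vec s → ℝ} (hφ : Continuous φ) :
    Integrable φ (cellMeasure s) := by
  simpa using integrable_mul_test (memLp_const (1 : ℝ)) hφ

/-- Integration by parts for periodic functions. -/
theorem integral_mul_pderiv {s : SpaceDim} {φ ψ : Vec s → ℝ} (hφ : IsPeriodicTest φ)
    (hψ : IsPeriodicTest ψ) (i : Fin s.dim) :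
    ∫ y, φ y * pderiv i ψ y ∂(cellMeasure s) = -∫ y, pderiv i φ y * ψ y ∂(cellMeasure s) := by
  have h := integral_pderiv_eq_zero (hφ.mul hψ) i
  have e : ∀ y, pderiv i (fun y => φ y * ψ y) y = φ y * pderiv i ψ y + pderiv i φ y * ψ y := by
    intro y
    have h1 : HasFDerivAt (fun y => φ y * ψ y) _ y :=
      ((hφ.smooth.differentiable (by simp)) y).hasFDerivAt.mul
      ((hψ.smooth.differentiable (by simp)) y).hasFDerivAt
    rw [pderiv, h1.fderiv]
    simp [pderiv, mul_comm]
  simp_rw [e] at h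
  have h2 := (integral_add
    (integrable_cell_of_continuous (hφ.smooth.continuous.mul (hψ.continuous_pderiv i)))
    (integrable_cell_of_continuous ((hφ.continuous_pderiv i).mul hψ.smooth.continuous))).symm.trans h
  simp only [Pi.mul_apply] at h2
  linarith

theorem memLp_cell_of_continuous {s : SpaceDim} {A : Type*} [NormedAddCommGroup A]
    {φ : Vec s → A} (hφ : Continuous φ) : MemLp φ 2 (cellMeasure s) := by
  have hK : IsCompact ((fun y : Vec s => (WithLp.ofLp y : Fin s.dim → ℝ)) ⁻¹' Icc 0 1) :=
    (PiLp.homeomorph 2 (fun _ : Fin s.dim => ℝ)).isCompact_preimage.2 isCompact_Icc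
  obtain ⟨C, hC⟩ := hK.exists_bound_of_continuousOn hφ.continuousOn
  have hm : AEStronglyMeasurable φ (cellMeasure s) :=
    hφ.aestronglyMeasurable
  refine MemLp.of_bound hm C ?_
  filter_upwards [ae_restrict_mem (measurableSet_unitCell s)] with y hy
  exact hC y ⟨fun i => (hy i).1.le, fun i => (hy i).2.le⟩

/-- The class of a continuous function in `L²(Y)`. -/
def cellClass {s : SpaceDim} {A : Type} [NormedAddCommGroup A] {φ : Vec s → A}
    (hφ : Continuous φ) : Lp A 2 (cellMeasure s) :=
  (memLp_cell_of_continuous hφ).toLp φ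

theorem coeFn_cellClass {s : SpaceDim} {A : Type} [NormedAddCommGroup A] {φ : Vec s → A}
    (hφ : Continuous φ) : cellClass hφ =ᵐ[cellMeasure s] φ :=
  (memLp_cell_of_continuous hφ).coeFn_toLp

/-- A field `φ a` with `∇φ × a = 0` has vanishing periodic curl. -/
theorem smul_mem_hCurlPer {s : SpaceDim} {φ : Vec s → ℝ} (hφ : IsPeriodicTest φ) (a : Vec s)
    (h : ∀ k y, ∑ i, ∑ j, eps s k i j * (pderiv i φ y * a j) = 0) :
    WithLp.toLp 2 (cellClass (φ := fun y => φ y • a)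
      (hφ.smooth.continuous.smul continuous_const), 0) ∈ hCurlPer s := by
  intro ψ hψ k
  have h1 : ∀ i j, ∫ y, (cellClass (φ := fun y => φ y • a)
      (hφ.smooth.continuous.smul continuous_const) y) j * pderiv i ψ y ∂(cellMeasure s)
      = -∫ y, a j * (pderiv i φ y * ψ y) ∂(cellMeasure s) := by
    intro i j
    rw [integral_const_mul, ← mul_neg, ← integral_mul_pderiv hφ hψ, ← integral_const_mul]
    refine integral_congr_ae ?_
    filter_upwards [coeFn_cellClass (φ := fun y => φ y • a)
      (hφ.smooth.continuous.smul continuous_const)] with y hy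
    rw [hy]
    simp
    ring
  have h2 : ∫ y, (0 : Lp (CurlVec s) 2 (cellMeasure s)) y k * ψ y ∂(cellMeasure s) = 0 := by
    refine integral_eq_zero_of_ae ?_
    filter_upwards [Lp.coeFn_zero (CurlVec s) 2 (cellMeasure s)] with y hy
    rw [hy]
    simp
  refine h2.trans ?_
  change 0 = -∑ i, ∑ j, eps s k i j * ∫ y, (cellClass (φ := fun y => φ y • a)
      (hφ.smooth.continuous.smul continuous_const) y) j * pderiv i ψ y ∂(cellMeasure s)
  simp only [h1, mul_neg, Finset.sum_neg_distrib, neg_neg]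
  have hi : ∀ i j, Integrable (fun y => eps s k i j * (a j * (pderiv i φ y * ψ y)))
      (cellMeasure s) := fun i j =>
    ((integrable_cell_of_continuous ((hφ.continuous_pderiv i).mul hψ.smooth.continuous)).const_mul
      _).const_mul _
  simp_rw [← integral_const_mul]
  simp_rw [← integral_finsetSum _ fun j _ => hi _ j]
  rw [← integral_finsetSum _ fun i _ => integrable_finsetSum _ fun j _ => hi i j]
  refine (integral_eq_zero_of_ae (.of_forall fun y => ?_)).symm
  have := congrArg (· * ψ y) (h k y)
  simp only [zero_mul, Finset.sum_mul] at this
  refine Eq.trans (Finset.sum_congr rfl fun i _ => Finset.sum_congr rfl fun j _ => ?_) this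
  ring

/-- The symbol is antisymmetric in `i, j`, the product `a i * a j` symmetric. For `a = m` this is
the reason why a mode directed along its own frequency has no curl. -/
theorem sum_eps_symm {s : SpaceDim} (k : Fin s.curlDim) (c : ℝ) (a : Fin s.dim → ℝ) :
    ∑ i, ∑ j, eps s k i j * (c * (a i * a j)) = 0 := by
  have h : ∑ i, ∑ j, eps s k i j * (c * (a i * a j))
      = -∑ i, ∑ j, eps s k i j * (c * (a i * a j)) := by
    rw [← Finset.sum_neg_distrib]
    nth_rewrite 1 [Finset.sum_comm]
    refine Finset.sum_congr rfl fun i _ => ?_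
    rw [← Finset.sum_neg_distrib]
    refine Finset.sum_congr rfl fun j _ => ?_
    rw [eps_swap]
    ring
  linarith

/-- The constant one is the single kernel element needed for gradients: orthogonality to it means
mean zero. -/
theorem const_mem_hOnePer (s : SpaceDim) :
    WithLp.toLp 2 (cellClass (continuous_const (y := (1 : ℝ))), 0) ∈ hOnePer s := by
  intro ψ hψ k
  have h2 : ∫ y, (0 : Lp (Vec s) 2 (cellMeasure s)) y k * ψ y ∂(cellMeasure s) = 0 := by
    refine integral_eq_zero_of_ae ?_
    filter_upwards [Lp.coeFn_zero (Vec s) 2 (cellMeasure s)] with y hy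
    rw [hy]
    simp
  refine h2.trans ?_
  rw [zero_eq_neg, ← integral_pderiv_eq_zero hψ k]
  refine integral_congr_ae ?_
  filter_upwards [coeFn_cellClass (s := s) (continuous_const (y := (1 : ℝ)))] with y hy
  refine (congrArg (· * pderiv k ψ y) hy).trans ?_
  simp

end PeriodicIntegration

/-! ### Slices of square integrable functions on a product -/

section Slices

variable {Z Y : Type*} [MeasurableSpace Z] [MeasurableSpace Y] {μ : Measure Z} {ν : Measure Y}
  [SFinite μ] [SFinite ν] {A : Type*} [NormedAddCommGroup A]

theorem ae_memLp_slice (w : Lp A 2 (μ.prod ν)) : ∀ᵐ z ∂μ, MemLp (fun y => w (z, y)) 2 ν := by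
  have h1 : Integrable (fun p => ‖w p‖ ^ 2) (μ.prod ν) := by
    simpa using (Lp.memLp w).integrable_norm_pow (by norm_num)
  filter_upwards [h1.prod_right_ae, (Lp.aestronglyMeasurable w).prodMk_left] with z hz hm
  refine (integrable_norm_rpow_iff hm (by norm_num) (by norm_num)).1 ?_
  simpa using hz

theorem norm_sq_eq_integral_norm {α : Type*} [MeasurableSpace α] {ρ : Measure α}
    [InnerProductSpace ℝ A] (w : Lp A 2 ρ) : ‖w‖ ^ 2 = ∫ p, ‖w p‖ ^ 2 ∂ρ := by
  rw [← real_inner_self_eq_norm_sq, L2.inner_def]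
  simp_rw [real_inner_self_eq_norm_sq]

theorem integrable_norm_sq_Lp {α : Type*} [MeasurableSpace α] {ρ : Measure α} (w : Lp A 2 ρ) :
    Integrable (fun p => ‖w p‖ ^ 2) ρ := by
  simpa using (Lp.memLp w).integrable_norm_pow (by norm_num)

theorem norm_sq_eq_integral_slice [InnerProductSpace ℝ A] (w : Lp A 2 (μ.prod ν)) :
    ‖w‖ ^ 2 = ∫ z, ∫ y, ‖w (z, y)‖ ^ 2 ∂ν ∂μ := by
  rw [norm_sq_eq_integral_norm, integral_prod _ (integrable_norm_sq_Lp w)]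

end Slices

/-! ### Closedness and Poincaré inequality for the slice spaces -/

section SliceSpace

variable {s : SpaceDim} {D : Set (Vec s)} {k : ℕ} {A B : Type} [NormedAddCommGroup A]
  [InnerProductSpace ℝ A] [NormedAddCommGroup B] [InnerProductSpace ℝ B]
  {S : Submodule ℝ (WithLp 2 (Lp A 2 (cellMeasure s) × Lp B 2 (cellMeasure s)))}

theorem norm_toLp_sub_sq {E : Type} [NormedAddCommGroup E] [InnerProductSpace ℝ E]
    {f g : Vec s → E} {v : Lp E 2 (cellMeasure s)}
    (hf : MemLp f 2 (cellMeasure s)) (hg : g =ᵐ[cellMeasure s] v) :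
    ‖hf.toLp f - v‖ ^ 2 = ∫ y, ‖f y - g y‖ ^ 2 ∂(cellMeasure s) := by
  rw [norm_sq_eq_integral_norm]
  refine integral_congr_ae ?_
  filter_upwards [Lp.coeFn_sub (hf.toLp f) v, hf.coeFn_toLp, hg] with y h1 h2 h3
  rw [h1, Pi.sub_apply, h2, h3]

/-- The squared distance of the limit to the sequence is the integral of the squared distances of
their slices. For almost every `z` the slice of the limit is therefore approximated arbitrarily well
by elements of the closed space `S`. -/
theorem isClosed_sliceSpace (hS : IsClosed (S : Set (WithLp 2 (Lp A 2 (cellMeasure s) ×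
    Lp B 2 (cellMeasure s))))) : IsClosed (sliceSpace s D k S : Set
      (WithLp 2 (Lp A 2 (levelMeasure s D k) × Lp B 2 (levelMeasure s D k)))) := by
  rw [← isSeqClosed_iff_isClosed]
  intro q p hq hqp
  let F : ℕ → Pts s k → ℝ := fun n z => ∫ y, ‖(p - q n).fst (z, y)‖ ^ 2 ∂(cellMeasure s)
    + ∫ y, ‖(p - q n).snd (z, y)‖ ^ 2 ∂(cellMeasure s)
  have hi1 : ∀ n, Integrable (fun z => ∫ y, ‖(p - q n).fst (z, y)‖ ^ 2 ∂(cellMeasure s))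
      (ptsMeasure s D k) := fun n =>
    (integrable_norm_sq_Lp (p - q n).fst).integral_prod_left
  have hi2 : ∀ n, Integrable (fun z => ∫ y, ‖(p - q n).snd (z, y)‖ ^ 2 ∂(cellMeasure s))
      (ptsMeasure s D k) := fun n =>
    (integrable_norm_sq_Lp (p - q n).snd).integral_prod_left
  have hFi : ∀ n, ∫ z, F n z ∂(ptsMeasure s D k) = ‖p - q n‖ ^ 2 := by
    intro n
    rw [integral_add (hi1 n) (hi2 n), WithLp.prod_norm_sq_eq_of_L2]
    congr 1
    · exact (norm_sq_eq_integral_slice (p - q n).fst).symm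
    · exact (norm_sq_eq_integral_slice (p - q n).snd).symm
  have hF0 : ∀ n z, 0 ≤ F n z := fun n z =>
    add_nonneg (integral_nonneg fun y => sq_nonneg _) (integral_nonneg fun y => sq_nonneg _)
  have hlim : Filter.Tendsto (fun n => ‖p - q n‖ ^ 2) Filter.atTop (nhds 0) := by
    have h1 := (tendsto_const_nhds (x := p)).sub hqp
    rw [sub_self] at h1
    simpa using h1.norm.pow 2
  -- The infimum replaces the choice of an almost everywhere convergent subsequence: its integral is
  -- below every `‖p - q n‖²`.
  have hinf : ∀ᵐ z ∂(ptsMeasure s D k), ⨅ n, ENNReal.ofReal (F n z) = 0 := by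
    have hF : ∀ n, Integrable (F n) (ptsMeasure s D k) := fun n => (hi1 n).add (hi2 n)
    have hm : AEMeasurable (fun z => ⨅ n, ENNReal.ofReal (F n z)) (ptsMeasure s D k) :=
      AEMeasurable.iInf fun n => (hF n).aestronglyMeasurable.aemeasurable.ennreal_ofReal
    refine (lintegral_eq_zero_iff' hm).1 (le_antisymm ?_ zero_le)
    have h2 : Filter.Tendsto (fun n => ENNReal.ofReal (‖p - q n‖ ^ 2)) Filter.atTop (nhds 0) := by
      simpa using (ENNReal.tendsto_ofReal hlim)
    refine ge_of_tendsto' h2 fun n => ?_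
    rw [← hFi, ofReal_integral_eq_lintegral_ofReal (hF n) (.of_forall (hF0 n))]
    exact lintegral_mono fun z => iInf_le _ n
  have hsub1 : ∀ᵐ z ∂(ptsMeasure s D k), ∀ n, ∀ᵐ y ∂(cellMeasure s),
      (p - q n).fst (z, y) = p.fst (z, y) - (q n).fst (z, y) :=
    ae_all_iff.2 fun n => Measure.ae_ae_of_ae_prod (Lp.coeFn_sub p.fst (q n).fst)
  have hsub2 : ∀ᵐ z ∂(ptsMeasure s D k), ∀ n, ∀ᵐ y ∂(cellMeasure s),
      (p - q n).snd (z, y) = p.snd (z, y) - (q n).snd (z, y) :=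
    ae_all_iff.2 fun n => Measure.ae_ae_of_ae_prod (Lp.coeFn_sub p.snd (q n).snd)
  have hq' := ae_all_iff.2 hq
  change ∀ᵐ z ∂(ptsMeasure s D k), _
  filter_upwards [hinf, hsub1, hsub2, hq', ae_memLp_slice p.fst, ae_memLp_slice p.snd] with
    z hz h1 h2 h3 m1 m2
  let v : WithLp 2 (Lp A 2 (cellMeasure s) × Lp B 2 (cellMeasure s)) :=
    WithLp.toLp 2 (m1.toLp, m2.toLp)
  refine ⟨v, ?_, m1.coeFn_toLp.symm, m2.coeFn_toLp.symm⟩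
  rw [← SetLike.mem_coe, ← hS.closure_eq, Metric.mem_closure_iff]
  intro ε hε
  have h4 : ⨅ n, ENNReal.ofReal (F n z) < ENNReal.ofReal (ε ^ 2) := by
    rw [hz, ENNReal.ofReal_pos]; positivity
  obtain ⟨n, hn⟩ := iInf_lt_iff.1 h4
  obtain ⟨w, hw, hw1, hw2⟩ := h3 n
  refine ⟨w, hw, ?_⟩
  have h5 : dist v w ^ 2 = F n z := by
    rw [dist_eq_norm, WithLp.prod_norm_sq_eq_of_L2]
    congr 1
    · refine (norm_toLp_sub_sq m1 hw1).trans (integral_congr_ae ?_)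
      filter_upwards [h1 n] with y hy
      exact congrArg (fun x => ‖x‖ ^ 2) hy.symm
    · refine (norm_toLp_sub_sq m2 hw2).trans (integral_congr_ae ?_)
      filter_upwards [h2 n] with y hy
      exact congrArg (fun x => ‖x‖ ^ 2) hy.symm
  rw [← h5] at hn
  exact lt_of_pow_lt_pow_left₀ 2 hε.le ((ENNReal.ofReal_lt_ofReal_iff (by positivity)).1 hn)

instance [IsFiniteMeasure (domMeasure s D)] : IsFiniteMeasure (ptsMeasure s D k) := by
  unfold ptsMeasure; infer_instance

/-- An element orthogonal to the kernel of the differential is controlled by its differential if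
this holds for almost all slices. -/
theorem norm_fst_le_of_orthogonal [IsFiniteMeasure (domMeasure s D)] {ι : Type*} [Countable ι]
    (κ : ι → Lp A 2 (cellMeasure s)) (hκ : ∀ i, WithLp.toLp 2 (κ i, 0) ∈ S)
    (hS : ∀ v ∈ S, (∀ i, inner ℝ (κ i) v.fst = 0) → ‖v.fst‖ ≤ ‖v.snd‖)
    {p : WithLp 2 (Lp A 2 (levelMeasure s D k) × Lp B 2 (levelMeasure s D k))}
    (hp : p ∈ sliceSpace s D k S)
    (horth : ∀ w, WithLp.toLp 2 (w, 0) ∈ sliceSpace s D k S → inner ℝ w p.fst = 0) :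
    ‖p.fst‖ ≤ ‖p.snd‖ := by
  have hκm : ∀ i, MemLp (fun x : Pts s k × Vec s => κ i x.2) 2 (levelMeasure s D k) := fun i =>
    (Lp.memLp (κ i)).comp_snd (ptsMeasure s D k)
  have hint : ∀ i, Integrable (fun x : Pts s k × Vec s => inner ℝ (κ i x.2) (p.fst x))
      (levelMeasure s D k) := fun i =>
    (L2.integrable_inner ((hκm i).toLp _) p.fst).congr (by
      filter_upwards [(hκm i).coeFn_toLp] with x hx
      rw [hx])
  -- For each measurable `E` of finite measure the function `1_E(z) κ_i(y)` represents an element of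
  -- the kernel; orthogonality to all of them makes the slice pairing with `κ_i` vanish for almost
  -- every `z`.
  have h0 : ∀ i, (fun z => ∫ y, inner ℝ (κ i y) (p.fst (z, y)) ∂(cellMeasure s))
      =ᵐ[ptsMeasure s D k] 0 := by
    intro i
    refine (hint i).integral_prod_left.ae_eq_zero_of_forall_setIntegral_eq_zero ?_
    intro E hE _
    have hm : MemLp ((E ×ˢ univ).indicator fun x : Pts s k × Vec s => κ i x.2) 2
        (levelMeasure s D k) := (hκm i).indicator (hE.prod MeasurableSet.univ)
    have hmem : WithLp.toLp 2 (hm.toLp, 0) ∈ sliceSpace s D k S := by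
      have e1 := Measure.ae_ae_of_ae_prod hm.coeFn_toLp
      have e2 := Measure.ae_ae_of_ae_prod (Lp.coeFn_zero B 2 (levelMeasure s D k))
      change ∀ᵐ z ∂(ptsMeasure s D k), _
      filter_upwards [e1, e2] with z h1 h2
      by_cases hz : z ∈ E
      · refine ⟨_, hκ i, ?_, ?_⟩
        · filter_upwards [h1] with y hy
          refine hy.trans ?_
          simp [hz]
        · filter_upwards [h2, Lp.coeFn_zero B 2 (cellMeasure s)] with y hy hy'
          exact hy.trans hy'.symm
      · refine ⟨0, S.zero_mem, ?_, ?_⟩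
        · filter_upwards [h1, Lp.coeFn_zero A 2 (cellMeasure s)] with y hy hy'
          refine hy.trans (Eq.trans ?_ hy'.symm)
          simp [hz]
        · filter_upwards [h2, Lp.coeFn_zero B 2 (cellMeasure s)] with y hy hy'
          exact hy.trans hy'.symm
    have h1 := horth _ hmem
    rw [L2.inner_def] at h1
    have h2 : ∫ x, inner ℝ (hm.toLp _ x) (p.fst x) ∂(levelMeasure s D k)
        = ∫ x, (E ×ˢ univ).indicator (fun x : Pts s k × Vec s => inner ℝ (κ i x.2) (p.fst x)) x
          ∂(levelMeasure s D k) := by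
      refine integral_congr_ae ?_
      filter_upwards [hm.coeFn_toLp] with x hx
      rw [hx]
      by_cases hxE : x ∈ E ×ˢ univ
      · rw [indicator_of_mem hxE, indicator_of_mem hxE]
      · rw [indicator_of_notMem hxE, indicator_of_notMem hxE, inner_zero_left]
    rw [h2] at h1
    replace h1 := (integral_prod _
      ((hint i).indicator (hE.prod MeasurableSet.univ))).symm.trans h1
    rw [← integral_indicator hE, ← h1]
    refine integral_congr_ae (.of_forall fun z => ?_)
    by_cases hz : z ∈ E <;> simp [hz]
  have hae : ∀ᵐ z ∂(ptsMeasure s D k), ∫ y, ‖p.fst (z, y)‖ ^ 2 ∂(cellMeasure s)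
      ≤ ∫ y, ‖p.snd (z, y)‖ ^ 2 ∂(cellMeasure s) := by
    -- Countability of the family gives one null set for all `i`, so no projection has to be chosen
    -- measurably in `z`.
    have h0' := ae_all_iff.2 h0
    have hp' : ∀ᵐ z ∂(ptsMeasure s D k), _ := hp
    filter_upwards [h0', hp'] with z hz hpz
    obtain ⟨v, hv, hv1, hv2⟩ := hpz
    have h1 := hS v hv fun i => by
      rw [L2.inner_def, ← show _ = (0 : ℝ) from hz i]
      refine integral_congr_ae ?_
      filter_upwards [hv1] with y hy
      rw [hy]
    have h2 := pow_le_pow_left₀ (norm_nonneg _) h1 2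
    rw [norm_sq_eq_integral_norm, norm_sq_eq_integral_norm] at h2
    refine le_trans (le_of_eq (integral_congr_ae ?_))
      (h2.trans (le_of_eq (integral_congr_ae ?_)))
    · filter_upwards [hv1] with y hy
      rw [hy]
    · filter_upwards [hv2] with y hy
      rw [hy]
  refine le_of_sq_le_sq ?_ (norm_nonneg _)
  have e1 := norm_sq_eq_integral_slice p.fst
  have e2 := norm_sq_eq_integral_slice p.snd
  exact e1.trans_le ((integral_mono_ae (integrable_norm_sq_Lp p.fst).integral_prod_left
    (integrable_norm_sq_Lp p.snd).integral_prod_left hae).trans e2.ge)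

/-- The Poincaré inequality on the quotient by the kernel of the differential. -/
theorem norm_mk_le_sliceDiff [CompleteSpace A] [CompleteSpace B]
    [IsFiniteMeasure (domMeasure s D)] {ι : Type*} [Countable ι]
    (hSc : IsClosed (S : Set (WithLp 2 (Lp A 2 (cellMeasure s) × Lp B 2 (cellMeasure s)))))
    (κ : ι → Lp A 2 (cellMeasure s)) (hκ : ∀ i, WithLp.toLp 2 (κ i, 0) ∈ S)
    (hS : ∀ v ∈ S, (∀ i, inner ℝ (κ i) v.fst = 0) → ‖v.fst‖ ≤ ‖v.snd‖)
    (p : sliceSpace s D k S) :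
    ‖(Submodule.Quotient.mk p : sliceSpace s D k S ⧸ (sliceDiff s D k S).ker)‖
      ≤ 2 * ‖sliceDiff s D k S p‖ := by
  have : CompleteSpace (sliceSpace s D k S) := (isClosed_sliceSpace hSc).completeSpace_coe
  let K : Submodule ℝ (sliceSpace s D k S) := (sliceDiff s D k S).ker
  have : CompleteSpace K := (sliceDiff s D k S).isClosed_ker.completeSpace_coe
  -- The quotient norm is estimated through the representative orthogonal to the kernel.
  let r : K := K.orthogonalProjectionOnto p
  let p' : sliceSpace s D k S := p - r
  have hr : sliceDiff s D k S r = 0 := r.2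
  have h1 : (Submodule.Quotient.mk p : sliceSpace s D k S ⧸ K) = Submodule.Quotient.mk p' := by
    rw [Submodule.Quotient.eq]
    simp [p']
  have h2 : sliceDiff s D k S p' = sliceDiff s D k S p := by
    rw [map_sub, hr, sub_zero]
  have h3 : ‖p'.1.fst‖ ≤ ‖p'.1.snd‖ := by
    refine norm_fst_le_of_orthogonal κ hκ hS p'.2 fun w hw => ?_
    have h4 : inner ℝ (⟨_, hw⟩ : sliceSpace s D k S) p' = 0 :=
      (Submodule.mem_orthogonal K p').1 (K.sub_starProjection_mem_orthogonal p) _ rfl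
    have h5 : inner ℝ (WithLp.toLp 2 (w, (0 : Lp B 2 (levelMeasure s D k)))) p'.1 = 0 := h4
    rw [WithLp.prod_inner_apply] at h5
    simpa using h5
  -- The squared norm is at most `2 ‖p'.1.snd‖²`, so `√2` would do; `2` is the convenient constant.
  have h4 : ‖p'‖ ≤ 2 * ‖p'.1.snd‖ := by
    refine le_of_sq_le_sq ?_ (by positivity)
    have : ‖p'‖ ^ 2 = ‖p'.1.fst‖ ^ 2 + ‖p'.1.snd‖ ^ 2 := WithLp.prod_norm_sq_eq_of_L2 p'.1
    rw [this]
    nlinarith [norm_nonneg p'.1.fst, norm_nonneg p'.1.snd]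
  change ‖(Submodule.Quotient.mk p : sliceSpace s D k S ⧸ K)‖ ≤ _
  rw [h1]
  refine (Submodule.Quotient.norm_mk_le K p').trans (h4.trans (le_of_eq ?_))
  rw [← h2]
  rfl

end SliceSpace

/-! ### Closedness of the cell spaces and completeness of `W`, `V_i`, `W_i` -/

section Closedness

theorem inner_cellClass {s : SpaceDim} {A : Type} [NormedAddCommGroup A] [InnerProductSpace ℝ A]
    {φ : Vec s → A} (hφ : Continuous φ) (v : Lp A 2 (cellMeasure s)) :
    inner ℝ (cellClass hφ) v = ∫ y, inner ℝ (φ y) (v y) ∂(cellMeasure s) := by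
  rw [L2.inner_def]
  refine integral_congr_ae ?_
  filter_upwards [coeFn_cellClass hφ] with y hy
  rw [hy]

theorem inner_cellClass_smul {s : SpaceDim} {m : ℕ} {φ : Vec s → ℝ} (hφ : Continuous φ)
    (a : EuclideanSpace ℝ (Fin m)) (v : Lp (EuclideanSpace ℝ (Fin m)) 2 (cellMeasure s)) :
    inner ℝ (cellClass (φ := fun y => φ y • a) (hφ.smul continuous_const)) v
      = ∑ j, a j * ∫ y, v y j * φ y ∂(cellMeasure s) := by
  rw [inner_cellClass]
  simp_rw [← integral_const_mul]
  rw [← integral_finsetSum]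
  · refine integral_congr_ae (.of_forall fun y => ?_)
    simp only [inner_smul_left, PiLp.inner_apply, RCLike.inner_apply, conj_trivial, Finset.mul_sum]
    exact Finset.sum_congr rfl fun j _ => by ring
  · exact fun j _ => (integrable_mul_test (memLp_coord (Lp.memLp v) j) hφ).const_mul _

theorem continuous_integral_coord {s : SpaceDim} {m : ℕ} {φ : Vec s → ℝ} (hφ : Continuous φ)
    (k : Fin m) : Continuous fun v : Lp (EuclideanSpace ℝ (Fin m)) 2 (cellMeasure s) =>
      ∫ y, v y k * φ y ∂(cellMeasure s) := by
  have h : (fun v : Lp (EuclideanSpace ℝ (Fin m)) 2 (cellMeasure s) =>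
      ∫ y, v y k * φ y ∂(cellMeasure s)) = fun v => inner ℝ (cellClass
        (φ := fun y => φ y • (EuclideanSpace.single k (1 : ℝ) : EuclideanSpace ℝ (Fin m)))
        (hφ.smul continuous_const)) v := by
    funext v
    rw [inner_cellClass_smul hφ, Finset.sum_eq_single k]
    · simp
    · intro j _ hj
      simp [hj]
    · exact fun hk => (hk (Finset.mem_univ k)).elim
  rw [h]
  exact continuous_const.inner continuous_id

theorem continuous_integral_mul {s : SpaceDim} {φ : Vec s → ℝ} (hφ : Continuous φ) :
    Continuous fun v : Lp ℝ 2 (cellMeasure s) => ∫ y, v y * φ y ∂(cellMeasure s) := by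
  have h : (fun v : Lp ℝ 2 (cellMeasure s) => ∫ y, v y * φ y ∂(cellMeasure s))
      = fun v => inner ℝ (cellClass hφ) v := by
    funext v
    rw [inner_cellClass]
    rfl
  rw [h]
  exact continuous_const.inner continuous_id

/-- Each defining identity equates two continuous functionals of the pair, since pairing with a
fixed continuous function on the cell is continuous in L². -/
theorem isClosed_hOnePer (s : SpaceDim) : IsClosed (hOnePer s : Set
    (WithLp 2 (Lp ℝ 2 (cellMeasure s) × Lp (Vec s) 2 (cellMeasure s)))) := by
  have h : (hOnePer s : Set (WithLp 2 (Lp ℝ 2 (cellMeasure s) × Lp (Vec s) 2 (cellMeasure s))))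
      = {p | ∀ ψ : Vec s → ℝ, IsPeriodicTest ψ → ∀ k : Fin s.dim,
    ∫ y, p.snd y k * ψ y ∂(cellMeasure s) = -∫ y, p.fst y * pderiv k ψ y ∂(cellMeasure s)} := rfl
  rw [h]
  simp only [ofPred_forall]
  refine isClosed_iInter fun ψ => isClosed_iInter fun hψ => isClosed_iInter fun k => ?_
  exact isClosed_eq
    ((continuous_integral_coord hψ.smooth.continuous k).comp (WithLp.sndL 2 ℝ _ _).continuous)
    ((continuous_integral_mul (hψ.continuous_pderiv k)).comp
      (WithLp.fstL 2 ℝ _ _).continuous).neg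

theorem isClosed_hCurlPer (s : SpaceDim) : IsClosed (hCurlPer s : Set
    (WithLp 2 (Lp (Vec s) 2 (cellMeasure s) × Lp (CurlVec s) 2 (cellMeasure s)))) := by
  have h : (hCurlPer s : Set
      (WithLp 2 (Lp (Vec s) 2 (cellMeasure s) × Lp (CurlVec s) 2 (cellMeasure s))))
      = {p | ∀ ψ : Vec s → ℝ, IsPeriodicTest ψ → ∀ k : Fin s.curlDim,
    ∫ y, p.snd y k * ψ y ∂(cellMeasure s) =
      -∑ i, ∑ j, eps s k i j * ∫ y, p.fst y j * pderiv i ψ y ∂(cellMeasure s)} := rfl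
  rw [h]
  simp only [ofPred_forall]
  refine isClosed_iInter fun ψ => isClosed_iInter fun hψ => isClosed_iInter fun k => ?_
  refine isClosed_eq
    ((continuous_integral_coord hψ.smooth.continuous k).comp (WithLp.sndL 2 ℝ _ _).continuous)
    (Continuous.neg ?_)
  exact continuous_finsetSum _ fun i _ => continuous_finsetSum _ fun j _ =>
    ((continuous_integral_coord (hψ.continuous_pderiv i) j).comp
      (WithLp.fstL 2 ℝ _ _).continuous).const_mul _

instance (s : SpaceDim) (D : Set (Vec s)) : CompleteSpace (WSpace s D) :=
  ((Submodule.isClosed_topologicalClosure _).completeSpace_coe :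
    CompleteSpace (hZeroCurl s D))

instance (s : SpaceDim) (D : Set (Vec s)) (k : ℕ) : CompleteSpace (VSpace s D k) := by
  have : CompleteSpace (sliceSpace s D k (hOnePer s)) :=
    (isClosed_sliceSpace (isClosed_hOnePer s)).completeSpace_coe
  exact inferInstanceAs (CompleteSpace
    (sliceSpace s D k (hOnePer s) ⧸ (sliceDiff s D k (hOnePer s)).ker))

instance (s : SpaceDim) (D : Set (Vec s)) (k : ℕ) : CompleteSpace (WLevel s D k) := by
  have : CompleteSpace (sliceSpace s D k (hCurlPer s)) :=
    (isClosed_sliceSpace (isClosed_hCurlPer s)).completeSpace_coe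
  exact inferInstanceAs (CompleteSpace
    (sliceSpace s D k (hCurlPer s) ⧸ (sliceDiff s D k (hCurlPer s)).ker))

end Closedness

/-! ### Classes in `V_i` and `W_i` are bounded by their gradient or curl -/

section Bounds

variable {s : SpaceDim} {D : Set (Vec s)} {k : ℕ} [IsFiniteMeasure (domMeasure s D)]

theorem VSpace.norm_le_grad (x : VSpace s D k) : ‖x‖ ≤ 2 * ‖VSpace.grad s D k x‖ := by
  obtain ⟨p, rfl⟩ := Submodule.Quotient.mk_surjective _ x
  refine norm_mk_le_sliceDiff (isClosed_hOnePer s) (ι := Unit)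
    (fun _ => cellClass (continuous_const (y := (1 : ℝ)))) (fun _ => const_mem_hOnePer s) ?_ p
  intro v hv h
  refine poincare_hOnePer hv ?_
  have := h ()
  rw [inner_cellClass] at this
  simpa using this

/-- A family of fields of vanishing periodic curl whose orthogonal complement consists of
divergence free fields of mean zero. -/
def curlFreeField (s : SpaceDim) :
    Fin s.dim ⊕ (Fin s.dim → ℤ) ⊕ (Fin s.dim → ℤ) → Lp (Vec s) 2 (cellMeasure s)
  | .inl j => cellClass (φ := fun _ => (1 : ℝ) • (EuclideanSpace.single j (1 : ℝ) : Vec s))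
      ((isPeriodicTest_one s).smooth.continuous.smul continuous_const)
  | .inr (.inl m) => cellClass (φ := fun y => Real.cos (phase s m y) •
      (WithLp.toLp 2 fun j => (m j : ℝ) : Vec s))
      ((isPeriodicTest_cos s m).smooth.continuous.smul continuous_const)
  | .inr (.inr m) => cellClass (φ := fun y => Real.sin (phase s m y) •
      (WithLp.toLp 2 fun j => (m j : ℝ) : Vec s))
      ((isPeriodicTest_sin s m).smooth.continuous.smul continuous_const)

theorem curlFreeField_mem (s : SpaceDim)
    (i : Fin s.dim ⊕ (Fin s.dim → ℤ) ⊕ (Fin s.dim → ℤ)) :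
    WithLp.toLp 2 (curlFreeField s i, 0) ∈ hCurlPer s := by
  rcases i with j | m | m
  · exact smul_mem_hCurlPer (isPeriodicTest_one s) _ fun k y => by simp [pderiv_const]
  · refine smul_mem_hCurlPer (isPeriodicTest_cos s m) _ fun k y => ?_
    rw [← sum_eps_symm k (-(2 * Real.pi * Real.sin (phase s m y))) fun i => (m i : ℝ)]
    refine Finset.sum_congr rfl fun i _ => Finset.sum_congr rfl fun j _ => ?_
    rw [pderiv_cos_phase]
    ring
  · refine smul_mem_hCurlPer (isPeriodicTest_sin s m) _ fun k y => ?_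
    rw [← sum_eps_symm k (2 * Real.pi * Real.cos (phase s m y)) fun i => (m i : ℝ)]
    refine Finset.sum_congr rfl fun i _ => Finset.sum_congr rfl fun j _ => ?_
    rw [pderiv_sin_phase]
    ring

theorem norm_le_of_orthogonal_curlFreeField {s : SpaceDim}
    {v : WithLp 2 (Lp (Vec s) 2 (cellMeasure s) × Lp (CurlVec s) 2 (cellMeasure s))}
    (hv : v ∈ hCurlPer s) (h : ∀ i, inner ℝ (curlFreeField s i) v.fst = 0) :
    ‖v.fst‖ ≤ ‖v.snd‖ := by
  refine poincare_hCurlPer hv (fun j => ?_) (fun m => ?_) (fun m => ?_)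
  · have h1 := (inner_cellClass_smul (isPeriodicTest_one s).smooth.continuous _ _).symm.trans
      (h (.inl j))
    rw [Finset.sum_eq_single j] at h1
    · simpa using h1
    · simp +contextual
    · simp
  · exact (inner_cellClass_smul (isPeriodicTest_cos s m).smooth.continuous _ _).symm.trans
      (h (.inr (.inl m)))
  · exact (inner_cellClass_smul (isPeriodicTest_sin s m).smooth.continuous _ _).symm.trans
      (h (.inr (.inr m)))

theorem WLevel.norm_le_curl (x : WLevel s D k) : ‖x‖ ≤ 2 * ‖WLevel.curl s D k x‖ := by
  obtain ⟨p, rfl⟩ := Submodule.Quotient.mk_surjective _ x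
  exact norm_mk_le_sliceDiff (isClosed_hCurlPer s) (curlFreeField s) (curlFreeField_mem s)
    (fun v hv h => norm_le_of_orthogonal_curlFreeField hv h) p

end Bounds

/-! ### Gradients and curls have mean zero over the cell -/

section MeanZero

variable {s : SpaceDim} {D : Set (Vec s)} {k : ℕ}

theorem integral_eq_zero_of_coord {m : ℕ} {v : Lp (EuclideanSpace ℝ (Fin m)) 2 (cellMeasure s)}
    (h : ∀ k, ∫ y, v y k ∂(cellMeasure s) = 0) : ∫ y, v y ∂(cellMeasure s) = 0 := by
  have hi : Integrable v (cellMeasure s) := (Lp.memLp v).integrable (by norm_num)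
  ext k
  exact ((EuclideanSpace.proj k : EuclideanSpace ℝ (Fin m) →L[ℝ] ℝ).integral_comp_comm hi).symm.trans
    (h k)

theorem integral_slice_eq_zero {A B : Type} [NormedAddCommGroup A] [NormedSpace ℝ A]
    [NormedAddCommGroup B] [NormedSpace ℝ B]
    {S : Submodule ℝ (WithLp 2 (Lp A 2 (cellMeasure s) × Lp B 2 (cellMeasure s)))}
    (hS : ∀ v ∈ S, ∫ y, v.snd y ∂(cellMeasure s) = 0) (p : sliceSpace s D k S) :
    ∀ᵐ z ∂(ptsMeasure s D k), ∫ y, sliceDiff s D k S p (z, y) ∂(cellMeasure s) = 0 := by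
  have hp : ∀ᵐ z ∂(ptsMeasure s D k), _ := p.2
  filter_upwards [hp] with z hz
  obtain ⟨v, hv, -, h2⟩ := hz
  exact (integral_congr_ae h2).trans (hS v hv)

/-- Almost every slice is a periodic gradient, and testing it with the constant function one leaves
zero on the right. -/
theorem VSpace.integral_grad (x : VSpace s D k) :
    ∀ᵐ z ∂(ptsMeasure s D k), ∫ y, VSpace.grad s D k x (z, y) ∂(cellMeasure s) = 0 := by
  obtain ⟨p, rfl⟩ := Submodule.Quotient.mk_surjective _ x
  refine integral_slice_eq_zero (fun v hv => integral_eq_zero_of_coord fun k => ?_) p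
  have h := hv _ (isPeriodicTest_one s) k
  simpa [pderiv_const] using h

theorem WLevel.integral_curl (x : WLevel s D k) :
    ∀ᵐ z ∂(ptsMeasure s D k), ∫ y, WLevel.curl s D k x (z, y) ∂(cellMeasure s) = 0 := by
  obtain ⟨p, rfl⟩ := Submodule.Quotient.mk_surjective _ x
  refine integral_slice_eq_zero (fun v hv => integral_eq_zero_of_coord fun k => ?_) p
  have h := hv _ (isPeriodicTest_one s) k
  simpa [pderiv_const] using h

end MeanZero

/-! ### Orthogonality of the levels -/

section Lifts

variable {s : SpaceDim} {D : Set (Vec s)} {n : ℕ}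

theorem isFiniteMeasure_domMeasure (hD : Bornology.IsBounded D) :
    IsFiniteMeasure (domMeasure s D) :=
  ⟨by rw [domMeasure, Measure.restrict_apply_univ]; exact hD.measure_lt_top⟩

variable {E : Type} [NormedAddCommGroup E] [InnerProductSpace ℝ E] [CompleteSpace E]

theorem norm_liftBase (h : Lp E 2 (domMeasure s D)) : ‖liftBase s D n E h‖ = ‖h‖ :=
  (Lp.compMeasurePreservingₗᵢ ℝ Prod.fst (measurePreserving_base s D n)).norm_map h

theorem norm_liftLevel {i : Fin n} (w : Lp E 2 (levelMeasure s D i)) :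
    ‖liftLevel s D i E w‖ = ‖w‖ :=
  (Lp.compMeasurePreservingₗᵢ ℝ (levelProj s i) (measurePreserving_levelProj s D i)).norm_map w

theorem coeFn_liftBase (h : Lp E 2 (domMeasure s D)) :
    liftBase s D n E h =ᵐ[ptsMeasure s D n] fun p => h p.1 :=
  Lp.coeFn_compMeasurePreserving h (measurePreserving_base s D n)

theorem coeFn_liftLevel {i : Fin n} (w : Lp E 2 (levelMeasure s D i)) :
    liftLevel s D i E w =ᵐ[ptsMeasure s D n] fun p => w (levelProj s i p) :=
  Lp.coeFn_compMeasurePreserving w (measurePreserving_levelProj s D i)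

/-- A function of mean zero in its last variable is orthogonal to the functions that do not depend
on this variable. -/
theorem inner_liftLevel_eq_zero {j : Fin n} (h : Lp E 2 (ptsMeasure s D j))
    {H : Lp E 2 (ptsMeasure s D n)}
    (hH : H =ᵐ[ptsMeasure s D n] fun p => h (levelProj s j p).1)
    {w : Lp E 2 (levelMeasure s D j)}
    (hw : ∀ᵐ z ∂(ptsMeasure s D j), ∫ y, w (z, y) ∂(cellMeasure s) = 0) :
    inner ℝ H (liftLevel s D j E w) = 0 := by
  have hmp : MeasurePreserving (Prod.fst : Pts s j × Vec s → Pts s j) (levelMeasure s D j)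
    (ptsMeasure s D j) := measurePreserving_fst
  let h' : Lp E 2 (levelMeasure s D j) := Lp.compMeasurePreserving Prod.fst hmp h
  have hh' : h' =ᵐ[levelMeasure s D j] fun q => h q.1 := Lp.coeFn_compMeasurePreserving h hmp
  have h1 : H = liftLevel s D j E h' := by
    refine Lp.ext (hH.trans ?_)
    filter_upwards [coeFn_liftLevel h', (measurePreserving_levelProj s D j).quasiMeasurePreserving.ae
      hh'] with p hp hp'
    rw [hp, hp']
  have h2 : inner ℝ H (liftLevel s D j E w) = inner ℝ h' w := by
    rw [h1]
    exact (Lp.compMeasurePreservingₗᵢ ℝ (levelProj s j)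
      (measurePreserving_levelProj s D j)).inner_map_map h' w
  have hi := L2.integrable_inner (𝕜 := ℝ) h' w
  rw [h2, L2.inner_def]
  refine (integral_prod _ hi).trans (integral_eq_zero_of_ae ?_)
  filter_upwards [hw, Measure.ae_ae_of_ae_prod hh', ae_memLp_slice w] with z hz hz' hm
  refine (integral_congr_ae (g := fun y => inner ℝ (h z) (w (z, y))) ?_).trans ?_
  · filter_upwards [hz'] with y hy
    exact congrArg (fun x => inner ℝ x (w (z, y))) hy
  · have hzi : Integrable (fun y => w (z, y)) (cellMeasure s) := hm.integrable (by norm_num)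
    refine (integral_inner (𝕜 := ℝ) hzi (h z)).trans ?_
    rw [hz, inner_zero_right]
    rfl

theorem inner_liftBase_liftLevel {j : Fin n} (h : Lp E 2 (domMeasure s D))
    {w : Lp E 2 (levelMeasure s D j)}
    (hw : ∀ᵐ z ∂(ptsMeasure s D j), ∫ y, w (z, y) ∂(cellMeasure s) = 0) :
    inner ℝ (liftBase s D n E h) (liftLevel s D j E w) = 0 := by
  refine inner_liftLevel_eq_zero (liftBase s D j E h) ?_ hw
  have h1 := (measurePreserving_fst (μ := ptsMeasure s D j) (ν := cellMeasure s)).comp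
    (measurePreserving_levelProj s D j)
  filter_upwards [coeFn_liftBase (n := n) h, h1.quasiMeasurePreserving.ae
    (coeFn_liftBase (n := j) h)] with p hp hp'
  exact hp.trans hp'.symm

/-- The term of the lower level does not depend on the last variable of `w`, over which `w` has mean
zero. -/
theorem inner_liftLevel_liftLevel {i j : Fin n} (hij : i < j) (v : Lp E 2 (levelMeasure s D i))
    {w : Lp E 2 (levelMeasure s D j)}
    (hw : ∀ᵐ z ∂(ptsMeasure s D j), ∫ y, w (z, y) ∂(cellMeasure s) = 0) :
    inner ℝ (liftLevel s D i E v) (liftLevel s D j E w) = 0 := by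
  let i' : Fin j := ⟨i, hij⟩
  refine inner_liftLevel_eq_zero (liftLevel s D i' E v) ?_ hw
  have h1 := (measurePreserving_fst (μ := ptsMeasure s D j) (ν := cellMeasure s)).comp
    (measurePreserving_levelProj s D j)
  filter_upwards [coeFn_liftLevel (n := n) v, h1.quasiMeasurePreserving.ae
    (coeFn_liftLevel (i := i') v)] with p hp hp'
  exact hp.trans hp'.symm

variable {X : Fin n → Type} [∀ i, NormedAddCommGroup (X i)] [∀ i, NormedSpace ℝ (X i)]

/-- The sum over all levels of operators with values in functions of fewer variables. -/
def sumLevels (G : ∀ i : Fin n, X i →L[ℝ] Lp E 2 (levelMeasure s D i)) :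
    (∀ i, X i) →L[ℝ] Lp E 2 (ptsMeasure s D n) :=
  ∑ i, (liftLevel s D i E).comp ((G i).comp (ContinuousLinearMap.proj i))

theorem sumLevels_apply (G : ∀ i : Fin n, X i →L[ℝ] Lp E 2 (levelMeasure s D i)) (x : ∀ i, X i) :
    sumLevels G x = ∑ i, liftLevel s D i E (G i (x i)) := by
  simp [sumLevels]

theorem sumLevels_single (G : ∀ i : Fin n, X i →L[ℝ] Lp E 2 (levelMeasure s D i)) (i : Fin n)
    (x : X i) : sumLevels G (Pi.single i x) = liftLevel s D i E (G i x) := by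
  rw [sumLevels_apply, Finset.sum_eq_single i]
  · simp
  · intro j _ hj
    simp [hj]
  · simp

theorem inner_liftBase_sumLevels {G : ∀ i : Fin n, X i →L[ℝ] Lp E 2 (levelMeasure s D i)}
    (hG : ∀ i x, ∀ᵐ z ∂(ptsMeasure s D i), ∫ y, G i x (z, y) ∂(cellMeasure s) = 0)
    (h : Lp E 2 (domMeasure s D)) (x : ∀ i, X i) :
    inner ℝ (liftBase s D n E h) (sumLevels G x) = 0 := by
  rw [sumLevels_apply, inner_sum]
  exact Finset.sum_eq_zero fun i _ => inner_liftBase_liftLevel h (hG i (x i))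

/-- The levels are orthogonal, so the squared norm of the sum dominates each squared summand. The
norm on the product of the `X i` is the maximum, hence the constant does not depend on `n`. -/
theorem norm_sumLevels_ge {G : ∀ i : Fin n, X i →L[ℝ] Lp E 2 (levelMeasure s D i)}
    (hG : ∀ i x, ∀ᵐ z ∂(ptsMeasure s D i), ∫ y, G i x (z, y) ∂(cellMeasure s) = 0)
    (hb : ∀ i x, ‖x‖ ≤ 2 * ‖G i x‖) (x : ∀ i, X i) : 1 / 2 * ‖x‖ ≤ ‖sumLevels G x‖ := by
  have hsq : ‖sumLevels G x‖ ^ 2 = ∑ i, ‖G i (x i)‖ ^ 2 := by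
    rw [← real_inner_self_eq_norm_sq, sumLevels_apply, inner_sum]
    refine Finset.sum_congr rfl fun i _ => ?_
    rw [sum_inner, Finset.sum_eq_single i, real_inner_self_eq_norm_sq, norm_liftLevel]
    · intro j _ hj
      rcases lt_or_gt_of_ne hj with h | h
      · exact inner_liftLevel_liftLevel h _ (hG i (x i))
      · rw [real_inner_comm]
        exact inner_liftLevel_liftLevel h _ (hG j (x j))
    · simp
  have h1 : ‖x‖ ≤ 2 * ‖sumLevels G x‖ := by
    refine (pi_norm_le_iff_of_nonneg (by positivity)).2 fun i => (hb i (x i)).trans ?_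
    refine mul_le_mul_of_nonneg_left (le_of_sq_le_sq ?_ (norm_nonneg _)) (by norm_num)
    rw [hsq]
    exact Finset.single_le_sum (f := fun i => ‖G i (x i)‖ ^ 2) (fun j _ => sq_nonneg _)
      (Finset.mem_univ i)
  linarith

end Lifts

/-! ### Symmetry and coercivity of the coefficient operators -/

section CoefficientOperator

variable {s : SpaceDim} {D : Set (Vec s)} {n k : ℕ} {α β : ℝ}

theorem Coefficient.inner_mulOp (A : Coefficient s D n k α β)
    (u v : Lp (EuclideanSpace ℝ (Fin k)) 2 (ptsMeasure s D n)) :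
    inner ℝ (A.mulOp u) v
      = ∫ p, ∑ i, ∑ j, A.toFun p i j * u p j * v p i ∂(ptsMeasure s D n) := by
  rw [L2.inner_def]
  refine integral_congr_ae ?_
  filter_upwards [MemLp.coeFn_toLp (A.memLp_mul u)] with p hp
  have h : A.mulOp u p = mulVecE (A.toFun p) (u p) := hp
  rw [h]
  simp only [PiLp.inner_apply, RCLike.inner_apply, conj_trivial]
  refine Finset.sum_congr rfl fun i _ => ?_
  have : (mulVecE (A.toFun p) (u p)) i = ∑ j, A.toFun p i j * u p j := rfl
  rw [this, Finset.mul_sum]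
  exact Finset.sum_congr rfl fun j _ => mul_comm _ _

theorem Coefficient.inner_mulOp_comm (A : Coefficient s D n k α β)
    (u v : Lp (EuclideanSpace ℝ (Fin k)) 2 (ptsMeasure s D n)) :
    inner ℝ (A.mulOp u) v = inner ℝ (A.mulOp v) u := by
  rw [A.inner_mulOp, A.inner_mulOp]
  refine integral_congr_ae ?_
  filter_upwards [A.symm] with p hp
  rw [Finset.sum_comm]
  refine Finset.sum_congr rfl fun i _ => Finset.sum_congr rfl fun j _ => ?_
  rw [hp.apply i j]
  ring

theorem Coefficient.le_inner_mulOp (A : Coefficient s D n k α β)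
    (u : Lp (EuclideanSpace ℝ (Fin k)) 2 (ptsMeasure s D n)) :
    α * ‖u‖ ^ 2 ≤ inner ℝ (A.mulOp u) u := by
  rw [norm_sq_eq_integral_norm, ← integral_const_mul, L2.inner_def]
  refine integral_mono_ae ((integrable_norm_sq_Lp u).const_mul _) (L2.integrable_inner _ _) ?_
  filter_upwards [A.coercive, MemLp.coeFn_toLp (A.memLp_mul u)] with p hc hp
  have h : A.mulOp u p = mulVecE (A.toFun p) (u p) := hp
  refine (hc (u p)).trans (le_of_eq ?_)
  rw [h]
  simp only [PiLp.inner_apply, RCLike.inner_apply, conj_trivial]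
  refine Finset.sum_congr rfl fun i _ => ?_
  have : (mulVecE (A.toFun p) (u p)) i = ∑ j, A.toFun p i j * u p j := rfl
  rw [this, Finset.mul_sum]
  refine Finset.sum_congr rfl fun j _ => ?_
  ring

end CoefficientOperator

/-! ### The graph norm of `W` -/

section BaseSpace

variable {s : SpaceDim} {D : Set (Vec s)}

theorem WSpace.norm_sq_eq (u : WSpace s D) :
    ‖u‖ ^ 2 = ‖WSpace.val s D u‖ ^ 2 + ‖WSpace.curl s D u‖ ^ 2 :=
  WithLp.prod_norm_sq_eq_of_L2
    (u.1 : WithLp 2 (Lp (Vec s) 2 (domMeasure s D) × Lp (CurlVec s) 2 (domMeasure s D)))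

theorem WSpace.norm_val_le (u : WSpace s D) : ‖WSpace.val s D u‖ ≤ ‖u‖ :=
  le_of_sq_le_sq (by rw [WSpace.norm_sq_eq]; linarith [sq_nonneg ‖WSpace.curl s D u‖])
    (norm_nonneg _)

end BaseSpace

/-! ### Calculus of functions with an initial value and an integrable derivative -/

section Primitives

variable {X Y : Type*} [NormedAddCommGroup X] [NormedSpace ℝ X] [CompleteSpace X]
  [NormedAddCommGroup Y] [NormedSpace ℝ Y] [CompleteSpace Y] {T : ℝ}

/-- `u` has the initial value `x` and the integrable time derivative `g`. -/
def IsPrim (T : ℝ) (u : ℝ → X) (x : X) (g : ℝ → X) : Prop :=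
  Integrable g (timeMeasure T) ∧ u =ᵐ[timeMeasure T] fun t => x + ∫ s in (0 : ℝ)..t, g s

theorem ae_mem_timeMeasure (T : ℝ) : ∀ᵐ t ∂(timeMeasure T), t ∈ Ioo 0 T :=
  ae_restrict_mem measurableSet_Ioo

theorem integral_congr_of_timeMeasure {g g' : ℝ → X} (h : g =ᵐ[timeMeasure T] g') {t : ℝ}
    (ht : t ∈ Ioo 0 T) : ∫ s in (0 : ℝ)..t, g s = ∫ s in (0 : ℝ)..t, g' s := by
  rw [intervalIntegral.integral_of_le ht.1.le, intervalIntegral.integral_of_le ht.1.le]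
  exact integral_congr_ae (ae_restrict_of_ae_restrict_of_subset
    (show Ioc 0 t ⊆ Ioo 0 T from fun r hr => ⟨hr.1, hr.2.trans_lt ht.2⟩) h)

theorem intervalIntegrable_zero_of_timeMeasure {g : ℝ → X} (hg : Integrable g (timeMeasure T))
    {t : ℝ} (ht : t ∈ Ioo 0 T) : IntervalIntegrable g volume 0 t :=
  intervalIntegrable_of_timeMeasure hg ⟨le_rfl, (ht.1.trans ht.2).le⟩ ⟨ht.1.le, ht.2.le⟩

namespace IsPrim

variable {u v g h : ℝ → X} {x y : X}

theorem congr (hu : IsPrim T u x g) (huv : u =ᵐ[timeMeasure T] v) (hgh : g =ᵐ[timeMeasure T] h) :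
    IsPrim T v x h := by
  refine ⟨hu.1.congr hgh, ?_⟩
  filter_upwards [hu.2, huv, ae_mem_timeMeasure T] with t h1 h2 ht
  rw [← h2, h1, integral_congr_of_timeMeasure hgh ht]

theorem clm (L : X →L[ℝ] Y) (hu : IsPrim T u x g) :
    IsPrim T (fun t => L (u t)) (L x) (fun t => L (g t)) := by
  refine ⟨L.integrable_comp hu.1, ?_⟩
  filter_upwards [hu.2, ae_mem_timeMeasure T] with t h1 ht
  rw [h1, map_add, L.intervalIntegral_comp_comm (intervalIntegrable_zero_of_timeMeasure hu.1 ht)]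

theorem add (hu : IsPrim T u x g) (hv : IsPrim T v y h) :
    IsPrim T (fun t => u t + v t) (x + y) (fun t => g t + h t) := by
  refine ⟨hu.1.add hv.1, ?_⟩
  filter_upwards [hu.2, hv.2, ae_mem_timeMeasure T] with t h1 h2 ht
  rw [h1, h2, intervalIntegral.integral_add (intervalIntegrable_zero_of_timeMeasure hu.1 ht)
    (intervalIntegrable_zero_of_timeMeasure hv.1 ht)]
  abel

theorem neg (hu : IsPrim T u x g) : IsPrim T (fun t => -u t) (-x) (fun t => -g t) := by
  refine ⟨hu.1.neg, ?_⟩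
  filter_upwards [hu.2] with t h1
  rw [h1, intervalIntegral.integral_neg]
  abel

theorem sub (hu : IsPrim T u x g) (hv : IsPrim T v y h) :
    IsPrim T (fun t => u t - v t) (x - y) (fun t => g t - h t) := by
  simpa only [sub_eq_add_neg] using hu.add hv.neg

theorem const (T : ℝ) (x : X) : IsPrim T (fun _ => x) x (fun _ => 0) :=
  ⟨integrable_zero _ _ _, .of_forall fun t => by simp⟩

theorem linear (T : ℝ) (x : X) : IsPrim T (fun t => t • x) 0 (fun _ => x) :=
  ⟨integrable_const _, .of_forall fun t => by simp⟩

theorem sum {ι : Type*} [Fintype ι] {u g : ι → ℝ → X} {x : ι → X}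
    (hu : ∀ i, IsPrim T (u i) (x i) (g i)) :
    IsPrim T (fun t => ∑ i, u i t) (∑ i, x i) (fun t => ∑ i, g i t) := by
  refine ⟨integrable_finsetSum _ fun i _ => (hu i).1, ?_⟩
  filter_upwards [ae_all_iff.2 fun i => (hu i).2, ae_mem_timeMeasure T] with t h1 ht
  rw [intervalIntegral.integral_finsetSum fun i _ =>
    intervalIntegrable_zero_of_timeMeasure (hu i).1 ht, ← Finset.sum_add_distrib]
  exact Finset.sum_congr rfl fun i _ => h1 i

theorem isWeakTimeDeriv (hT : 0 < T) (hu : IsPrim T u x g) : IsWeakTimeDeriv T u g :=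
  (isWeakTimeDeriv_prim hT.le hu.1 x).congr hu.2.symm .rfl

theorem hasInitialValue (hT : 0 < T) (hu : IsPrim T u x g) : HasInitialValue T u x :=
  (hasInitialValue_prim hT.le hu.1 x).congr hu.2.symm

theorem memL2Time (hT : 0 < T) (hu : IsPrim T u x g) : MemL2Time T u :=
  (memL2Time_of_continuousOn (continuousOn_const.add (continuousOn_prim hT.le hu.1))).congr
    hu.2.symm

theorem memH1Time (hT : 0 < T) (hu : IsPrim T u x g) (hg : MemL2Time T g) : MemH1Time T u :=
  ⟨hu.memL2Time hT, g, hg, hu.isWeakTimeDeriv hT⟩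

theorem of_weak (hT : 0 < T) (hu : Integrable u (timeMeasure T))
    (hg : Integrable g (timeMeasure T)) (h : IsWeakTimeDeriv T u g) (hx : HasInitialValue T u x) :
    IsPrim T u x g :=
  ⟨hg, h.eq_prim hT hu hg hx⟩

end IsPrim

/-- Turns regularity and initial condition into an integral formula, which passes through sums and
bounded operators by substitution. -/
theorem MemH1Time.exists_isPrim (hT : 0 < T) {u : ℝ → X} {x : X} (hu : MemH1Time T u)
    (hx : HasInitialValue T u x) : ∃ g, MemL2Time T g ∧ IsPrim T u x g := by
  obtain ⟨h1, g, hg, h2⟩ := hu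
  exact ⟨g, hg, .of_weak hT h1.integrable hg.integrable h2 hx⟩

end Primitives

/-! ### The multiscale problem in operator form -/

section Problem

variable {s : SpaceDim} {D : Set (Vec s)} {n : ℕ} {α β T : ℝ}

theorem totalField_eq (u₀ : WSpace s D) (𝔲 : ∀ i : Fin n, VSpace s D i) :
    totalField u₀ 𝔲 = liftBase s D n _ (WSpace.val s D u₀)
      + sumLevels (fun i : Fin n => VSpace.grad s D i) 𝔲 := by
  rw [sumLevels_apply]
  rfl

theorem totalCurl_eq (u₀ : WSpace s D) (u : ∀ i : Fin n, WLevel s D i) :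
    totalCurl u₀ u = liftBase s D n _ (WSpace.curl s D u₀)
      + sumLevels (fun i : Fin n => WLevel.curl s D i) u := by
  rw [sumLevels_apply]
  rfl

/-- The map `U ↦ ∫_Y b U dy`, as a bounded operator. -/
def pairWL (b : Coefficient s D n s.dim α β) :
    Lp (Vec s) 2 (ptsMeasure s D n) →L[ℝ] StrongDual ℝ (WSpace s D) :=
  ((ContinuousLinearMap.compL ℝ _ _ ℝ).flip ((liftBase s D n _).comp (WSpace.val s D))).comp
    ((innerSL ℝ).comp b.mulOp)

/-- The map `U ↦ b U`, as a bounded operator. -/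
def pairVL (b : Coefficient s D n s.dim α β) (j : Fin n) :
    Lp (Vec s) 2 (ptsMeasure s D n) →L[ℝ] StrongDual ℝ (VSpace s D j) :=
  ((ContinuousLinearMap.compL ℝ _ _ ℝ).flip ((liftLevel s D j _).comp (VSpace.grad s D j))).comp
    ((innerSL ℝ).comp b.mulOp)

theorem pairWL_apply (b : Coefficient s D n s.dim α β) (U : Lp (Vec s) 2 (ptsMeasure s D n)) :
    pairWL b U = pairW b U := rfl

/-- All conditions depend only on classes modulo null sets of times, so a solution given by
functions may be replaced by the elements of the Lp spaces it represents. -/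
theorem IsMultiscaleSolution.congr {a : Coefficient s D n s.curlDim α β}
    {b : Coefficient s D n s.dim α β} {f : ℝ → HField s D} {g₀ : WSpace s D} {g₁ : HField s D}
    {u₀ v₀ : ℝ → WSpace s D} {uc vc : ∀ i : Fin n, ℝ → WLevel s D i}
    {𝔲 𝔳 : ∀ i : Fin n, ℝ → VSpace s D i} (h : IsMultiscaleSolution T a b f g₀ g₁ u₀ uc 𝔲)
    (h₀ : u₀ =ᵐ[timeMeasure T] v₀) (hc : ∀ i, uc i =ᵐ[timeMeasure T] vc i)
    (hV : ∀ i, 𝔲 i =ᵐ[timeMeasure T] 𝔳 i) : IsMultiscaleSolution T a b f g₀ g₁ v₀ vc 𝔳 := by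
  have hc' := ae_all_iff.2 hc
  have hV' := ae_all_iff.2 hV
  have e1 : (fun t => WSpace.val s D (u₀ t)) =ᵐ[timeMeasure T] fun t => WSpace.val s D (v₀ t) :=
    h₀.fun_comp _
  have e2 : ∀ i : Fin n, (fun t => VSpace.grad s D i (𝔲 i t)) =ᵐ[timeMeasure T]
      fun t => VSpace.grad s D i (𝔳 i t) := fun i => (hV i).fun_comp _
  have e3 : (fun t => totalField (u₀ t) (fun i => 𝔲 i t)) =ᵐ[timeMeasure T]
      fun t => totalField (v₀ t) (fun i => 𝔳 i t) := by
    filter_upwards [h₀, hV'] with t h1 h2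
    rw [h1, funext h2]
  obtain ⟨⟨r1, w, r1', r1''⟩, r2, r3, r4, P₀, Q₀, P, Q, m1, m2, m3, d1, d2, d3, i1, i2, eq⟩ := h
  refine ⟨⟨r1.congr e1, w, r1', r1''.congr e1 .rfl⟩, fun i => ?_, r3.congr e1,
    fun i => (r4 i).congr (e2 i), P₀, Q₀, P, Q, m1, m2, m3, d1.congr (e3.fun_comp (pairW b)) .rfl,
    d2, fun j => ⟨(d3 j).1.congr (e3.fun_comp (pairV b j)) .rfl, (d3 j).2⟩, i1, i2, ?_⟩
  · obtain ⟨q1, w, q2, q3⟩ := r2 i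
    exact ⟨q1.congr (e2 i), w, q2, q3.congr (e2 i) .rfl⟩
  · filter_upwards [eq, h₀, hc'] with t h1 h2 h3
    rw [← h2, ← funext h3]
    exact h1

end Problem

/-! ### Correctors and effective forms -/

section Homogenization

variable {s : SpaceDim} {D : Set (Vec s)} {n : ℕ} {α β T : ℝ}

/-- The sum of the gradients in all fast variables. -/
abbrev gradSum (s : SpaceDim) (D : Set (Vec s)) (n : ℕ) :
    (∀ i : Fin n, VSpace s D i) →L[ℝ] Lp (Vec s) 2 (ptsMeasure s D n) :=
  sumLevels fun i : Fin n => VSpace.grad s D i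

/-- The sum of the curls in all fast variables. -/
abbrev curlSum (s : SpaceDim) (D : Set (Vec s)) (n : ℕ) :
    (∀ i : Fin n, WLevel s D i) →L[ℝ] Lp (CurlVec s) 2 (ptsMeasure s D n) :=
  sumLevels fun i : Fin n => WLevel.curl s D i


theorem norm_gradSum_ge [IsFiniteMeasure (domMeasure s D)] (x : ∀ i : Fin n, VSpace s D i) :
    1 / 2 * ‖x‖ ≤ ‖gradSum s D n x‖ :=
  norm_sumLevels_ge (fun _ x => VSpace.integral_grad x) (fun _ x => VSpace.norm_le_grad x) x

theorem norm_curlSum_ge [IsFiniteMeasure (domMeasure s D)] (x : ∀ i : Fin n, WLevel s D i) :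
    1 / 2 * ‖x‖ ≤ ‖curlSum s D n x‖ :=
  norm_sumLevels_ge (fun _ x => WLevel.integral_curl x) (fun _ x => WLevel.norm_le_curl x) x

theorem exists_homogenized_mass [IsFiniteMeasure (domMeasure s D)] (hα : 0 < α)
    (b : Coefficient s D n s.dim α β) :
    ∃ (N : Lp (Vec s) 2 (ptsMeasure s D n) →L[ℝ] ∀ i : Fin n, VSpace s D i)
      (C : HField s D →L[ℝ] StrongDual ℝ (HField s D)),
      (∀ e x, inner ℝ (b.mulOp (e + gradSum s D n (N e))) (gradSum s D n x) = 0) ∧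
      (∀ h v, C h v = inner ℝ (b.mulOp (liftBase s D n _ h + gradSum s D n
        (N (liftBase s D n _ h)))) (liftBase s D n _ v)) ∧
      (∀ h v, C h v = C v h) ∧ (∀ h, α * ‖h‖ ^ 2 ≤ C h h) := by
  obtain ⟨N, hN⟩ := exists_corrector hα (by norm_num : (0 : ℝ) < 1 / 2) b.le_inner_mulOp
    norm_gradSum_ge
  obtain ⟨C, hC⟩ := exists_effective_form hα b.le_inner_mulOp b.inner_mulOp_comm N hN
    (liftBase s D n _) norm_liftBase
    (fun k x => inner_liftBase_sumLevels (fun _ x => VSpace.integral_grad x) k x)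
  exact ⟨N, C, hN, hC⟩

/-- The effective form of `a` acts on macroscopic curls and is pulled back by `curl`. It is thus
coercive only in `‖curl u‖²`, which is the difference of squared norms in the last bound. -/
theorem exists_homogenized_stiffness [IsFiniteMeasure (domMeasure s D)] (hα : 0 < α)
    (a : Coefficient s D n s.curlDim α β) :
    ∃ (N : Lp (CurlVec s) 2 (ptsMeasure s D n) →L[ℝ] ∀ i : Fin n, WLevel s D i)
      (A : WSpace s D →L[ℝ] StrongDual ℝ (WSpace s D)),
      (∀ e x, inner ℝ (a.mulOp (e + curlSum s D n (N e))) (curlSum s D n x) = 0) ∧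
      (∀ u v, A u v = inner ℝ (a.mulOp (liftBase s D n _ (WSpace.curl s D u) + curlSum s D n
        (N (liftBase s D n _ (WSpace.curl s D u))))) (liftBase s D n _ (WSpace.curl s D v))) ∧
      (∀ u v, A u v = A v u) ∧
      (∀ u, α * (‖u‖ ^ 2 - ‖WSpace.val s D u‖ ^ 2) ≤ A u u) := by
  obtain ⟨N, hN⟩ := exists_corrector hα (by norm_num : (0 : ℝ) < 1 / 2) a.le_inner_mulOp
    norm_curlSum_ge
  obtain ⟨C, hC1, hC2, hC3⟩ := exists_effective_form hα a.le_inner_mulOp a.inner_mulOp_comm N hN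
    (liftBase s D n _) norm_liftBase
    (fun k x => inner_liftBase_sumLevels (fun _ x => WLevel.integral_curl x) k x)
  refine ⟨N, ((ContinuousLinearMap.compL ℝ _ _ ℝ).flip (WSpace.curl s D)).comp
    (C.comp (WSpace.curl s D)), hN, fun u v => hC1 _ _, fun u v => hC2 _ _, fun u => ?_⟩
  rw [WSpace.norm_sq_eq, add_sub_cancel_left]
  exact hC3 _

/-- The total field of the homogenized solution, up to the contribution of the initial data, is
orthogonal to all gradients, and its pairing with `W` is the homogenized one. -/
theorem pairWL_corrected {b : Coefficient s D n s.dim α β}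
    {N : Lp (Vec s) 2 (ptsMeasure s D n) →L[ℝ] ∀ i : Fin n, VSpace s D i}
    {C : HField s D →L[ℝ] StrongDual ℝ (HField s D)}
    (hC : ∀ h v, C h v = inner ℝ (b.mulOp (liftBase s D n _ h + gradSum s D n
        (N (liftBase s D n _ h)))) (liftBase s D n _ v)) (z g : HField s D) :
    pairWL b (liftBase s D n _ z + gradSum s D n (N (liftBase s D n _ (z - g))))
      = pairWL b (liftBase s D n _ g) + (C z).comp (WSpace.val s D)
        - (C g).comp (WSpace.val s D) := by
  have h1 : liftBase s D n _ z + gradSum s D n (N (liftBase s D n _ (z - g)))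
      = liftBase s D n _ g + (liftBase s D n _ (z - g)
        + gradSum s D n (N (liftBase s D n _ (z - g)))) := by
    rw [map_sub (liftBase s D n _) z g]
    abel
  rw [h1, map_add (pairWL b), add_sub_assoc]
  congr 1
  ext v
  refine (hC (z - g) (WSpace.val s D v)).symm.trans ?_
  rw [map_sub]
  rfl

/-- The field equals `g + ((z - g) + ∇ N (z - g))`, and `b` times the corrected part annihilates
gradients. With `z = u₀'` and `g = g₁` this makes the time derivative of `b U` constant in `V_j'`.
-/
theorem pairVL_corrected {b : Coefficient s D n s.dim α β}
    {N : Lp (Vec s) 2 (ptsMeasure s D n) →L[ℝ] ∀ i : Fin n, VSpace s D i}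
    (hN : ∀ e x, inner ℝ (b.mulOp (e + gradSum s D n (N e))) (gradSum s D n x) = 0)
    (j : Fin n) (z g : HField s D) :
    pairVL b j (liftBase s D n _ z + gradSum s D n (N (liftBase s D n _ (z - g))))
      = pairVL b j (liftBase s D n _ g) := by
  have h1 : liftBase s D n _ z + gradSum s D n (N (liftBase s D n _ (z - g)))
      = liftBase s D n _ g + (liftBase s D n _ (z - g)
        + gradSum s D n (N (liftBase s D n _ (z - g)))) := by
    rw [map_sub (liftBase s D n _) z g]
    abel
  rw [h1, map_add (pairVL b j), add_eq_left]
  ext v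
  have h2 := hN (liftBase s D n _ (z - g)) (Pi.single j v)
  rw [gradSum, sumLevels_single] at h2
  exact h2

end Homogenization

/-! ### Equivalence of the multiscale problem with the homogenized wave equation -/

section Reduction

variable {s : SpaceDim} {D : Set (Vec s)} {n : ℕ} {α β T : ℝ}
  {a : Coefficient s D n s.curlDim α β} {b : Coefficient s D n s.dim α β}
  {f : ℝ → HField s D} {g₀ : WSpace s D} {g₁ : HField s D}
  {N : Lp (Vec s) 2 (ptsMeasure s D n) →L[ℝ] ∀ i : Fin n, VSpace s D i}
  {C : HField s D →L[ℝ] StrongDual ℝ (HField s D)}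
  {M : Lp (CurlVec s) 2 (ptsMeasure s D n) →L[ℝ] ∀ i : Fin n, WLevel s D i}
  {A : WSpace s D →L[ℝ] StrongDual ℝ (WSpace s D)}

theorem memL2Time_load {f : ℝ → HField s D} (hf : MemL2Time T f) {u : ℝ → WSpace s D}
    (hu : MemL2Time T u) :
    MemL2Time T fun t => (innerSL ℝ (f t)).comp (WSpace.val s D) - A (u t) :=
  MemLp.sub (hf.clm (((ContinuousLinearMap.compL ℝ (WSpace s D) (HField s D) ℝ).flip
    (WSpace.val s D)).comp (innerSL ℝ))) (hu.clm A)

/-- A solution of the homogenized wave equation and its correctors solve the multiscale problem. -/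
theorem isMultiscaleSolution_of_homogenized (hT : 0 < T)
    (hN : ∀ e x, inner ℝ (b.mulOp (e + gradSum s D n (N e))) (gradSum s D n x) = 0)
    (hC : ∀ h v, C h v = inner ℝ (b.mulOp (liftBase s D n _ h + gradSum s D n
        (N (liftBase s D n _ h)))) (liftBase s D n _ v))
    (hM : ∀ e x, inner ℝ (a.mulOp (e + curlSum s D n (M e))) (curlSum s D n x) = 0)
    (hA : ∀ u v, A u v = inner ℝ (a.mulOp (liftBase s D n _ (WSpace.curl s D u) + curlSum s D n
        (M (liftBase s D n _ (WSpace.curl s D u))))) (liftBase s D n _ (WSpace.curl s D v)))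
    (hf : MemL2Time T f) {u : ℝ → WSpace s D} {z : ℝ → HField s D}
    (hu : MemL2Time T u) (hz : MemL2Time T z)
    (hJ : IsPrim T (fun t => WSpace.val s D (u t)) (WSpace.val s D g₀) z)
    (hw : IsPrim T (fun t => (C (z t)).comp (WSpace.val s D)) ((C g₁).comp (WSpace.val s D))
      fun t => (innerSL ℝ (f t)).comp (WSpace.val s D) - A (u t)) :
    IsMultiscaleSolution T a b f g₀ g₁ u
      (fun i t => M (liftBase s D n _ (WSpace.curl s D (u t))) i)
      (fun i t => N (liftBase s D n _ (WSpace.val s D (u t) - WSpace.val s D g₀ - t • g₁)) i) := by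
  let l := liftBase s D n (Vec s)
  have hh : IsPrim T (fun t => WSpace.val s D (u t) - WSpace.val s D g₀ - t • g₁) 0
      (fun t => z t - g₁) := by
    have := (hJ.sub (.const T (WSpace.val s D g₀))).sub (.linear T g₁)
    simpa using this
  have hzg : MemL2Time T fun t => z t - g₁ := MemLp.sub hz (memLp_const _)
  -- Subtracting `g₀` and `t g₁` makes the correctors start at zero, and the time derivative passes
  -- under the bounded map `N`.
  have hU : IsPrim T (fun t => totalField (u t) fun i : Fin n =>
        N (l (WSpace.val s D (u t) - WSpace.val s D g₀ - t • g₁)) i) (l (WSpace.val s D g₀))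
      fun t => l (z t) + gradSum s D n (N (l (z t - g₁))) := by
    have h1 := (hJ.clm l).add (hh.clm ((gradSum s D n).comp (N.comp l)))
    rw [map_zero, add_zero] at h1
    exact h1.congr (.of_forall fun t => (totalField_eq _ _).symm) .rfl
  have hZ : MemL2Time T fun t => l (z t) + gradSum s D n (N (l (z t - g₁))) :=
    MemLp.add (hz.clm l) (hzg.clm ((gradSum s D n).comp (N.comp l)))
  have hg : ∀ i : Fin n, IsPrim T (fun t => VSpace.grad s D i
      (N (l (WSpace.val s D (u t) - WSpace.val s D g₀ - t • g₁)) i)) 0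
      (fun t => VSpace.grad s D i (N (l (z t - g₁)) i)) := by
    intro i
    have h1 := hh.clm ((VSpace.grad s D i).comp ((ContinuousLinearMap.proj i).comp (N.comp l)))
    rwa [map_zero] at h1
  have hQ := memL2Time_load (A := A) hf hu
  -- This functional differs from `C (z t)`, restricted to `W`, by a constant, so both have the same
  -- derivative `f - A u`; the constant adjusts the initial value to `b g₁`.
  have hP₀ : IsPrim T (fun t => pairWL b (l (z t) + gradSum s D n (N (l (z t - g₁)))))
      (pairWL b (l g₁)) fun t => (innerSL ℝ (f t)).comp (WSpace.val s D) - A (u t) := by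
    have h1 := ((IsPrim.const T (pairWL b (l g₁))).add hw).sub
      (.const T ((C g₁).comp (WSpace.val s D)))
    simp only [add_sub_cancel_right, zero_add, sub_zero] at h1
    exact h1.congr (.of_forall fun t => (pairWL_corrected hC (z t) g₁).symm) .rfl
  have hP : ∀ j : Fin n, IsPrim T
      (fun t => pairVL b j (l (z t) + gradSum s D n (N (l (z t - g₁)))))
      (pairVL b j (l g₁)) fun _ => 0 := fun j =>
    (IsPrim.const T (pairVL b j (l g₁))).congr
      (.of_forall fun t => (pairVL_corrected hN j (z t) g₁).symm) .rfl
  refine ⟨hJ.memH1Time hT hz, fun i => (hg i).memH1Time hT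
      (hzg.clm ((VSpace.grad s D i).comp ((ContinuousLinearMap.proj i).comp (N.comp l)))),
    hJ.hasInitialValue hT, fun i => (hg i).hasInitialValue hT,
    fun t => pairWL b (l (z t) + gradSum s D n (N (l (z t - g₁)))), _,
    fun j t => pairVL b j (l (z t) + gradSum s D n (N (l (z t - g₁)))), fun _ _ => 0,
    hZ.clm (pairWL b), hQ, fun j => ⟨hZ.clm (pairVL b j), memLp_const _⟩,
    (hU.clm (pairWL b)).isWeakTimeDeriv hT, hP₀.isWeakTimeDeriv hT,
    fun j => ⟨(hU.clm (pairVL b j)).isWeakTimeDeriv hT, (hP j).isWeakTimeDeriv hT⟩,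
    hP₀.hasInitialValue hT, fun j => (hP j).hasInitialValue hT, .of_forall fun t v₀ v 𝔳 => ?_⟩
  rw [totalCurl_eq, totalCurl_eq, inner_add_right]
  have h1 := hA (u t) v₀
  have h2 := hM (liftBase s D n _ (WSpace.curl s D (u t))) v
  have h3 : ∑ j : Fin n, (0 : StrongDual ℝ (VSpace s D j)) (𝔳 j) = 0 :=
    Finset.sum_eq_zero fun j _ => rfl
  have h4 : ((innerSL ℝ (f t)).comp (WSpace.val s D) - A (u t)) v₀
      = inner ℝ (f t) (WSpace.val s D v₀) - A (u t) v₀ := rfl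
  rw [h3, h4]
  linarith

/-- The solutions of the multiscale problem come from the homogenized wave equation. -/
theorem IsMultiscaleSolution.homogenized [IsFiniteMeasure (domMeasure s D)] (hT : 0 < T)
    (hα : 0 < α)
    (hN : ∀ e x, inner ℝ (b.mulOp (e + gradSum s D n (N e))) (gradSum s D n x) = 0)
    (hC : ∀ h v, C h v = inner ℝ (b.mulOp (liftBase s D n _ h + gradSum s D n
        (N (liftBase s D n _ h)))) (liftBase s D n _ v))
    (hM : ∀ e x, inner ℝ (a.mulOp (e + curlSum s D n (M e))) (curlSum s D n x) = 0)
    (hA : ∀ u v, A u v = inner ℝ (a.mulOp (liftBase s D n _ (WSpace.curl s D u) + curlSum s D n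
        (M (liftBase s D n _ (WSpace.curl s D u))))) (liftBase s D n _ (WSpace.curl s D v)))
    {u : ℝ → WSpace s D} {uc : ∀ i : Fin n, ℝ → WLevel s D i}
    {𝔲 : ∀ i : Fin n, ℝ → VSpace s D i}
    (h : IsMultiscaleSolution T a b f g₀ g₁ u uc 𝔲) :
    (∃ z, MemL2Time T z ∧ IsPrim T (fun t => WSpace.val s D (u t)) (WSpace.val s D g₀) z ∧
      IsPrim T (fun t => (C (z t)).comp (WSpace.val s D)) ((C g₁).comp (WSpace.val s D))
        fun t => (innerSL ℝ (f t)).comp (WSpace.val s D) - A (u t)) ∧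
    (∀ᵐ t ∂(timeMeasure T),
      (fun i => uc i t) = M (liftBase s D n _ (WSpace.curl s D (u t)))) ∧
    (∀ᵐ t ∂(timeMeasure T), (fun i => 𝔲 i t)
      = N (liftBase s D n _ (WSpace.val s D (u t) - WSpace.val s D g₀ - t • g₁))) := by
  let l := liftBase s D n (Vec s)
  obtain ⟨r1, r2, r3, r4, P₀, Q₀, P, Q, m1, m2, m3, d1, d2, d3, i1, i2, eq⟩ := h
  obtain ⟨z, hz, hJ⟩ := r1.exists_isPrim hT r3
  choose y hy hg using fun i => (r2 i).exists_isPrim hT (r4 i)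
  have hU : IsPrim T (fun t => totalField (u t) fun i : Fin n => 𝔲 i t) (l (WSpace.val s D g₀))
      fun t => l (z t) + ∑ i, liftLevel s D i _ (y i t) := by
    have h1 := (hJ.clm l).add (IsPrim.sum fun i => (hg i).clm (liftLevel s D i (Vec s)))
    simp only [map_zero, Finset.sum_const_zero, add_zero] at h1
    exact h1
  -- Testing with a single nonzero `𝔳_j` removes the curl terms and the load.
  have hQj : ∀ j, Q j =ᵐ[timeMeasure T] fun _ => 0 := by
    intro j
    filter_upwards [eq] with t ht
    ext x
    have h1 := ht 0 0 (Pi.single j x)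
    have h2 : totalCurl (0 : WSpace s D) (0 : ∀ i : Fin n, WLevel s D i) = 0 := by
      rw [totalCurl_eq]
      simp
    rw [h2, Finset.sum_eq_single j] at h1
    · simpa using h1
    · intro i _ hi
      simp [hi]
    · simp
  have hPj : ∀ j, P j =ᵐ[timeMeasure T] fun _ => pairVL b j (l g₁) := by
    intro j
    have h1 := (IsPrim.of_weak hT (m3 j).1.integrable (m3 j).2.integrable (d3 j).2 (i2 j)).congr
      .rfl (hQj j)
    filter_upwards [h1.2] with t ht
    rw [ht]
    simp only [intervalIntegral.integral_zero, add_zero]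
    rfl
  -- A second integration in time, using that `U` starts at `g₀` because all fast gradients start at
  -- zero.
  have hPU : ∀ j, (fun t => pairVL b j (totalField (u t) fun i : Fin n => 𝔲 i t))
      =ᵐ[timeMeasure T] fun t => pairVL b j (l (WSpace.val s D g₀ + t • g₁)) := by
    intro j
    have h1 := hU.clm (pairVL b j)
    have h2 := ((h1.isWeakTimeDeriv hT).unique h1.1 (m3 j).1.integrable (d3 j).1).trans (hPj j)
    filter_upwards [(h1.congr .rfl h2).2] with t ht
    rw [ht]
    simp
  -- Now `b (U - g₀ - t g₁)` annihilates all gradients, and `U - g₀ - t g₁` is `u₀ - g₀ - t g₁` plus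
  -- the fast gradients: this is the corrector equation.
  have hV : ∀ᵐ t ∂(timeMeasure T), (fun i => 𝔲 i t)
      = N (l (WSpace.val s D (u t) - WSpace.val s D g₀ - t • g₁)) := by
    filter_upwards [ae_all_iff.2 hPU] with t ht
    refine corrector_unique hα (by norm_num : (0 : ℝ) < 1 / 2) b.le_inner_mulOp norm_gradSum_ge
      (e := l (WSpace.val s D (u t) - WSpace.val s D g₀ - t • g₁)) (fun x => ?_) (hN _)
    have h1 : l (WSpace.val s D (u t) - WSpace.val s D g₀ - t • g₁)
        + gradSum s D n (fun i => 𝔲 i t)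
        = totalField (u t) (fun i => 𝔲 i t) - l (WSpace.val s D g₀ + t • g₁) := by
      rw [totalField_eq, sub_sub, map_sub]
      abel
    rw [h1, sumLevels_apply, inner_sum]
    refine Finset.sum_eq_zero fun j _ => ?_
    have h2 := congrArg (fun F => F (x j)) (sub_eq_zero.2 (ht j))
    rw [← map_sub] at h2
    exact h2
  have hUC : ∀ᵐ t ∂(timeMeasure T),
      (fun i => uc i t) = M (liftBase s D n _ (WSpace.curl s D (u t))) := by
    filter_upwards [eq] with t ht
    refine corrector_unique hα (by norm_num : (0 : ℝ) < 1 / 2) a.le_inner_mulOp norm_curlSum_ge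
      (e := liftBase s D n _ (WSpace.curl s D (u t))) (fun x => ?_) (hM _)
    have h1 := ht 0 x 0
    have h2 : totalCurl (0 : WSpace s D) x = curlSum s D n x := by
      rw [totalCurl_eq, map_zero, map_zero, zero_add]
    rw [h2, totalCurl_eq] at h1
    simpa using h1
  refine ⟨⟨z, hz, hJ, ?_⟩, hUC, hV⟩
  · have hh : IsPrim T (fun t => WSpace.val s D (u t) - WSpace.val s D g₀ - t • g₁) 0
        (fun t => z t - g₁) := by
      have := (hJ.sub (.const T (WSpace.val s D g₀))).sub (.linear T g₁)
      simpa using this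
    have hU' : IsPrim T (fun t => totalField (u t) fun i : Fin n => 𝔲 i t)
        (l (WSpace.val s D g₀)) fun t => l (z t) + gradSum s D n (N (l (z t - g₁))) := by
      have h1 := (hJ.clm l).add (hh.clm ((gradSum s D n).comp (N.comp l)))
      rw [map_zero, add_zero] at h1
      refine h1.congr ?_ .rfl
      filter_upwards [hV] with t ht
      rw [totalField_eq, ht]
      rfl
    have h1 := hU'.clm (pairWL b)
    have h2 := (d1.unique m1.integrable h1.1 (h1.isWeakTimeDeriv hT))
    have h3 := IsPrim.of_weak hT m1.integrable m2.integrable d2 i1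
    have hQ₀ : Q₀ =ᵐ[timeMeasure T]
        fun t => (innerSL ℝ (f t)).comp (WSpace.val s D) - A (u t) := by
      filter_upwards [eq, hUC] with t ht huc
      ext v₀
      have e1 := ht v₀ 0 0
      have e2 : totalCurl v₀ (0 : ∀ i : Fin n, WLevel s D i)
          = liftBase s D n _ (WSpace.curl s D v₀) := by
        rw [totalCurl_eq, map_zero, add_zero]
      have e3 : ∑ j : Fin n, Q j t ((0 : ∀ i : Fin n, VSpace s D i) j) = 0 :=
        Finset.sum_eq_zero fun j _ => map_zero (Q j t)
      rw [e2, totalCurl_eq, huc, ← hA, e3] at e1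
      have e4 : ((innerSL ℝ (f t)).comp (WSpace.val s D) - A (u t)) v₀
          = inner ℝ (f t) (WSpace.val s D v₀) - A (u t) v₀ := rfl
      rw [e4]
      linarith
    have h4 := ((h3.congr h2 hQ₀).sub (.const T (pairWL b (l g₁)))).add
      (.const T ((C g₁).comp (WSpace.val s D)))
    simp only [sub_zero, add_zero] at h4
    have h5 : pairW b (liftBase s D n _ g₁) - pairWL b (l g₁)
        + (C g₁).comp (WSpace.val s D) = (C g₁).comp (WSpace.val s D) := by
      rw [pairWL_apply, sub_self, zero_add]
    rw [h5] at h4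
    refine h4.congr (.of_forall fun t => ?_) .rfl
    have h6 := pairWL_corrected hC (z t) g₁
    change pairWL b (l (z t) + gradSum s D n (N (l (z t - g₁)))) - _ + _ = _
    rw [h6]
    abel

end Reduction

end MultiscaleMaxwell

end

/-! ### Existence and uniqueness for the multiscale problem -/

theorem mainTheorem7 (s : SpaceDim) (n : ℕ) (D : Set (Vec s)) (hD_open : IsOpen D)
    (hD_connected : IsConnected D) (hD_bounded : Bornology.IsBounded D)
    (T : ℝ) (hT : 0 < T) (α β : ℝ) (hα : 0 < α) (hβ : 0 < β)
    (a : Coefficient s D n s.curlDim α β) (b : Coefficient s D n s.dim α β)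
    (f : Lp (HField s D) 2 (timeMeasure T)) (g₀ : WSpace s D) (g₁ : HField s D) :
    ∃! u : SolutionSpace s D n T,
      IsMultiscaleSolution T a b f g₀ g₁ u.1 (fun i => u.2.1 i) (fun i => u.2.2 i) := by
  have := isFiniteMeasure_domMeasure hD_bounded
  obtain ⟨N, C, hN, hC, hCs, hCc⟩ := exists_homogenized_mass hα b
  obtain ⟨M, A, hM, hA, hAs, hAc⟩ := exists_homogenized_stiffness hα a
  have hf : MemL2Time T f := Lp.memLp f
  refine existsUnique_of_exists_of_unique ?_ fun u v hu hv => ?_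
  · obtain ⟨u, z, hu, hz, h1, h2⟩ := wave_exists hT hα hα hCs hCc hAs hAc WSpace.norm_val_le f g₀ g₁
    have hJ : IsPrim T (fun t => WSpace.val s D (u t)) (WSpace.val s D g₀) z := ⟨hz.integrable, h1⟩
    have hsol := isMultiscaleSolution_of_homogenized hT hN hC hM hA hf hu hz hJ
      ⟨(memL2Time_load hf hu).integrable, h2⟩
    have hc : ∀ i : Fin n, MemLp (fun t => M (liftBase s D n _ (WSpace.curl s D (u t))) i) 2
        (timeMeasure T) := fun i =>
      hu.clm ((ContinuousLinearMap.proj i).comp (M.comp ((liftBase s D n _).comp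
        (WSpace.curl s D))))
    have hV : ∀ i : Fin n, MemLp (fun t => N (liftBase s D n _
        (WSpace.val s D (u t) - WSpace.val s D g₀ - t • g₁)) i) 2 (timeMeasure T) := fun i =>
      MemL2Time.clm ((ContinuousLinearMap.proj i).comp (N.comp (liftBase s D n _)))
        (((hJ.sub (.const T (WSpace.val s D g₀))).sub (.linear T g₁)).memL2Time hT)
    refine ⟨(hu.toLp u, fun i => (hc i).toLp _, fun i => (hV i).toLp _), ?_⟩
    exact hsol.congr hu.coeFn_toLp.symm (fun i => (hc i).coeFn_toLp.symm)
      (fun i => (hV i).coeFn_toLp.symm)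
  · obtain ⟨⟨z, hz, hJ, hw⟩, hc, hV⟩ :=
      hu.homogenized hT hα hN hC hM hA
    obtain ⟨⟨z', hz', hJ', hw'⟩, hc', hV'⟩ :=
      hv.homogenized hT hα hN hC hM hA
    have hd1 := hJ.sub hJ'
    have hd2 := hw.sub hw'
    rw [sub_self] at hd1 hd2
    -- The load and the initial data cancel in the difference, which solves the homogenized wave
    -- equation with zero data.
    have h0 : (fun t => u.1 t - v.1 t) =ᵐ[timeMeasure T] 0 := by
      refine wave_unique hT hα hα hCs hCc hAs hAc WSpace.norm_val_le (z := fun t => z t - z' t)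
        (MemL2Time.integrable (MemLp.sub (Lp.memLp u.1) (Lp.memLp v.1))) hd1.1 ?_ ?_
      · filter_upwards [hd1.2] with t ht
        rw [map_sub, ht, zero_add]
      · filter_upwards [hd2.2] with t ht
        rw [map_sub, ContinuousLinearMap.sub_comp, ht, zero_add, ← intervalIntegral.integral_neg]
        refine intervalIntegral.integral_congr fun r _ => ?_
        simp only [map_sub]
        abel
    have h1 : u.1 =ᵐ[timeMeasure T] v.1 := by
      filter_upwards [h0] with t ht
      exact sub_eq_zero.1 ht
    -- The fast components agree because both are the same corrector maps applied to the common
    -- `u₀`.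
    refine Prod.ext (Lp.ext h1) (Prod.ext (funext fun i => Lp.ext ?_) (funext fun i => Lp.ext ?_))
    · filter_upwards [h1, hc, hc'] with t e1 e2 e3
      rw [e1, ← e3] at e2
      exact congrFun e2 i
    · filter_upwards [h1, hV, hV'] with t e1 e2 e3
      rw [e1, ← e3] at e2
      exact congrFun e2 i
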